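/- Let $d\ge 1$ and $k\ge 1$ be integers and write the points of $\mathbb{R}^d$ as $(x_1,x')\in\mathbb{R}\times\mathbb{R}^{d-1}$. A \emph{Neumann domain} is a bounded connected open set $\Omega\subset\mathbb{R}^d$ for which the embedding $H^1(\Omega)\hookrightarrow L^2(\Omega)$ is compact (for instance a bounded connected Lipschitz open set). $D(\Omega)$ denotes its diameter, and $$\mu_k(\Omega)=\inf_{E}\ \sup_{0\ne u\in E}\frac{\int_\Omega|\nabla u|^2\,dx}{\int_\Omega u^2\,dx}$$ its $k$-th nontrivial Neumann eigenvalue, where the infimum is over all $k$-dimensional subspaces $E$ of $H^1(\Omega)$ whose elements satisfy $\int_\Omega u\,dx=0$. The profile function of $\Omega$ is $g_\Omega(x_1)=\mathcal{H}^{d-1}(\{x'\in\mathbb{R}^{d-1} : (x_1,x')\in\Omega\})$. For a nonnegative $h\in L^\infty(0,1)$ let $$\mu_k(h)=\inf_{E}\ \sup_{0\ne u\in E}\frac{\int_0^1(u')^2h\,dx}{\int_0^1u^2h\,dx}\in[0,\infty],$$ where the infimum is over all $k$-dimensional subspaces $E$ of $H^1(0,1)$ whose elements satisfy $\int_0^1uh\,dx=0$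 (a quotient with zero denominator counts as $+\infty$). Let $h\in L^\infty(0,1)$ be nonnegative and not identically zero. Let $\Omega_h\subset\mathbb{R}^d$ be a Neumann domain whose projection on the $x_1$-axis is $(0,1)$, whose profile function equals $h$ almost everywhere on $(0,1)$, and whose slices $\{x' : (x_1,x')\in\Omega_h\}$ are connected for almost every $x_1\in(0,1)$. For $\epsilon>0$ put $\Omega_{\epsilon,h}=\{(x_1,\epsilon x') : (x_1,x')\in\Omega_h\}$. Then each $\Omega_{\epsilon,h}$ is a Neumann domain with profile function $\epsilon^{d-1}h$ almost everywhere on $(0,1)$, and $$\lim_{\epsilon\to0^+}D(\Omega_{\epsilon,h})^2\,\mu_k(\Omega_{\epsilon,h})=\mu_k(h).$$ -/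

import Mathlib

open MeasureTheory Set Filter Topology
open scoped ENNReal ContDiff

noncomputable section

namespace ThinNeumann

section Sobolev

variable {E : Type*} [NormedAddCommGroup E] [InnerProductSpace ℝ E] [MeasureSpace E]

/-- `g` is the weak gradient of `u` on `Ω`:
`∫_Ω u ∂_v φ = - ∫_Ω ⟪g, v⟫ φ` for all test functions `φ ∈ C_c^∞(Ω)` and all directions `v`. -/
def IsWeakGradient (Ω : Set E) (u : E → ℝ) (g : E → E) : Prop :=
  ∀ φ : E → ℝ, ContDiff ℝ ∞ φ → HasCompactSupport φ → tsupport φ ⊆ Ω → ∀ v : E,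
    ∫ x in Ω, u x * fderiv ℝ φ x v = -∫ x in Ω, inner ℝ (g x) v * φ x

variable [BorelSpace E] [IsFiniteMeasureOnCompacts (volume : Measure E)]

theorem integrable_mul_test {E : Type*} [NormedAddCommGroup E] [MeasureSpace E] [BorelSpace E]
    [IsFiniteMeasureOnCompacts (volume : Measure E)] {Ω : Set E} {u ψ : E → ℝ}
    (hu : MemLp u 2 (volume.restrict Ω)) (hψ : Continuous ψ) (hc : HasCompactSupport ψ) :
    Integrable (fun x => u x * ψ x) (volume.restrict Ω) :=
  hu.integrable_mul (q := 2) ((hψ.memLp_of_hasCompactSupport hc).restrict Ω)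

theorem integrable_mul_fderiv {Ω : Set E} {u φ : E → ℝ}
    (hu : MemLp u 2 (volume.restrict Ω)) (hφ : ContDiff ℝ ∞ φ) (hc : HasCompactSupport φ)
    (v : E) : Integrable (fun x => u x * fderiv ℝ φ x v) (volume.restrict Ω) :=
  integrable_mul_test hu ((hφ.continuous_fderiv (by simp)).clm_apply continuous_const)
    (hc.fderiv_apply ℝ v)

theorem integrable_inner_mul_test {Ω : Set E} {g : E → E} {φ : E → ℝ}
    (hg : MemLp g 2 (volume.restrict Ω)) (hφ : ContDiff ℝ ∞ φ) (hc : HasCompactSupport φ)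
    (v : E) : Integrable (fun x => inner ℝ (g x) v * φ x) (volume.restrict Ω) :=
  integrable_mul_test (u := fun x => inner ℝ (g x) v) (hg.inner_const v) hφ.continuous hc

/-- The Sobolev space `H¹(Ω)`, as the space of pairs `(u, ∇u)` with `u ∈ L²(Ω)` whose weak
gradient `∇u` is in `L²(Ω)`. For open `Ω` the weak gradient is determined by `u`. -/
def H1 (Ω : Set E) :
    Submodule ℝ (Lp ℝ 2 (volume.restrict Ω) × Lp E 2 (volume.restrict Ω)) where
  carrier := {p | IsWeakGradient Ω p.1 p.2}
  zero_mem' := by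
    intro φ _ _ _ v
    have h1 : ∫ x in Ω, (0 : Lp ℝ 2 (volume.restrict Ω)) x * fderiv ℝ φ x v = 0 := by
      refine integral_eq_zero_of_ae ?_
      filter_upwards [Lp.coeFn_zero ℝ 2 (volume.restrict Ω)] with x hx
      simp only [hx, Pi.zero_apply, zero_mul]
    have h2 : ∫ x in Ω, inner ℝ ((0 : Lp E 2 (volume.restrict Ω)) x) v * φ x = 0 := by
      refine integral_eq_zero_of_ae ?_
      filter_upwards [Lp.coeFn_zero E 2 (volume.restrict Ω)] with x hx
      simp only [hx, Pi.zero_apply, inner_zero_left, zero_mul]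
    exact h1.trans (by rw [Prod.snd_zero, h2, neg_zero])
  add_mem' := by
    intro p q hp hq φ h1 h2 h3 v
    have e1 : ∫ x in Ω, (p + q).1 x * fderiv ℝ φ x v
        = (∫ x in Ω, p.1 x * fderiv ℝ φ x v) + ∫ x in Ω, q.1 x * fderiv ℝ φ x v := by
      rw [← integral_add (integrable_mul_fderiv (Lp.memLp p.1) h1 h2 v)
        (integrable_mul_fderiv (Lp.memLp q.1) h1 h2 v)]
      refine integral_congr_ae ?_
      filter_upwards [Lp.coeFn_add p.1 q.1] with x hx
      simp only [Prod.fst_add, hx, Pi.add_apply, add_mul]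
    have e2 : ∫ x in Ω, inner ℝ ((p + q).2 x) v * φ x
        = (∫ x in Ω, inner ℝ (p.2 x) v * φ x) + ∫ x in Ω, inner ℝ (q.2 x) v * φ x := by
      rw [← integral_add (integrable_inner_mul_test (Lp.memLp p.2) h1 h2 v)
        (integrable_inner_mul_test (Lp.memLp q.2) h1 h2 v)]
      refine integral_congr_ae ?_
      filter_upwards [Lp.coeFn_add p.2 q.2] with x hx
      simp only [Prod.snd_add, hx, Pi.add_apply, inner_add_left, add_mul]
    rw [e1, e2, hp φ h1 h2 h3 v, hq φ h1 h2 h3 v, neg_add]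
  smul_mem' := by
    intro c p hp φ h1 h2 h3 v
    have e1 : ∫ x in Ω, (c • p).1 x * fderiv ℝ φ x v
        = c * ∫ x in Ω, p.1 x * fderiv ℝ φ x v := by
      rw [← integral_const_mul]
      refine integral_congr_ae ?_
      filter_upwards [Lp.coeFn_smul c p.1] with x hx
      simp only [Prod.smul_fst, hx, Pi.smul_apply, smul_eq_mul, mul_assoc]
    have e2 : ∫ x in Ω, inner ℝ ((c • p).2 x) v * φ x
        = c * ∫ x in Ω, inner ℝ (p.2 x) v * φ x := by
      rw [← integral_const_mul]
      refine integral_congr_ae ?_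
      filter_upwards [Lp.coeFn_smul c p.2] with x hx
      simp only [Prod.smul_snd, hx, Pi.smul_apply, real_inner_smul_left, mul_assoc]
    rw [e1, e2, hp φ h1 h2 h3 v, mul_neg]

/-- The weighted Rayleigh quotient `∫_Ω |∇u|² w / ∫_Ω u² w`, with value `∞` when the denominator
vanishes. -/
def rayleigh (Ω : Set E) (w : E → ℝ) (u : H1 Ω) : ℝ≥0∞ :=
  if ∫⁻ x in Ω, ‖u.1.1 x‖ₑ ^ 2 * ENNReal.ofReal (w x) = 0 then ⊤ else
    (∫⁻ x in Ω, ‖u.1.2 x‖ₑ ^ 2 * ENNReal.ofReal (w x)) /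
      ∫⁻ x in Ω, ‖u.1.1 x‖ₑ ^ 2 * ENNReal.ofReal (w x)

/-- The infimum, over the `k`-dimensional subspaces `V` of `H¹(Ω)` whose elements satisfy
`∫_Ω u w = 0`, of the supremum over `0 ≠ u ∈ V` of the weighted Rayleigh quotient. -/
def minmax (Ω : Set E) (w : E → ℝ) (k : ℕ) : ℝ≥0∞ :=
  ⨅ (V : Submodule ℝ (H1 Ω)) (_ : Module.Finite ℝ V ∧ Module.finrank ℝ V = k)
    (_ : ∀ u ∈ V, ∫ x in Ω, u.1.1 x * w x = 0),
    ⨆ (u : H1 Ω) (_ : u ∈ V) (_ : u ≠ 0), rayleigh Ω w u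

/-- The `k`-th nontrivial Neumann eigenvalue `μ_k(Ω)` of the Laplacian, `k ≥ 1`. -/
def neumannEigenvalue (Ω : Set E) (k : ℕ) : ℝ≥0∞ := minmax Ω (fun _ => 1) k

/-- The domains on which the Neumann problem is considered: bounded, connected, open, with compact
embedding `H¹(Ω) → L²(Ω)`. -/
structure IsNeumannDomain (Ω : Set E) : Prop where
  isOpen : IsOpen Ω
  isBounded : Bornology.IsBounded Ω
  isConnected : IsConnected Ω
  compact_embedding : IsCompactOperator (fun u : H1 Ω => u.1.1)

end Sobolev

/-- The relaxed Sturm-Liouville eigenvalue `μ_k(h)` of a nonnegative `h ∈ L^∞(0,1)`, `k ≥ 1`. -/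
def sturmLiouvilleEigenvalue (h : ℝ → ℝ) (k : ℕ) : ℝ≥0∞ := minmax (Ioo (0 : ℝ) 1) h k

/-- The point `(t, y) ∈ ℝ × ℝⁿ = ℝ^{n+1}`. -/
def point {n : ℕ} (t : ℝ) (y : EuclideanSpace ℝ (Fin n)) : EuclideanSpace ℝ (Fin (n + 1)) :=
  WithLp.toLp 2 (Fin.cons t y)

/-- The slice `{y ∈ ℝⁿ | (t, y) ∈ Ω}`. -/
def slice {n : ℕ} (Ω : Set (EuclideanSpace ℝ (Fin (n + 1)))) (t : ℝ) :
    Set (EuclideanSpace ℝ (Fin n)) := {y | point t y ∈ Ω}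

/-- The profile function of `Ω`: the `n`-dimensional measure of the slices. -/
def profile {n : ℕ} (Ω : Set (EuclideanSpace ℝ (Fin (n + 1)))) (t : ℝ) : ℝ :=
  (volume : Measure (EuclideanSpace ℝ (Fin n))).real (slice Ω t)

/-- The thin set `{(t, ε y) | (t, y) ∈ Ω}`. -/
def thin {n : ℕ} (ε : ℝ) (Ω : Set (EuclideanSpace ℝ (Fin (n + 1)))) :
    Set (EuclideanSpace ℝ (Fin (n + 1))) :=
  {z | ∃ (t : ℝ) (y : EuclideanSpace ℝ (Fin n)), point t y ∈ Ω ∧ z = point t (ε • y)}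

end ThinNeumann

end

/-!
The thin set `thin ε Ω` is the image of `Ω` under the linear map `(t, y) ↦ (t, ε y)`, which is
self-adjoint, so `H¹` and the compactness of its embedding are transported by pulling back
(`pullbackH1`, `isNeumannDomain_thin`). Its diameter lies between `1` and `1 + ε diam Ω`
(`one_le_diam`, `diam_thin_le`), so that only the eigenvalues matter in the limit. By Fubini the
image of Lebesgue measure on `Ω` under `x ↦ x₁` is `h dt` (`map_apply_zero_eq_weightMeasure`), and
`h > 0` almost everywhere because the slices over `(0, 1)` are open and nonempty.

*Upper bound.* An element `u` of `H¹(0, 1)`, read as the function `x ↦ u(x₁)`, is in `H¹(thin ε Ω)`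
with gradient `u'(x₁) e₁`, and the factor `ε ^ n` cancels in its Rayleigh quotient. Hence the
eigenvalue of `thin ε Ω` is at most that of `h`, for every `ε`
(`neumannEigenvalue_le_sturmLiouvilleEigenvalue`).

*Lower bound.* Suppose that the eigenvalue of `thin ε Ω` is less than `lam` for arbitrarily small
`ε`. An admissible subspace, pulled back to `Ω`, has an `L²(Ω)`-orthonormal basis bounded in
`H¹(Ω)`, and a combination `f = ∑ cᵢ uᵢ` of its members satisfies
`|∫ f ∂ᵥφ| ≤ √lam |c| |(v₁, ε v')| ‖φ‖` for all test functions `φ` (`exists_orthonormal_family`).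
By the compact embedding there is a limit family, orthonormal in `L²(Ω)`, for which the same bound
holds with `|v₁|` in place of `|(v₁, ε v')|` (`exists_limit_family`). Stating the bound on the
gradient by duality against test functions makes this passage to the limit a matter of continuity.

The limit functions thus have vanishing transversal derivatives. Their derivative `g` along `e₁`
exists in `L²(Ω)` by Riesz representation, and its transversal derivatives vanish as well; since
the slices are connected, `g = γ(x₁)` (`exists_ae_eq_comp_apply_zero`). The difference of the
limit function and a primitive of `γ` has zero weak gradient on the connected set `Ω`, so that it is
constant (`exists_primitive_of_abs_le`).

The primitives `w` so obtained are in `L²(h)` with derivative in `L²(h)`, but need not be in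
`H¹(0, 1)`, as `h` may degenerate at the endpoints. Stopping `w` at points `a` near `0` and `b` near
`1` gives elements of `H¹(0, 1)` with no larger energy. They are close to `w` in `L²(h)` provided
that `w(a)` and `w(b)` are controlled by weighted means of `w` near the endpoints
(`exists_small_left`, `exists_truncation_close`). This bounds the eigenvalue of `h` by `lam`
(`sturmLiouvilleEigenvalue_le_of_primitives`).
-/

noncomputable section

namespace ThinNeumann

/-! ### Fubini in the coordinates `(t, y)` -/

section Coordinates

variable {n : ℕ}

/-- The transversal part `y` of the point `x = (t, y)`. -/
def transversal (x : EuclideanSpace ℝ (Fin (n + 1))) : EuclideanSpace ℝ (Fin n) :=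
  WithLp.toLp 2 (fun i => x i.succ)

@[simp] theorem point_apply_zero (t : ℝ) (y : EuclideanSpace ℝ (Fin n)) : point t y 0 = t := rfl

@[simp] theorem transversal_point (t : ℝ) (y : EuclideanSpace ℝ (Fin n)) :
    transversal (point t y) = y := by
  ext i; simp [transversal, point]

@[simp] theorem point_transversal (x : EuclideanSpace ℝ (Fin (n + 1))) :
    point (x 0) (transversal x) = x := by
  ext i
  refine Fin.cases ?_ (fun i => ?_) i <;> simp [transversal, point]

theorem point_add (s t : ℝ) (y z : EuclideanSpace ℝ (Fin n)) :
    point (s + t) (y + z) = point s y + point t z := by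
  ext i
  refine Fin.cases ?_ (fun i => ?_) i <;> simp [point]

theorem point_smul (c t : ℝ) (y : EuclideanSpace ℝ (Fin n)) :
    point (c * t) (c • y) = c • point t y := by
  ext i
  refine Fin.cases ?_ (fun i => ?_) i <;> simp [point]

theorem continuous_apply_zero :
    Continuous (fun x : EuclideanSpace ℝ (Fin (n + 1)) => x 0) := by fun_prop

theorem continuous_transversal :
    Continuous (transversal : EuclideanSpace ℝ (Fin (n + 1)) → EuclideanSpace ℝ (Fin n)) := by
  unfold transversal
  fun_prop

theorem continuous_point :
    Continuous (fun p : ℝ × EuclideanSpace ℝ (Fin n) => point p.1 p.2) := by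
  unfold point
  refine (PiLp.continuous_toLp 2 _).comp (continuous_pi fun i => ?_)
  refine Fin.cases ?_ (fun i => ?_) i
  · simpa using continuous_fst
  · simp only [Fin.cons_succ]
    fun_prop

theorem continuous_point_right (t : ℝ) :
    Continuous (fun y : EuclideanSpace ℝ (Fin n) => point t y) :=
  continuous_point.comp (Continuous.prodMk_right t)

theorem continuous_point_left (y : EuclideanSpace ℝ (Fin n)) :
    Continuous (fun t : ℝ => point t y) :=
  continuous_point.comp (Continuous.prodMk_left y)

/-- The homeomorphism `(t, y) ↦ point t y`. -/
def pointHomeo (n : ℕ) :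
    (ℝ × EuclideanSpace ℝ (Fin n)) ≃ₜ EuclideanSpace ℝ (Fin (n + 1)) where
  toFun p := point p.1 p.2
  invFun x := (x 0, transversal x)
  left_inv p := by simp
  right_inv x := by simp
  continuous_toFun := continuous_point
  continuous_invFun := continuous_apply_zero.prodMk continuous_transversal

theorem measurePreserving_point :
    MeasurePreserving (fun p : ℝ × EuclideanSpace ℝ (Fin n) => point p.1 p.2)
      (volume.prod volume) volume := by
  have h1 : MeasurePreserving (fun p : ℝ × EuclideanSpace ℝ (Fin n) => (p.1, WithLp.ofLp p.2))
      (volume.prod volume) (volume.prod volume) :=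
    (MeasurePreserving.id volume).prod (PiLp.volume_preserving_ofLp (Fin n))
  have h2 := ((volume_preserving_piFinSuccAbove (fun _ : Fin (n + 1) => ℝ) 0).symm _).comp h1
  have h3 := (PiLp.volume_preserving_toLp (Fin (n + 1))).comp h2
  have h4 : (fun p : ℝ × EuclideanSpace ℝ (Fin n) => point p.1 p.2) =
      WithLp.toLp 2 ∘ (MeasurableEquiv.piFinSuccAbove (fun _ : Fin (n + 1) => ℝ) 0).symm ∘
        fun p => (p.1, WithLp.ofLp p.2) := by
    funext p
    simp [point, MeasurableEquiv.piFinSuccAbove, Fin.insertNthEquiv]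
  rw [h4]
  exact h3

theorem measurableEmbedding_point :
    MeasurableEmbedding (fun p : ℝ × EuclideanSpace ℝ (Fin n) => point p.1 p.2) :=
  (pointHomeo n).measurableEmbedding

variable {Ω : Set (EuclideanSpace ℝ (Fin (n + 1)))}

theorem isOpen_slice (hΩ : IsOpen Ω) (t : ℝ) : IsOpen (slice Ω t) :=
  hΩ.preimage (continuous_point_right t)

theorem lintegral_point {f : EuclideanSpace ℝ (Fin (n + 1)) → ℝ≥0∞} (hΩ : IsOpen Ω)
    (hf : AEMeasurable f (volume.restrict Ω)) :
    ∫⁻ x in Ω, f x = ∫⁻ t, ∫⁻ y in slice Ω t, f (point t y) := by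
  rw [← lintegral_indicator hΩ.measurableSet,
    ← measurePreserving_point.lintegral_comp_emb measurableEmbedding_point,
    lintegral_prod]
  · refine lintegral_congr fun t => ?_
    rw [← lintegral_indicator (isOpen_slice hΩ t).measurableSet]
    rfl
  · exact ((aemeasurable_indicator_iff hΩ.measurableSet).2 hf).comp_quasiMeasurePreserving
      measurePreserving_point.quasiMeasurePreserving

theorem integral_point {f : EuclideanSpace ℝ (Fin (n + 1)) → ℝ} (hf : Integrable f) :
    ∫ x, f x = ∫ t, ∫ y, f (point t y) := by
  rw [← measurePreserving_point.integral_comp measurableEmbedding_point, integral_prod]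
  exact (measurePreserving_point.integrable_comp_emb measurableEmbedding_point).2 hf

theorem integral_point_swap {f : EuclideanSpace ℝ (Fin (n + 1)) → ℝ} (hf : Integrable f) :
    ∫ x, f x = ∫ y, ∫ t, f (point t y) := by
  rw [← measurePreserving_point.integral_comp measurableEmbedding_point, integral_prod_symm]
  exact (measurePreserving_point.integrable_comp_emb measurableEmbedding_point).2 hf

theorem measurable_volume_slice (hΩ : IsOpen Ω) :
    Measurable (fun t => (volume : Measure (EuclideanSpace ℝ (Fin n))) (slice Ω t)) :=
  measurable_measure_prodMk_left (hΩ.preimage continuous_point).measurableSet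

theorem mem_Ioo_of_mem_slice
    (hproj : (fun x : EuclideanSpace ℝ (Fin (n + 1)) => x 0) '' Ω = Ioo 0 1) {t : ℝ}
    {y : EuclideanSpace ℝ (Fin n)} (hy : point t y ∈ Ω) : t ∈ Ioo (0 : ℝ) 1 :=
  hproj ▸ ⟨_, hy, rfl⟩

theorem slice_nonempty
    (hproj : (fun x : EuclideanSpace ℝ (Fin (n + 1)) => x 0) '' Ω = Ioo 0 1) {t : ℝ}
    (ht : t ∈ Ioo (0 : ℝ) 1) : (slice Ω t).Nonempty := by
  rw [← hproj] at ht
  obtain ⟨x, hx, rfl⟩ := ht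
  exact ⟨transversal x, by simpa [slice] using hx⟩

theorem volume_slice_pos (hΩ : IsOpen Ω)
    (hproj : (fun x : EuclideanSpace ℝ (Fin (n + 1)) => x 0) '' Ω = Ioo 0 1) {t : ℝ}
    (ht : t ∈ Ioo (0 : ℝ) 1) : 0 < (volume : Measure (EuclideanSpace ℝ (Fin n))) (slice Ω t) :=
  (isOpen_slice hΩ t).measure_pos _ (slice_nonempty hproj ht)

theorem norm_transversal_le (x : EuclideanSpace ℝ (Fin (n + 1))) : ‖transversal x‖ ≤ ‖x‖ := by
  rw [EuclideanSpace.norm_eq, EuclideanSpace.norm_eq, Fin.sum_univ_succ]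
  refine Real.sqrt_le_sqrt ?_
  have : (0 : ℝ) ≤ ‖x 0‖ ^ 2 := by positivity
  simpa [transversal] using this

theorem volume_slice_lt_top (hΩ : Bornology.IsBounded Ω) (t : ℝ) :
    (volume : Measure (EuclideanSpace ℝ (Fin n))) (slice Ω t) < ⊤ := by
  obtain ⟨R, hR⟩ := hΩ.subset_closedBall 0
  refine (measure_mono (t := Metric.closedBall 0 R) fun y hy => ?_).trans_lt
    measure_closedBall_lt_top
  have h1 := hR hy
  rw [mem_closedBall_zero_iff] at h1 ⊢
  have h2 := norm_transversal_le (point t y)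
  rw [transversal_point] at h2
  exact h2.trans h1

/-- The image under `x ↦ x₁` of Lebesgue measure on `Ω` has the profile function as density. -/
theorem map_apply_zero_restrict (hΩ : IsOpen Ω)
    (hproj : (fun x : EuclideanSpace ℝ (Fin (n + 1)) => x 0) '' Ω = Ioo 0 1) :
    (volume.restrict Ω).map (fun x : EuclideanSpace ℝ (Fin (n + 1)) => x 0) =
      (volume.restrict (Ioo (0 : ℝ) 1)).withDensity
        (fun t => (volume : Measure (EuclideanSpace ℝ (Fin n))) (slice Ω t)) := by
  have hm : Measurable (fun x : EuclideanSpace ℝ (Fin (n + 1)) => x 0) :=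
    continuous_apply_zero.measurable
  ext s hs
  rw [Measure.map_apply hm hs, withDensity_apply _ hs, ← lintegral_indicator_one (hm hs),
    lintegral_point hΩ ((measurable_one.indicator (hm hs)).aemeasurable),
    ← lintegral_indicator hs, ← lintegral_indicator measurableSet_Ioo]
  refine lintegral_congr fun t => ?_
  have h1 : ∀ y : EuclideanSpace ℝ (Fin n),
      ((fun x : EuclideanSpace ℝ (Fin (n + 1)) => x 0) ⁻¹' s).indicator
        (1 : EuclideanSpace ℝ (Fin (n + 1)) → ℝ≥0∞) (point t y) = s.indicator 1 t := fun y => by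
    by_cases hts : t ∈ s
    · rw [indicator_of_mem hts, indicator_of_mem (by simpa using hts)]; rfl
    · rw [indicator_of_notMem hts, indicator_of_notMem (by simpa using hts)]
  simp only [h1, lintegral_const, Measure.restrict_apply_univ]
  by_cases ht : t ∈ Ioo (0 : ℝ) 1
  · rw [indicator_of_mem ht]
    by_cases hts : t ∈ s <;> simp [hts]
  · have h0 : slice Ω t = ∅ :=
      eq_empty_of_forall_notMem fun y hy => ht (mem_Ioo_of_mem_slice hproj hy)
    rw [indicator_of_notMem ht]
    simp [h0]

/-- The measure `h dt` on the interval `(0, 1)`. -/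
def weightMeasure (h : ℝ → ℝ) : Measure ℝ :=
  (volume.restrict (Ioo (0 : ℝ) 1)).withDensity (fun t => ENNReal.ofReal (h t))

theorem map_apply_zero_eq_weightMeasure (hΩ : IsOpen Ω) (hb : Bornology.IsBounded Ω)
    (hproj : (fun x : EuclideanSpace ℝ (Fin (n + 1)) => x 0) '' Ω = Ioo 0 1) {h : ℝ → ℝ}
    (hprofile : profile Ω =ᵐ[volume.restrict (Ioo (0 : ℝ) 1)] h) :
    (volume.restrict Ω).map (fun x : EuclideanSpace ℝ (Fin (n + 1)) => x 0) =
      weightMeasure h := by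
  rw [map_apply_zero_restrict hΩ hproj]
  refine withDensity_congr_ae ?_
  filter_upwards [hprofile] with t ht
  rw [← ht, profile, measureReal_def, ENNReal.ofReal_toReal (volume_slice_lt_top hb t).ne]

theorem profile_pos (hΩ : IsOpen Ω) (hb : Bornology.IsBounded Ω)
    (hproj : (fun x : EuclideanSpace ℝ (Fin (n + 1)) => x 0) '' Ω = Ioo 0 1) {t : ℝ}
    (ht : t ∈ Ioo (0 : ℝ) 1) : 0 < profile Ω t :=
  ENNReal.toReal_pos (volume_slice_pos hΩ hproj ht).ne' (volume_slice_lt_top hb t).ne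

end Coordinates

/-! ### Linear changes of variables in `H¹` -/

section Pullback

variable {E : Type*} [NormedAddCommGroup E] [InnerProductSpace ℝ E]

/-- The factor by which the linear map `A` multiplies the push-forward of Lebesgue measure. -/
def jacobianFactor (A : E ≃L[ℝ] E) : ℝ≥0∞ :=
  ENNReal.ofReal |(LinearMap.det (A : E →ₗ[ℝ] E))⁻¹|

theorem jacobianFactor_ne_zero (A : E ≃L[ℝ] E) : jacobianFactor A ≠ 0 := by
  have : (LinearMap.det (A : E →ₗ[ℝ] E)) ≠ 0 := A.toLinearEquiv.isUnit_det'.ne_zero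
  simpa [jacobianFactor] using this

theorem jacobianFactor_ne_top (A : E ≃L[ℝ] E) : jacobianFactor A ≠ ⊤ := ENNReal.ofReal_ne_top

section Congr

variable [MeasureSpace E]

theorem IsWeakGradient.congr_ae {Ω : Set E} {u u' : E → ℝ} {g g' : E → E}
    (hu : IsWeakGradient Ω u g)
    (h1 : u =ᵐ[volume.restrict Ω] u') (h2 : g =ᵐ[volume.restrict Ω] g') :
    IsWeakGradient Ω u' g' := by
  intro φ hφ hc hs v
  have e1 : ∫ x in Ω, u' x * fderiv ℝ φ x v = ∫ x in Ω, u x * fderiv ℝ φ x v :=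
    integral_congr_ae (by filter_upwards [h1] with x hx; rw [hx])
  have e2 : ∫ x in Ω, inner ℝ (g' x) v * φ x = ∫ x in Ω, inner ℝ (g x) v * φ x :=
    integral_congr_ae (by filter_upwards [h2] with x hx; rw [hx])
  rw [e1, e2, hu φ hφ hc hs v]

end Congr

variable [FiniteDimensional ℝ E] [MeasureSpace E] [BorelSpace E]
  [(volume : Measure E).IsAddHaarMeasure]
  {F : Type*} [NormedAddCommGroup F] {Ω Ω' : Set E} (A : E ≃L[ℝ] E)

theorem map_restrict_of_image_eq (h : Ω' = A '' Ω) :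
    (volume.restrict Ω).map A = jacobianFactor A • volume.restrict Ω' := by
  have h1 : A ⁻¹' Ω' = Ω := by rw [h, preimage_image_eq _ A.injective]
  have h2 := A.toHomeomorph.measurableEmbedding.restrict_map volume Ω'
  have h3 : Measure.map A (volume : Measure E) = jacobianFactor A • volume :=
    Measure.map_linearMap_addHaar_eq_smul_addHaar volume
      (f := (A : E →ₗ[ℝ] E)) A.toLinearEquiv.isUnit_det'.ne_zero
  simp only [ContinuousLinearEquiv.coe_toHomeomorph] at h2
  rw [h1, h3, Measure.restrict_smul] at h2
  exact h2.symm

theorem quasiMeasurePreserving_of_image_eq (h : Ω' = A '' Ω) :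
    Measure.QuasiMeasurePreserving A (volume.restrict Ω) (volume.restrict Ω') :=
  ⟨A.continuous.measurable, by
    rw [map_restrict_of_image_eq A h]; exact Measure.smul_absolutelyContinuous⟩

theorem eLpNorm_comp_of_image_eq (h : Ω' = A '' Ω) (u : E → F) :
    eLpNorm (fun x => u (A x)) 2 (volume.restrict Ω) =
      jacobianFactor A ^ (1 / 2 : ℝ) * eLpNorm u 2 (volume.restrict Ω') := by
  have h1 := A.toHomeomorph.measurableEmbedding.eLpNorm_map_measure (g := u) (p := 2)
    (μ := volume.restrict Ω)
  simp only [ContinuousLinearEquiv.coe_toHomeomorph] at h1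
  rw [map_restrict_of_image_eq A h, eLpNorm_smul_measure_of_ne_top (by simp)] at h1
  simpa [Function.comp_def] using h1.symm

theorem setIntegral_comp_of_image_eq (h : Ω' = A '' Ω) (f : E → ℝ) :
    ∫ x in Ω, f (A x) = (jacobianFactor A).toReal * ∫ z in Ω', f z := by
  have h1 := A.toHomeomorph.measurableEmbedding.integral_map (μ := volume.restrict Ω) f
  simp only [ContinuousLinearEquiv.coe_toHomeomorph] at h1
  rw [← h1, map_restrict_of_image_eq A h, integral_smul_measure, smul_eq_mul]

theorem memLp_comp_of_image_eq (h : Ω' = A '' Ω) {u : E → F}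
    (hu : MemLp u 2 (volume.restrict Ω')) :
    MemLp (fun x => u (A x)) 2 (volume.restrict Ω) := by
  refine ⟨hu.1.comp_quasiMeasurePreserving (quasiMeasurePreserving_of_image_eq A h), ?_⟩
  rw [eLpNorm_comp_of_image_eq A h]
  exact ENNReal.mul_lt_top (ENNReal.rpow_lt_top_of_nonneg (by norm_num)
    (jacobianFactor_ne_top A)) hu.2

/-- Composition with `A`, as a bounded operator from `L²(A(Ω))` to `L²(Ω)`. -/
def pullbackLp (F : Type*) [NormedAddCommGroup F] [NormedSpace ℝ F] (h : Ω' = A '' Ω) :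
    Lp F 2 (volume.restrict Ω') →L[ℝ] Lp F 2 (volume.restrict Ω) :=
  LinearMap.mkContinuous
    { toFun := fun u => (memLp_comp_of_image_eq A h (Lp.memLp u)).toLp
      map_add' := by
        intro u v
        rw [← MemLp.toLp_add]
        refine MemLp.toLp_congr _ _ ?_
        exact (quasiMeasurePreserving_of_image_eq A h).ae_eq_comp (Lp.coeFn_add u v)
      map_smul' := by
        intro c u
        rw [RingHom.id_apply, ← MemLp.toLp_const_smul]
        refine MemLp.toLp_congr _ _ ?_
        exact (quasiMeasurePreserving_of_image_eq A h).ae_eq_comp (Lp.coeFn_smul c u) }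
    ((jacobianFactor A ^ (1 / 2 : ℝ)).toReal) (by
      intro u
      simp only [LinearMap.coe_mk, AddHom.coe_mk]
      rw [Lp.norm_toLp, eLpNorm_comp_of_image_eq A h, ENNReal.toReal_mul, Lp.norm_def])

theorem coeFn_pullbackLp [NormedSpace ℝ F] (h : Ω' = A '' Ω) (u : Lp F 2 (volume.restrict Ω')) :
    pullbackLp A F h u =ᵐ[volume.restrict Ω] fun x => u (A x) :=
  (memLp_comp_of_image_eq A h (Lp.memLp u)).coeFn_toLp

theorem IsWeakGradient.comp_of_image_eq (h : Ω' = A '' Ω)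
    (hA : ∀ x y, inner ℝ (A x) y = inner ℝ x (A y)) {u : E → ℝ} {g : E → E}
    (hu : IsWeakGradient Ω' u g) :
    IsWeakGradient Ω (fun x => u (A x)) (fun x => A (g (A x))) := by
  intro φ h1 h2 h3 v
  have hd : ContDiff ℝ ∞ (fun z => φ (A.symm z)) := h1.comp A.symm.contDiff
  have hc : HasCompactSupport (fun z => φ (A.symm z)) :=
    h2.comp_homeomorph A.symm.toHomeomorph
  have hs : tsupport (fun z => φ (A.symm z)) ⊆ Ω' := by
    have := tsupport_comp_eq_preimage φ A.symm.toHomeomorph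
    change tsupport (φ ∘ A.symm.toHomeomorph) ⊆ Ω'
    rw [this, h]
    intro z hz
    exact ⟨A.symm z, h3 hz, by simp⟩
  have key := hu _ hd hc hs (A v)
  have hf : ∀ x, fderiv ℝ (fun z => φ (A.symm z)) (A x) (A v) = fderiv ℝ φ x v := by
    intro x
    have h4 : HasFDerivAt (fun z => φ (A.symm z))
        ((fderiv ℝ φ (A.symm (A x))).comp (A.symm : E →L[ℝ] E)) (A x) :=
      ((h1.differentiable (by simp)) _).hasFDerivAt.comp _ A.symm.hasFDerivAt
    rw [h4.fderiv]
    simp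
  have e1 := setIntegral_comp_of_image_eq A h
    (fun z => u z * fderiv ℝ (fun z => φ (A.symm z)) z (A v))
  have e2 := setIntegral_comp_of_image_eq A h (fun z => inner ℝ (g z) (A v) * φ (A.symm z))
  simp only [hf, ContinuousLinearEquiv.symm_apply_apply, ← hA] at e1 e2
  rw [e1, e2, key, mul_neg]
  simp only [hA]

/-- The pullback `u ↦ u ∘ A`, with gradient `A ∘ ∇u ∘ A`, from `H¹(A(Ω))` to `H¹(Ω)`, for a
self-adjoint `A`. -/
def pullbackH1 (h : Ω' = A '' Ω) (hA : ∀ x y, inner ℝ (A x) y = inner ℝ x (A y)) :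
    H1 Ω' →L[ℝ] H1 Ω :=
  ((((pullbackLp A ℝ h).prodMap
      (((A : E →L[ℝ] E).compLpL 2 (volume.restrict Ω)).comp (pullbackLp A E h)))).comp
        (H1 Ω').subtypeL).codRestrict (H1 Ω) (by
    intro u
    have h0 : IsWeakGradient Ω' u.1.1 u.1.2 := u.2
    refine (h0.comp_of_image_eq A h hA).congr_ae (coeFn_pullbackLp A h u.1.1).symm ?_
    have h1 := (A : E →L[ℝ] E).coeFn_compLpL (μ := volume.restrict Ω) (pullbackLp A E h u.1.2)
    refine (h1.trans ?_).symm
    filter_upwards [coeFn_pullbackLp A h u.1.2] with x hx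
    rw [hx]; rfl)

theorem pullbackH1_fst (h : Ω' = A '' Ω) (hA : ∀ x y, inner ℝ (A x) y = inner ℝ x (A y))
    (u : H1 Ω') : (pullbackH1 A h hA u).1.1 = pullbackLp A ℝ h u.1.1 := rfl

theorem isCompactOperator_H1_of_image_eq (h : Ω' = A '' Ω)
    (hA : ∀ x y, inner ℝ (A x) y = inner ℝ x (A y))
    (hc : IsCompactOperator (fun u : H1 Ω => u.1.1)) :
    IsCompactOperator (fun u : H1 Ω' => u.1.1) := by
  have h' : Ω = A.symm '' Ω' := by
    rw [h, ← image_comp]; simp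
  have h1 := (hc.comp_clm (pullbackH1 A h hA)).clm_comp (pullbackLp A.symm ℝ h')
  suffices he : (fun u : H1 Ω' => u.1.1) = pullbackLp A.symm ℝ h' ∘
      (fun u : H1 Ω => u.1.1) ∘ pullbackH1 A h hA by rw [he]; exact h1
  funext u
  simp only [Function.comp_apply, pullbackH1_fst]
  refine Lp.ext ?_
  have h2 := coeFn_pullbackLp A.symm h' (pullbackLp A ℝ h u.1.1)
  have h3 := (quasiMeasurePreserving_of_image_eq A.symm h').ae_eq_comp
    (coeFn_pullbackLp A h u.1.1)
  filter_upwards [h2, h3] with x hx hx'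
  rw [hx]
  simpa using hx'.symm

theorem IsNeumannDomain.of_image_eq (h : Ω' = A '' Ω)
    (hA : ∀ x y, inner ℝ (A x) y = inner ℝ x (A y)) (hΩ : IsNeumannDomain Ω) :
    IsNeumannDomain Ω' where
  isOpen := h ▸ A.toHomeomorph.isOpenMap _ hΩ.isOpen
  isBounded := h ▸ A.toContinuousLinearMap.lipschitz.isBounded_image hΩ.isBounded
  isConnected := h ▸ hΩ.isConnected.image A A.continuous.continuousOn
  compact_embedding := isCompactOperator_H1_of_image_eq A h hA hΩ.compact_embedding

end Pullback

/-! ### Thin sets -/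

section Thin

variable {n : ℕ}

/-- The linear map `(t, y) ↦ (t, ε y)`. -/
def stretch (n : ℕ) (ε : ℝ) (hε : ε ≠ 0) :
    EuclideanSpace ℝ (Fin (n + 1)) ≃L[ℝ] EuclideanSpace ℝ (Fin (n + 1)) :=
  LinearEquiv.toContinuousLinearEquiv
    { toFun := fun x => point (x 0) (ε • transversal x)
      invFun := fun x => point (x 0) (ε⁻¹ • transversal x)
      map_add' := fun x y => by
        rw [← point_add, ← smul_add]; rfl
      map_smul' := fun c x => by
        rw [RingHom.id_apply, ← point_smul, smul_comm]; rfl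
      left_inv := fun x => by
        simp [smul_smul, inv_mul_cancel₀ hε]
      right_inv := fun x => by
        simp [smul_smul, mul_inv_cancel₀ hε] }

theorem stretch_apply {ε : ℝ} (hε : ε ≠ 0) (x : EuclideanSpace ℝ (Fin (n + 1))) :
    stretch n ε hε x = point (x 0) (ε • transversal x) := rfl

theorem inner_stretch {ε : ℝ} (hε : ε ≠ 0) (x y : EuclideanSpace ℝ (Fin (n + 1))) :
    inner ℝ (stretch n ε hε x) y = inner ℝ x (stretch n ε hε y) := by
  simp [stretch_apply, PiLp.inner_apply, Fin.sum_univ_succ, point, transversal]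
  refine Finset.sum_congr rfl fun i _ => by ring

theorem thin_eq_image {ε : ℝ} (hε : ε ≠ 0) (Ω : Set (EuclideanSpace ℝ (Fin (n + 1)))) :
    thin ε Ω = stretch n ε hε '' Ω := by
  ext z
  constructor
  · rintro ⟨t, y, h1, rfl⟩
    exact ⟨_, h1, by simp [stretch_apply]⟩
  · rintro ⟨x, hx, rfl⟩
    exact ⟨x 0, transversal x, by simpa using hx, rfl⟩

variable {Ω : Set (EuclideanSpace ℝ (Fin (n + 1)))}

open scoped Pointwise in
theorem slice_thin (ε : ℝ) (t : ℝ) : slice (thin ε Ω) t = ε • slice Ω t := by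
  ext y
  constructor
  · rintro ⟨s, z, hz, h⟩
    have h1 := congrArg (fun x : EuclideanSpace ℝ (Fin (n + 1)) => x 0) h
    have h2 := congrArg transversal h
    simp only [point_apply_zero, transversal_point] at h1 h2
    subst h1
    exact ⟨z, hz, h2.symm⟩
  · rintro ⟨z, hz, rfl⟩
    exact ⟨t, z, hz, rfl⟩

theorem profile_thin {ε : ℝ} (hε : 0 < ε) (t : ℝ) :
    profile (thin ε Ω) t = ε ^ n * profile Ω t := by
  rw [profile, slice_thin, measureReal_def, Measure.addHaar_smul, ENNReal.toReal_mul,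
    profile, measureReal_def, ENNReal.toReal_ofReal (abs_nonneg _), finrank_euclideanSpace_fin,
    abs_of_pos (pow_pos hε n)]

theorem image_apply_zero_thin {ε : ℝ} (hε : ε ≠ 0) :
    (fun x : EuclideanSpace ℝ (Fin (n + 1)) => x 0) '' thin ε Ω =
      (fun x : EuclideanSpace ℝ (Fin (n + 1)) => x 0) '' Ω := by
  rw [thin_eq_image hε, ← image_comp]
  rfl

theorem isNeumannDomain_thin (hΩ : IsNeumannDomain Ω) {ε : ℝ} (hε : ε ≠ 0) :
    IsNeumannDomain (thin ε Ω) :=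
  hΩ.of_image_eq (stretch n ε hε) (thin_eq_image hε Ω) (inner_stretch hε)

theorem one_le_diam (hb : Bornology.IsBounded Ω)
    (hproj : (fun x : EuclideanSpace ℝ (Fin (n + 1)) => x 0) '' Ω = Ioo 0 1) :
    1 ≤ Metric.diam Ω := by
  refine le_of_forall_lt fun r hr => ?_
  rcases lt_or_ge r 0 with hr0 | hr0
  · exact hr0.trans_le Metric.diam_nonneg
  -- points with first coordinates `(1 - r) / 4` and `1 - (1 - r) / 4`
  have ha : (1 - r) / 4 ∈ Ioo (0 : ℝ) 1 := ⟨by linarith, by linarith⟩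
  have hb' : 1 - (1 - r) / 4 ∈ Ioo (0 : ℝ) 1 := ⟨by linarith, by linarith⟩
  rw [← hproj] at ha hb'
  obtain ⟨x, hx, hx0⟩ := ha
  obtain ⟨y, hy, hy0⟩ := hb'
  have h1 := Metric.dist_le_diam_of_mem hb hy hx
  have h2 := PiLp.norm_apply_le (y - x) 0
  rw [← dist_eq_norm, PiLp.sub_apply] at h2
  simp only at hx0 hy0
  rw [hx0, hy0, Real.norm_eq_abs] at h2
  have h3 := le_abs_self (1 - (1 - r) / 4 - (1 - r) / 4)
  linarith

theorem norm_point_le (t : ℝ) (y : EuclideanSpace ℝ (Fin n)) : ‖point t y‖ ≤ |t| + ‖y‖ := by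
  rw [EuclideanSpace.norm_eq, Fin.sum_univ_succ]
  have h : ∑ i : Fin n, ‖point t y i.succ‖ ^ 2 = ‖y‖ ^ 2 := by
    rw [EuclideanSpace.norm_sq_eq]; simp [point]
  rw [h, Real.sqrt_le_left (by positivity), point_apply_zero, Real.norm_eq_abs]
  nlinarith [abs_nonneg t, norm_nonneg y]

theorem diam_thin_le (hb : Bornology.IsBounded Ω)
    (hproj : (fun x : EuclideanSpace ℝ (Fin (n + 1)) => x 0) '' Ω = Ioo 0 1) {ε : ℝ}
    (hε : 0 < ε) : Metric.diam (thin ε Ω) ≤ 1 + ε * Metric.diam Ω := by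
  refine Metric.diam_le_of_forall_dist_le (by positivity) ?_
  rw [thin_eq_image hε.ne']
  rintro _ ⟨x, hx, rfl⟩ _ ⟨y, hy, rfl⟩
  have h1 : x 0 ∈ Ioo (0 : ℝ) 1 := hproj ▸ ⟨x, hx, rfl⟩
  have h2 : y 0 ∈ Ioo (0 : ℝ) 1 := hproj ▸ ⟨y, hy, rfl⟩
  have h3 := Metric.dist_le_diam_of_mem hb hx hy
  rw [dist_eq_norm, ← map_sub, stretch_apply]
  refine (norm_point_le _ _).trans (add_le_add ?_ ?_)
  · rw [PiLp.sub_apply, abs_le]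
    constructor <;> linarith [h1.1, h1.2, h2.1, h2.2]
  · rw [norm_smul, Real.norm_eq_abs, abs_of_pos hε]
    refine mul_le_mul_of_nonneg_left ?_ hε.le
    rw [dist_eq_norm] at h3
    exact (norm_transversal_le _).trans h3

end Thin

/-! ### Functions with vanishing weak derivatives -/

section LocalConstancy

theorem setIntegral_eq_integral_of_tsupport_subset {E : Type*} [TopologicalSpace E]
    [MeasureSpace E] {Ω : Set E} {ψ f : E → ℝ}
    (hs : tsupport ψ ⊆ Ω) : ∫ x in Ω, f x * ψ x = ∫ x, f x * ψ x := by
  refine setIntegral_eq_integral_of_forall_compl_eq_zero fun x hx => ?_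
  rw [image_eq_zero_of_notMem_tsupport fun h => hx (hs h), mul_zero]

variable {E : Type*} [NormedAddCommGroup E]

theorem locallyIntegrableOn_mul_integrable [MeasureSpace E] [BorelSpace E]
    {Q : Set E} {f ψ : E → ℝ}
    (hf : LocallyIntegrableOn f Q) (hψ : Continuous ψ) (hc : HasCompactSupport ψ)
    (hs : tsupport ψ ⊆ Q) : Integrable (fun x => f x * ψ x) := by
  have h1 : IntegrableOn f (tsupport ψ) := hf.integrableOn_compact_subset hs hc
  have h2 : IntegrableOn (fun x => f x * ψ x) (tsupport ψ) :=
    h1.mul_continuousOn hψ.continuousOn hc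
  refine (integrableOn_iff_integrable_of_support_subset fun x hx => ?_).1 h2
  exact subset_tsupport _ fun h => hx (by simp [h])

variable [InnerProductSpace ℝ E] [FiniteDimensional ℝ E]

theorem exists_countable_convex_cover {Ω : Set E} (hΩ : IsOpen Ω) :
    ∃ C : Set (Set E), C.Countable ∧ (∀ Q ∈ C, IsOpen Q ∧ Convex ℝ Q ∧ Q ⊆ Ω) ∧ ⋃₀ C = Ω := by
  have h1 : ∀ x : Ω, ∃ r > 0, Metric.ball (x : E) r ⊆ Ω := fun x =>
    Metric.isOpen_iff.1 hΩ x x.2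
  choose r hr hrΩ using h1
  obtain ⟨T, hT, hTu⟩ := TopologicalSpace.isOpen_iUnion_countable
    (fun x : Ω => Metric.ball (x : E) (r x)) fun x => Metric.isOpen_ball
  refine ⟨(fun x : Ω => Metric.ball (x : E) (r x)) '' T, hT.image _, ?_, ?_⟩
  · rintro _ ⟨x, -, rfl⟩
    exact ⟨Metric.isOpen_ball, convex_ball _ _, hrΩ x⟩
  · rw [sUnion_image, hTu]
    refine Subset.antisymm (iUnion_subset hrΩ) fun x hx => ?_
    exact mem_iUnion.2 ⟨⟨x, hx⟩, Metric.mem_ball_self (hr _)⟩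

variable [MeasureSpace E] [BorelSpace E] [(volume : Measure E).IsAddHaarMeasure]

/-- If the weak derivative of `f` in the direction `e` vanishes on the convex open set `Q`, then
`f` is invariant under the translation by `e` inside `Q`: for a test function `φ`, the integral
of `f` against `φ(· - τe)` does not depend on `τ`. -/
theorem ae_eq_translate_of_weak_deriv_eq_zero {Q : Set E} (hQ : IsOpen Q) (hQc : Convex ℝ Q)
    {f : E → ℝ} (hf : LocallyIntegrableOn f Q) (e : E)
    (h0 : ∀ φ : E → ℝ, ContDiff ℝ ∞ φ → HasCompactSupport φ → tsupport φ ⊆ Q →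
      ∫ x, f x * fderiv ℝ φ x e = 0) :
    ∀ᵐ x, x ∈ Q → x + e ∈ Q → f (x + e) = f x := by
  have hU : IsOpen (Q ∩ (fun x => x + e) ⁻¹' Q) :=
    hQ.inter (hQ.preimage (continuous_id.add continuous_const))
  have hfe : LocallyIntegrableOn (fun x => f (x + e)) ((fun x => x + e) ⁻¹' Q) := by
    have hUe : IsOpen ((fun x => x + e) ⁻¹' Q) :=
      hQ.preimage (continuous_id.add continuous_const)
    rw [locallyIntegrableOn_iff hUe.isLocallyClosed]
    intro k hk hkc
    have h1 : IntegrableOn f ((fun x => x + e) '' k) :=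
      hf.integrableOn_compact_subset (image_subset_iff.2 hk)
        (hkc.image (continuous_id.add continuous_const))
    exact ((measurePreserving_add_right volume e).integrableOn_image
      (measurableEmbedding_addRight e)).1 h1
  have hloc : LocallyIntegrableOn (fun x => f (x + e) - f x)
      (Q ∩ (fun x => x + e) ⁻¹' Q) :=
    (hfe.mono_set inter_subset_right).sub (hf.mono_set inter_subset_left)
  have key := hU.ae_eq_zero_of_integral_contDiff_smul_eq_zero hloc ?_
  · filter_upwards [key] with x hx h1 h2
    exact sub_eq_zero.1 (hx ⟨h1, h2⟩)
  intro φ hφ hc hs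
  -- the compact set swept by the support of `φ` under the translations by `τe`, `τ ∈ [0, 1]`
  set K : Set E := (fun p : E × ℝ => p.1 + p.2 • e) '' (tsupport φ ×ˢ Icc (0 : ℝ) 1) with hK
  have hKc : IsCompact K := (hc.prod isCompact_Icc).image (by fun_prop)
  have hKQ : K ⊆ Q := by
    rintro _ ⟨⟨x, τ⟩, ⟨hx, hτ⟩, rfl⟩
    have h1 := hs hx
    have h2 := hQc h1.1 h1.2 (sub_nonneg.2 hτ.2) hτ.1 (by ring)
    convert h2 using 1
    simp only [smul_add, sub_smul, one_smul]
    abel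
  have hfK : IntegrableOn f K := hf.integrableOn_compact_subset hKQ hKc
  set f' : E → ℝ := K.indicator f with hf'
  have hf'i : Integrable f' := hfK.integrable_indicator hKc.measurableSet
  have hsuppK : ∀ τ ∈ Icc (0 : ℝ) 1, ∀ x, x - τ • e ∈ tsupport φ → x ∈ K := by
    intro τ hτ x hx
    exact ⟨(x - τ • e, τ), ⟨hx, hτ⟩, by simp⟩
  have hswap : ∀ τ ∈ Icc (0 : ℝ) 1, ∀ ψ : E → ℝ, (∀ x, x ∉ tsupport φ → ψ x = 0) →
      ∫ x, f' x * ψ (x - τ • e) = ∫ x, f x * ψ (x - τ • e) := by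
    intro τ hτ ψ hψ
    refine integral_congr_ae (Eventually.of_forall fun x => ?_)
    by_cases hx : x ∈ K
    · simp [hf', hx]
    · have : ψ (x - τ • e) = 0 := hψ _ fun h => hx (hsuppK τ hτ x h)
      simp [this]
  obtain ⟨C, hC⟩ := (hφ.continuous_fderiv (by simp)).bounded_above_of_compact_support
    (hc.fderiv (𝕜 := ℝ))
  have hφd : Differentiable ℝ φ := hφ.differentiable (by simp)
  have hderiv : ∀ τ : ℝ, HasDerivAt (fun τ : ℝ => ∫ x, f' x * φ (x - τ • e))
      (∫ x, f' x * -(fderiv ℝ φ (x - τ • e) e)) τ := by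
    intro τ
    refine (hasDerivAt_integral_of_dominated_loc_of_deriv_le (μ := volume)
      (F := fun (τ : ℝ) x => f' x * φ (x - τ • e))
      (F' := fun (τ : ℝ) x => f' x * -(fderiv ℝ φ (x - τ • e) e))
      (bound := fun x => ‖f' x‖ * (C * ‖e‖)) (Metric.ball_mem_nhds τ one_pos)
      ?_ ?_ ?_ ?_ ?_ ?_).2
    · refine Eventually.of_forall fun τ => hf'i.1.mul ?_
      exact (hφ.continuous.comp (by fun_prop)).aestronglyMeasurable
    · obtain ⟨D, hD⟩ := hφ.continuous.bounded_above_of_compact_support hc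
      refine hf'i.mul_bdd (c := D)
        (hφ.continuous.comp (by fun_prop)).aestronglyMeasurable ?_
      exact Eventually.of_forall fun x => hD _
    · refine hf'i.1.mul (Continuous.aestronglyMeasurable ?_)
      exact (((hφ.continuous_fderiv (by simp)).comp (by fun_prop)).clm_apply
        continuous_const).neg
    · refine Eventually.of_forall fun x τ _ => ?_
      rw [norm_mul, norm_neg]
      refine mul_le_mul_of_nonneg_left ?_ (norm_nonneg _)
      exact ((fderiv ℝ φ _).le_opNorm e).trans
        (mul_le_mul_of_nonneg_right (hC _) (norm_nonneg _))
    · exact hf'i.norm.mul_const _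
    · refine Eventually.of_forall fun x τ _ => ?_
      have h1 : HasDerivAt (fun τ : ℝ => x - τ • e) (-e) τ := by
        simpa using ((hasDerivAt_id τ).smul_const e).const_sub x
      have h2 := (hφd (x - τ • e)).hasFDerivAt.comp_hasDerivAt τ h1
      simpa using h2.const_mul (f' x)
  have hzero : ∀ τ ∈ Icc (0 : ℝ) 1, ∫ x, f' x * -(fderiv ℝ φ (x - τ • e) e) = 0 := by
    intro τ hτ
    have h1 := hswap τ hτ (fun x => -(fderiv ℝ φ x e)) (fun x hx => by
      have : x ∉ tsupport (fderiv ℝ φ) := fun h => hx (tsupport_fderiv_subset ℝ h)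
      rw [image_eq_zero_of_notMem_tsupport this]; simp)
    rw [h1]
    have hτφ := h0 (fun x => φ (x - τ • e)) (hφ.comp (contDiff_id.sub contDiff_const))
      (hc.comp_homeomorph (Homeomorph.subRight (τ • e))) ?_
    · simp only [fderiv_comp_sub] at hτφ
      simp only [mul_neg, integral_neg, hτφ, neg_zero]
    · have h2 := tsupport_comp_eq_preimage φ (Homeomorph.subRight (τ • e))
      change tsupport (φ ∘ Homeomorph.subRight (τ • e)) ⊆ Q
      rw [h2]
      exact fun x hx => hKQ (hsuppK τ hτ x hx)
  have hconst := constant_of_has_deriv_right_zero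
    (f := fun τ : ℝ => ∫ x, f' x * φ (x - τ • e)) (a := 0) (b := 1)
    (fun τ _ => (hderiv τ).continuousAt.continuousWithinAt)
    (fun τ hτ => by
      have h1 := hderiv τ
      rw [hzero τ ⟨hτ.1, hτ.2.le⟩] at h1
      exact h1.hasDerivWithinAt) 1 (by simp)
  rw [hswap 1 (by simp) φ (fun x hx => image_eq_zero_of_notMem_tsupport hx),
    hswap 0 (by simp) φ (fun x hx => image_eq_zero_of_notMem_tsupport hx)] at hconst
  simp only [one_smul, zero_smul, sub_zero] at hconst
  have i1 : Integrable (fun x => f (x + e) * φ x) :=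
    locallyIntegrableOn_mul_integrable hfe hφ.continuous hc (hs.trans inter_subset_right)
  have i2 : Integrable (fun x => f x * φ x) :=
    locallyIntegrableOn_mul_integrable hf hφ.continuous hc (hs.trans inter_subset_left)
  have h3 : ∫ x, f (x + e) * φ x = ∫ x, f x * φ (x - e) := by
    rw [← integral_add_right_eq_self (fun x => f x * φ (x - e)) e]
    simp
  have h4 : (fun x => φ x • (f (x + e) - f x)) = fun x => f (x + e) * φ x - f x * φ x := by
    funext x; rw [smul_eq_mul]; ring
  rw [h4, integral_sub i1 i2, h3, hconst, sub_self]

/-- A function which is almost everywhere constant on each member of a countable open cover of a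
preconnected set is almost everywhere constant on that set. -/
theorem exists_ae_eq_const_of_cover {X : Type*} [TopologicalSpace X] [MeasurableSpace X]
    {μ : Measure X} [μ.IsOpenPosMeasure] {U : Set X} (hU : IsPreconnected U) {ι : Type*}
    [Countable ι] {Q : ι → Set X} (hQ : ∀ i, IsOpen (Q i)) (hQU : ⋃ i, Q i = U) {F : X → ℝ}
    (hF : ∀ i, ∃ c, ∀ᵐ x ∂μ, x ∈ Q i → F x = c) :
    ∃ c, ∀ᵐ x ∂μ, x ∈ U → F x = c := by
  choose c hc using hF
  rcases U.eq_empty_or_nonempty with rfl | ⟨x₀, hx₀⟩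
  · exact ⟨0, by simp⟩
  have hmeet : ∀ i j x, x ∈ Q i → x ∈ Q j → c i = c j := by
    intro i j x hi hj
    have hpos := ((hQ i).inter (hQ j)).measure_pos μ ⟨x, hi, hj⟩
    by_contra hne
    refine hpos.ne' (measure_mono_null (fun y hy => ?_) ((hc i).and (hc j)))
    intro h
    exact hne ((h.1 hy.1).symm.trans (h.2 hy.2))
  have hmem : ∀ x ∈ U, ∃ i, x ∈ Q i := fun x hx => mem_iUnion.1 (hQU ▸ hx)
  obtain ⟨i₀, hi₀⟩ := hmem x₀ hx₀
  have hall : ∀ x ∈ U, ∀ i, x ∈ Q i → c i = c i₀ := by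
    intro x hx i hi
    refine (hU.induction₂ (fun x y => ∀ i j, x ∈ Q i → y ∈ Q j → c i = c j)
      ?_ ?_ ?_ hx hx₀) i i₀ hi hi₀
    · intro x hx
      obtain ⟨k, hk⟩ := hmem x hx
      filter_upwards [mem_nhdsWithin_of_mem_nhds ((hQ k).mem_nhds hk)] with y hy i j hi hj
      exact (hmeet i k x hi hk).trans (hmeet k j y hy hj)
    · intro x y z _ hy _ hxy hyz i j hi hj
      obtain ⟨k, hk⟩ := hmem y hy
      exact (hxy i k hi hk).trans (hyz k j hk hj)
    · intro x y _ _ hxy i j hi hj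
      exact (hxy j i hj hi).symm
  refine ⟨c i₀, ?_⟩
  filter_upwards [ae_all_iff.2 hc] with x hx hxU
  obtain ⟨i, hi⟩ := hmem x hxU
  rw [hx i hi, hall x hxU i hi]

theorem exists_ae_eq_const_of_ae_ae {X : Type*} [TopologicalSpace X] [MeasurableSpace X]
    {μ : Measure X} [μ.IsOpenPosMeasure] {Q : Set X} (hQ : IsOpen Q) {F : X → ℝ}
    (hF : ∀ᵐ x ∂μ, x ∈ Q → ∀ᵐ y ∂μ, y ∈ Q → F y = F x) :
    ∃ c, ∀ᵐ x ∂μ, x ∈ Q → F x = c := by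
  rcases Q.eq_empty_or_nonempty with rfl | hne
  · exact ⟨0, by simp⟩
  by_contra hcon
  refine (hQ.measure_pos μ hne).ne' (measure_mono_null (fun x hx => ?_) hF)
  intro h
  exact hcon ⟨F x, h hx⟩

/-- A locally integrable function with zero weak gradient on a connected open set is almost
everywhere constant. -/
theorem IsWeakGradient.exists_ae_eq_const {Ω : Set E} (hΩ : IsOpen Ω) (hconn : IsPreconnected Ω)
    {f : E → ℝ} (hf : LocallyIntegrableOn f Ω) (h0 : IsWeakGradient Ω f (fun _ => 0)) :
    ∃ c, ∀ᵐ x, x ∈ Ω → f x = c := by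
  have hm : AEStronglyMeasurable f (volume.restrict Ω) := hf.aestronglyMeasurable
  set F : E → ℝ := hm.mk f with hFdef
  have hFm : Measurable F := hm.stronglyMeasurable_mk.measurable
  have hfF : f =ᵐ[volume.restrict Ω] F := hm.ae_eq_mk
  have hF0 : IsWeakGradient Ω F (fun _ => 0) := h0.congr_ae hfF EventuallyEq.rfl
  have hFl : LocallyIntegrableOn F Ω := by
    intro x hx
    obtain ⟨s, hs, hi⟩ := hf x hx
    refine ⟨s ∩ Ω, inter_mem hs self_mem_nhdsWithin, ?_⟩
    exact (hi.mono_set inter_subset_left).congr_fun_ae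
      (ae_restrict_of_ae_restrict_of_subset inter_subset_right hfF)
  obtain ⟨C, hC, hCQ, hCu⟩ := exists_countable_convex_cover hΩ
  have : Countable C := hC
  obtain ⟨c, hc⟩ := exists_ae_eq_const_of_cover (μ := (volume : Measure E)) hconn
    (Q := fun Q : C => (Q : Set E)) (fun Q => (hCQ Q Q.2).1)
    (by rw [← hCu, sUnion_eq_iUnion]) (F := F) (fun ⟨Q, hQC⟩ => by
      obtain ⟨hQ, hQc, hQΩ⟩ := hCQ Q hQC
      refine exists_ae_eq_const_of_ae_ae hQ ?_
      have h1 : ∀ e : E, ∀ᵐ x, x ∈ Q → x + e ∈ Q → F (x + e) = F x := fun e =>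
        ae_eq_translate_of_weak_deriv_eq_zero hQ hQc (hFl.mono_set hQΩ) e fun φ h1 h2 h3 => by
          have h4 := hF0 φ h1 h2 (h3.trans hQΩ) e
          have h5 : tsupport (fun x => fderiv ℝ φ x e) ⊆ Ω :=
            (tsupport_fderiv_apply_subset ℝ e).trans (h3.trans hQΩ)
          rw [setIntegral_eq_integral_of_tsupport_subset h5] at h4
          simpa using h4
      have hms : MeasurableSet
          {p : E × E | p.2 ∈ Q → p.2 + p.1 ∈ Q → F (p.2 + p.1) = F p.2} := by
        have m1 : MeasurableSet {p : E × E | p.2 ∈ Q} := measurable_snd hQ.measurableSet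
        have m2 : MeasurableSet {p : E × E | p.2 + p.1 ∈ Q} :=
          (measurable_snd.add measurable_fst) hQ.measurableSet
        have m3 : MeasurableSet {p : E × E | F (p.2 + p.1) = F p.2} :=
          measurableSet_eq_fun (hFm.comp (measurable_snd.add measurable_fst))
            (hFm.comp measurable_snd)
        exact m1.imp (m2.imp m3)
      have h2 := (Measure.ae_ae_comm (μ := (volume : Measure E)) (ν := (volume : Measure E))
        (p := fun e x => x ∈ Q → x + e ∈ Q → F (x + e) = F x) hms).1 (Eventually.of_forall h1)
      filter_upwards [h2] with x hx hxQ
      have h3 := (measurePreserving_sub_right volume x).quasiMeasurePreserving.ae hx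
      filter_upwards [h3] with y hy hyQ
      simpa using hy hxQ (by simpa using hyQ))
  refine ⟨c, ?_⟩
  rw [Filter.EventuallyEq, ae_restrict_iff' hΩ.measurableSet] at hfF
  filter_upwards [hc, hfF] with x h1 h2 hx
  rw [h2 hx, h1 hx]

end LocalConstancy

/-! ### Functions of the first coordinate -/

section FirstCoordinate

variable {n : ℕ} {Ω : Set (EuclideanSpace ℝ (Fin (n + 1)))}

/-- If the slices of `Ω` are connected, a locally integrable function on `Ω` whose weak
derivatives in the transversal directions vanish depends on the first coordinate only. -/
theorem exists_ae_eq_comp_apply_zero (hΩ : IsOpen Ω) (hb : Bornology.IsBounded Ω)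
    (hproj : (fun x : EuclideanSpace ℝ (Fin (n + 1)) => x 0) '' Ω = Ioo 0 1)
    (hslice : ∀ᵐ t ∂(volume.restrict (Ioo (0 : ℝ) 1)), IsConnected (slice Ω t))
    {g : EuclideanSpace ℝ (Fin (n + 1)) → ℝ} (hgm : Measurable g)
    (hg : LocallyIntegrableOn g Ω)
    (h0 : ∀ y : EuclideanSpace ℝ (Fin n), ∀ φ : EuclideanSpace ℝ (Fin (n + 1)) → ℝ,
      ContDiff ℝ ∞ φ → HasCompactSupport φ → tsupport φ ⊆ Ω →
        ∫ x in Ω, g x * fderiv ℝ φ x (point 0 y) = 0) :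
    ∃ γ : ℝ → ℝ, Measurable γ ∧ ∀ᵐ x ∂volume.restrict Ω, g x = γ (x 0) := by
  obtain ⟨C, hC, hCQ, hCu⟩ := exists_countable_convex_cover hΩ
  have : Countable C := hC
  -- on each convex piece, `g` is constant along almost every slice
  have hpiece : ∀ Q ∈ C, ∀ᵐ t : ℝ, ∀ᵐ y : EuclideanSpace ℝ (Fin n), point t y ∈ Q →
      ∀ᵐ z : EuclideanSpace ℝ (Fin n), point t z ∈ Q → g (point t z) = g (point t y) := by
    intro Q hQC
    obtain ⟨hQ, hQc, hQΩ⟩ := hCQ Q hQC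
    have h1 : ∀ s : EuclideanSpace ℝ (Fin n), ∀ᵐ p : ℝ × EuclideanSpace ℝ (Fin n),
        point p.1 p.2 ∈ Q → point p.1 (p.2 + s) ∈ Q →
          g (point p.1 (p.2 + s)) = g (point p.1 p.2) := by
      intro s
      have h2 := ae_eq_translate_of_weak_deriv_eq_zero hQ hQc (hg.mono_set hQΩ) (point 0 s)
        fun φ h1 h2 h3 => by
          have h5 : tsupport (fun x => fderiv ℝ φ x (point 0 s)) ⊆ Ω :=
            (tsupport_fderiv_apply_subset ℝ _).trans (h3.trans hQΩ)
          rw [← setIntegral_eq_integral_of_tsupport_subset h5]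
          exact h0 s φ h1 h2 (h3.trans hQΩ)
      have h3 := measurePreserving_point.quasiMeasurePreserving.ae h2
      filter_upwards [h3] with p hp
      rwa [← point_add, add_zero] at hp
    have hshift : Measurable (fun q : EuclideanSpace ℝ (Fin n) × (ℝ × EuclideanSpace ℝ (Fin n)) =>
        point q.2.1 (q.2.2 + q.1)) :=
      (continuous_point.comp (by fun_prop :
        Continuous fun q : EuclideanSpace ℝ (Fin n) × (ℝ × EuclideanSpace ℝ (Fin n)) =>
          (q.2.1, q.2.2 + q.1))).measurable
    have hbase : Measurable (fun q : EuclideanSpace ℝ (Fin n) × (ℝ × EuclideanSpace ℝ (Fin n)) =>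
        point q.2.1 q.2.2) := continuous_point.measurable.comp measurable_snd
    have hms : MeasurableSet
        {q : EuclideanSpace ℝ (Fin n) × (ℝ × EuclideanSpace ℝ (Fin n)) |
          point q.2.1 q.2.2 ∈ Q → point q.2.1 (q.2.2 + q.1) ∈ Q →
            g (point q.2.1 (q.2.2 + q.1)) = g (point q.2.1 q.2.2)} :=
      (hbase hQ.measurableSet).imp ((hshift hQ.measurableSet).imp
        (measurableSet_eq_fun (hgm.comp hshift) (hgm.comp hbase)))
    have h2 := (Measure.ae_ae_comm (μ := (volume : Measure (EuclideanSpace ℝ (Fin n))))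
      (ν := (volume : Measure (ℝ × EuclideanSpace ℝ (Fin n))))
      (p := fun s p => point p.1 p.2 ∈ Q → point p.1 (p.2 + s) ∈ Q →
        g (point p.1 (p.2 + s)) = g (point p.1 p.2)) hms).1 (Eventually.of_forall h1)
    filter_upwards [Measure.ae_ae_of_ae_prod h2] with t ht
    filter_upwards [ht] with y hy hyQ
    have h3 := (measurePreserving_sub_right volume y).quasiMeasurePreserving.ae hy
    filter_upwards [h3] with z hz hzQ
    simpa using hz hyQ (by simpa using hzQ)
  have hconst : ∀ᵐ t : ℝ, t ∈ Ioo (0 : ℝ) 1 →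
      ∃ c, ∀ᵐ y : EuclideanSpace ℝ (Fin n), y ∈ slice Ω t → g (point t y) = c := by
    rw [ae_restrict_iff' measurableSet_Ioo] at hslice
    filter_upwards [hslice, (ae_ball_iff hC).2 hpiece] with t h1 h2 ht
    refine exists_ae_eq_const_of_cover (μ := volume) (h1 ht).isPreconnected
      (Q := fun Q : C => slice (Q : Set _) t) (fun Q => isOpen_slice (hCQ Q Q.2).1 t) ?_
      (F := fun y => g (point t y)) ?_
    · ext y
      simp only [mem_iUnion, slice, mem_ofPred_eq]
      rw [← hCu, mem_sUnion]
      simp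
    · rintro ⟨Q, hQ⟩
      exact exists_ae_eq_const_of_ae_ae (isOpen_slice (hCQ Q hQ).1 t) (h2 Q hQ)
  set G : ℝ → EuclideanSpace ℝ (Fin n) → ℝ := fun t y => Ω.indicator g (point t y) with hG
  have hGm : Measurable (Function.uncurry G) :=
    (hgm.indicator hΩ.measurableSet).comp continuous_point.measurable
  -- the constant is recovered measurably as the average over the slice
  set γ : ℝ → ℝ := fun t => (∫ y, G t y) / (volume (slice Ω t)).toReal with hγ
  have hγm : Measurable γ :=
    (hGm.stronglyMeasurable.integral_prod_right (ν := volume)).measurable.div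
      (measurable_volume_slice hΩ).ennreal_toReal
  refine ⟨γ, hγm, ?_⟩
  have hset : MeasurableSet {p : ℝ × EuclideanSpace ℝ (Fin n) |
      point p.1 p.2 ∈ Ω → g (point p.1 p.2) = γ p.1} :=
    (continuous_point.measurable hΩ.measurableSet).imp
      (measurableSet_eq_fun (hgm.comp continuous_point.measurable) (hγm.comp measurable_fst))
  have hprod : ∀ᵐ p : ℝ × EuclideanSpace ℝ (Fin n),
      point p.1 p.2 ∈ Ω → g (point p.1 p.2) = γ p.1 := by
    refine (Measure.ae_prod_iff_ae_ae hset).2 ?_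
    filter_upwards [hconst] with t ht
    by_cases htI : t ∈ Ioo (0 : ℝ) 1
    · obtain ⟨c, hc⟩ := ht htI
      have hpos := volume_slice_pos hΩ hproj htI
      have hlt := volume_slice_lt_top hb t
      have hγc : γ t = c := by
        have h1 : ∫ y, G t y = ∫ y, (slice Ω t).indicator (fun _ => c) y := by
          refine integral_congr_ae ?_
          filter_upwards [hc] with y hy
          by_cases hyΩ : y ∈ slice Ω t
          · rw [indicator_of_mem hyΩ, ← hy hyΩ]
            exact indicator_of_mem (s := Ω) hyΩ g
          · rw [indicator_of_notMem hyΩ]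
            exact indicator_of_notMem (s := Ω) hyΩ g
        have h2 : (volume (slice Ω t)).toReal ≠ 0 := (ENNReal.toReal_pos hpos.ne' hlt.ne).ne'
        rw [hγ]
        simp only
        rw [h1, integral_indicator_const _ (isOpen_slice hΩ t).measurableSet, measureReal_def,
          smul_eq_mul, mul_div_cancel_left₀ _ h2]
      filter_upwards [hc] with y hy hyΩ
      rw [hγc, hy hyΩ]
    · exact Eventually.of_forall fun y hy => absurd (mem_Ioo_of_mem_slice hproj hy) htI
  rw [ae_restrict_iff' hΩ.measurableSet, ← measurePreserving_point.map_eq,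
    measurableEmbedding_point.ae_map_iff]
  exact hprod

/-- The inclusion `y ↦ (0, y)` as a continuous linear map. -/
def pointZero (n : ℕ) : EuclideanSpace ℝ (Fin n) →L[ℝ] EuclideanSpace ℝ (Fin (n + 1)) :=
  LinearMap.toContinuousLinearMap
    { toFun := fun y => point 0 y
      map_add' := fun y z => by rw [← point_add, add_zero]
      map_smul' := fun c y => by rw [RingHom.id_apply, ← point_smul, mul_zero] }

theorem pointZero_apply (y : EuclideanSpace ℝ (Fin n)) : pointZero n y = point 0 y := rfl

theorem point_eq_smul_add (t : ℝ) (y : EuclideanSpace ℝ (Fin n)) :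
    point t y = t • point 1 0 + point 0 y := by
  rw [← point_smul, ← point_add]; simp

theorem point_eq_add_pointZero (t : ℝ) (y : EuclideanSpace ℝ (Fin n)) :
    point t y = point t 0 + pointZero n y := by
  rw [pointZero_apply, ← point_add]; simp

theorem inner_point_zero_right (s : ℝ) (v : EuclideanSpace ℝ (Fin (n + 1))) :
    inner ℝ (point s (0 : EuclideanSpace ℝ (Fin n))) v = s * v 0 := by
  simp [PiLp.inner_apply, Fin.sum_univ_succ, point, mul_comm]

/-- Integrability of `u(x₁) ψ(x)` for `ψ` continuous with compact support in `Ω`, when `u` is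
only locally integrable on the projection of `Ω`. -/
theorem integrable_comp_apply_zero_mul
    (hproj : (fun x : EuclideanSpace ℝ (Fin (n + 1)) => x 0) '' Ω = Ioo 0 1) {u : ℝ → ℝ}
    (hu : LocallyIntegrableOn u (Ioo 0 1)) {ψ : EuclideanSpace ℝ (Fin (n + 1)) → ℝ}
    (hψ : Continuous ψ) (hc : HasCompactSupport ψ) (hs : tsupport ψ ⊆ Ω) :
    Integrable (fun x => u (x 0) * ψ x) := by
  set K := (fun x : EuclideanSpace ℝ (Fin (n + 1)) => x 0) '' tsupport ψ with hK
  set K' := transversal '' tsupport ψ with hK'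
  have hKc : IsCompact K := IsCompact.image hc continuous_apply_zero
  have hKc' : IsCompact K' := IsCompact.image hc continuous_transversal
  have hKI : K ⊆ Ioo 0 1 := hproj ▸ image_mono hs
  have h1 : Integrable (K.indicator u) :=
    (hu.integrableOn_compact_subset hKI hKc).integrable_indicator hKc.measurableSet
  have h2 : Integrable (K'.indicator (fun _ => (1 : ℝ))) :=
    (integrable_indicator_iff hKc'.measurableSet).2 (integrableOn_const hKc'.measure_lt_top.ne)
  have h3 := h1.mul_prod h2
  obtain ⟨D, hD⟩ := hψ.bounded_above_of_compact_support hc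
  rw [← measurePreserving_point.integrable_comp_emb measurableEmbedding_point]
  have h4 := h3.mul_bdd (c := D)
    (g := fun p : ℝ × EuclideanSpace ℝ (Fin n) => ψ (point p.1 p.2))
    (hψ.comp continuous_point).aestronglyMeasurable (Eventually.of_forall fun p => hD _)
  refine h4.congr (Eventually.of_forall fun p => ?_)
  simp only [Function.comp_apply, point_apply_zero]
  by_cases hp : point p.1 p.2 ∈ tsupport ψ
  · have e1 : p.1 ∈ K := ⟨_, hp, rfl⟩
    have e2 : p.2 ∈ K' := ⟨_, hp, by simp⟩
    simp [e1, e2]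
  · simp [image_eq_zero_of_notMem_tsupport hp]

theorem integral_fderiv_eq_zero_of_hasCompactSupport {E : Type*} [NormedAddCommGroup E]
    [NormedSpace ℝ E] [FiniteDimensional ℝ E] [MeasureSpace E] [BorelSpace E]
    [(volume : Measure E).IsAddHaarMeasure] {φ : E → ℝ} (hφ : ContDiff ℝ ∞ φ)
    (hc : HasCompactSupport φ) (v : E) : ∫ x, fderiv ℝ φ x v = 0 := by
  have h1 : Integrable (fun x => fderiv ℝ φ x v) :=
    ((hφ.continuous_fderiv (by simp)).clm_apply continuous_const).integrable_of_hasCompactSupport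
      (hc.fderiv_apply ℝ v)
  have h2 : Integrable φ := hφ.continuous.integrable_of_hasCompactSupport hc
  have h3 := integral_mul_fderiv_eq_neg_fderiv_mul_of_integrable (μ := (volume : Measure E))
    (f := fun _ : E => (1 : ℝ)) (g := φ) (v := v) (by simp) (by simpa using h1)
    (by simpa using h2) (fun _ _ => differentiableAt_const _)
    (fun x _ => hφ.differentiable (by simp) x)
  simpa using h3

/-- A weakly differentiable function `u` on `(0, 1)`, seen as a function of `x₁` on `Ω`, has the
weak gradient `u'(x₁) e₁`. -/
theorem IsWeakGradient.comp_apply_zero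
    (hproj : (fun x : EuclideanSpace ℝ (Fin (n + 1)) => x 0) '' Ω = Ioo 0 1) {u g : ℝ → ℝ}
    (hu : LocallyIntegrableOn u (Ioo 0 1)) (hg : LocallyIntegrableOn g (Ioo 0 1))
    (hug : IsWeakGradient (Ioo (0 : ℝ) 1) u g) :
    IsWeakGradient Ω (fun x => u (x 0)) (fun x => point (g (x 0)) 0) := by
  intro φ hφ hc hs v
  have hφd : Differentiable ℝ φ := hφ.differentiable (by simp)
  have hder : ∀ w : EuclideanSpace ℝ (Fin (n + 1)), Continuous (fun x => fderiv ℝ φ x w) :=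
    fun w => (hφ.continuous_fderiv (by simp)).clm_apply continuous_const
  have hders : ∀ w : EuclideanSpace ℝ (Fin (n + 1)),
      tsupport (fun x => fderiv ℝ φ x w) ⊆ Ω := fun w =>
    (tsupport_fderiv_apply_subset ℝ w).trans hs
  have hint : ∀ w : EuclideanSpace ℝ (Fin (n + 1)),
      Integrable (fun x => u (x 0) * fderiv ℝ φ x w) := fun w =>
    integrable_comp_apply_zero_mul hproj hu (hder w) (hc.fderiv_apply ℝ w) (hders w)
  have hintg : Integrable (fun x => g (x 0) * φ x) :=
    integrable_comp_apply_zero_mul hproj hg hφ.continuous hc hs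
  -- the derivative along the axis, by Fubini and the weak derivative of `u`
  have haxis : ∫ x, u (x 0) * fderiv ℝ φ x (point 1 0) = -∫ x, g (x 0) * φ x := by
    rw [integral_point_swap (hint _), integral_point_swap hintg, ← integral_neg]
    refine integral_congr_ae (Eventually.of_forall fun y => ?_)
    simp only [point_apply_zero]
    have hd : ∀ t : ℝ, HasFDerivAt (fun t : ℝ => point t y)
        ((1 : ℝ →L[ℝ] ℝ).smulRight (point 1 (0 : EuclideanSpace ℝ (Fin n)))) t := by
      intro t
      rw [funext fun t : ℝ => point_eq_smul_add t y]
      exact ((hasFDerivAt_id t).smul_const _).add_const _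
    have hsm : ContDiff ℝ ∞ (fun t : ℝ => point t y) := by
      rw [funext fun t : ℝ => point_eq_smul_add t y]
      fun_prop
    have hemb : Topology.IsClosedEmbedding (fun t : ℝ => point t y) := by
      refine Topology.IsClosedEmbedding.of_continuous_injective_isClosedMap ?_ ?_ ?_
      · exact continuous_point_left y
      · intro s t h
        exact congrArg (fun x : EuclideanSpace ℝ (Fin (n + 1)) => x 0) h
      · have : IsClosedMap (fun t : ℝ => (t, y)) := by
          intro s hs
          have : (fun t : ℝ => (t, y)) '' s = s ×ˢ {y} := by
            ext ⟨a, b⟩; simp [eq_comm]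
          rw [this]
          exact hs.prod isClosed_singleton
        exact (pointHomeo n).isClosedMap.comp this
    have hcs : HasCompactSupport (fun t : ℝ => φ (point t y)) := hc.comp_isClosedEmbedding hemb
    have hts : tsupport (fun t : ℝ => φ (point t y)) ⊆ Ioo 0 1 := by
      have h1 := tsupport_comp_subset_preimage φ (continuous_point_left y)
      exact fun t ht => mem_Ioo_of_mem_slice hproj (hs (h1 ht))
    have hf : ∀ t : ℝ, fderiv ℝ (fun t : ℝ => φ (point t y)) t 1 =
        fderiv ℝ φ (point t y) (point 1 0) := by
      intro t
      have h1 : HasFDerivAt (fun t : ℝ => φ (point t y)) _ t :=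
        (hφd (point t y)).hasFDerivAt.comp t (hd t)
      rw [h1.fderiv]
      simp
    have key := hug _ (hφ.comp hsm) hcs hts 1
    change ∫ t in Ioo 0 1, u t * fderiv ℝ (fun t : ℝ => φ (point t y)) t 1 =
      -∫ t in Ioo 0 1, inner ℝ (g t) 1 * φ (point t y) at key
    rw [setIntegral_eq_integral_of_tsupport_subset
        ((tsupport_fderiv_apply_subset ℝ _).trans hts),
      setIntegral_eq_integral_of_tsupport_subset hts] at key
    simpa [hf] using key
  have htrans : ∀ w : EuclideanSpace ℝ (Fin n),
      ∫ x, u (x 0) * fderiv ℝ φ x (point 0 w) = 0 := by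
    intro w
    rw [integral_point (hint _)]
    refine integral_eq_zero_of_ae (Eventually.of_forall fun t => ?_)
    simp only [point_apply_zero, Pi.zero_apply]
    rw [integral_const_mul]
    have hd : ∀ y : EuclideanSpace ℝ (Fin n),
        HasFDerivAt (fun y => point t y) (pointZero n) y := by
      intro y
      rw [funext fun y => point_eq_add_pointZero t y]
      exact (pointZero n).hasFDerivAt.const_add _
    have hsm : ContDiff ℝ ∞ (fun y : EuclideanSpace ℝ (Fin n) => point t y) := by
      rw [funext fun y => point_eq_add_pointZero t y]
      fun_prop
    have hemb : Topology.IsClosedEmbedding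
        (fun y : EuclideanSpace ℝ (Fin n) => point t y) := by
      refine Topology.IsClosedEmbedding.of_continuous_injective_isClosedMap ?_ ?_ ?_
      · exact continuous_point_right t
      · intro y z h
        simpa using congrArg transversal h
      · have : IsClosedMap (fun y : EuclideanSpace ℝ (Fin n) => (t, y)) := by
          intro s hs
          have : (fun y : EuclideanSpace ℝ (Fin n) => (t, y)) '' s = {t} ×ˢ s := by
            ext ⟨a, b⟩; simp [eq_comm, and_comm]
          rw [this]
          exact isClosed_singleton.prod hs
        exact (pointHomeo n).isClosedMap.comp this
    have hf : ∀ y, fderiv ℝ (fun y => φ (point t y)) y w =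
        fderiv ℝ φ (point t y) (point 0 w) := by
      intro y
      have h1 : HasFDerivAt (fun y => φ (point t y)) _ y :=
        (hφd (point t y)).hasFDerivAt.comp y (hd y)
      rw [h1.fderiv]
      simp [pointZero_apply]
    have h2 := integral_fderiv_eq_zero_of_hasCompactSupport (hφ.comp hsm)
      (hc.comp_isClosedEmbedding hemb) w
    change ∫ y, fderiv ℝ (fun y => φ (point t y)) y w = 0 at h2
    simp only [hf] at h2
    rw [h2, mul_zero]
  rw [setIntegral_eq_integral_of_tsupport_subset (hders v),
    setIntegral_eq_integral_of_tsupport_subset hs]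
  have hv : v = v 0 • point 1 0 + point 0 (transversal v) := by
    rw [← point_eq_smul_add, point_transversal]
  have h1 : (fun x : EuclideanSpace ℝ (Fin (n + 1)) => u (x 0) * fderiv ℝ φ x v) =
      fun x => v 0 * (u (x 0) * fderiv ℝ φ x (point 1 0)) +
        u (x 0) * fderiv ℝ φ x (point 0 (transversal v)) := by
    funext x
    conv_lhs => rw [hv, map_add, map_smul, smul_eq_mul]
    ring
  rw [h1, integral_add ((hint _).const_mul _) (hint _), integral_const_mul, htrans, haxis,
    add_zero, mul_neg, ← integral_const_mul]
  congr 1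
  refine integral_congr_ae (Eventually.of_forall fun x => ?_)
  simp only [inner_point_zero_right]
  ring

end FirstCoordinate

/-! ### Primitives on the interval -/

section Primitive

theorem exists_Ioo_of_isCompact {K : Set ℝ} (hK : IsCompact K) (hKI : K ⊆ Ioo 0 1) :
    ∃ a b : ℝ, 0 < a ∧ b < 1 ∧ K ⊆ Ioo a b := by
  rcases K.eq_empty_or_nonempty with rfl | hne
  · exact ⟨1, 0, one_pos, zero_lt_one, empty_subset _⟩
  have h1 := hKI (hK.sInf_mem hne)
  have h2 := hKI (hK.sSup_mem hne)
  refine ⟨sInf K / 2, (sSup K + 1) / 2, by linarith [h1.1], by linarith [h2.2],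
    fun x hx => ⟨?_, ?_⟩⟩
  · have := csInf_le hK.bddBelow hx
    linarith [h1.1]
  · have := le_csSup hK.bddAbove hx
    linarith [h2.2]

/-- A primitive of a locally integrable function is weakly differentiable. -/
theorem isWeakGradient_primitive {γ w : ℝ → ℝ} (hγ : LocallyIntegrableOn γ (Ioo 0 1)) {c C : ℝ}
    (hc : c ∈ Ioo (0 : ℝ) 1) (hw : ∀ t ∈ Ioo (0 : ℝ) 1, w t = C + ∫ s in c..t, γ s) :
    IsWeakGradient (Ioo (0 : ℝ) 1) w γ := by
  intro φ hφ hφc hs v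
  obtain ⟨a, b, ha, hb, hab⟩ := exists_Ioo_of_isCompact (hφc.isCompact.insert c)
    (insert_subset hc hs)
  have hca := hab (mem_insert c _)
  have hsa : tsupport φ ⊆ Ioo a b := (subset_insert _ _).trans hab
  have hlt : a < b := hca.1.trans hca.2
  have hI : Icc a b ⊆ Ioo 0 1 := fun x hx => ⟨ha.trans_le hx.1, hx.2.trans_lt hb⟩
  have hii : IntervalIntegrable γ volume a b := by
    rw [intervalIntegrable_iff_integrableOn_Icc_of_le hlt.le]
    exact hγ.integrableOn_compact_subset hI isCompact_Icc
  have hcu : c ∈ uIcc a b := by rw [uIcc_of_le hlt.le]; exact ⟨hca.1.le, hca.2.le⟩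
  set W : ℝ → ℝ := fun t => C + ∫ s in c..t, γ s with hW
  have hWac : AbsolutelyContinuousOnInterval W a b := by
    have h1 := hii.absolutelyContinuousOnInterval_intervalIntegral hcu
    have h2 : AbsolutelyContinuousOnInterval (fun _ : ℝ => C) a b :=
      (contDiff_const.contDiffOn (s := uIcc a b)).absolutelyContinuousOnInterval
    exact h2.fun_add h1
  have hφac : AbsolutelyContinuousOnInterval φ a b :=
    ((hφ.of_le (by simp)).contDiffOn (s := uIcc a b)).absolutelyContinuousOnInterval
  have key := hWac.integral_mul_deriv_eq_deriv_mul hφac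
  have h0a : φ a = 0 := image_eq_zero_of_notMem_tsupport fun h => (hsa h).1.false
  have h0b : φ b = 0 := image_eq_zero_of_notMem_tsupport fun h => (hsa h).2.false
  rw [h0a, h0b, mul_zero, mul_zero, sub_zero, zero_sub] at key
  have hWd : ∫ x in a..b, deriv W x * φ x = ∫ x in a..b, γ x * φ x := by
    refine intervalIntegral.integral_congr_ae ?_
    filter_upwards [hii.ae_hasDerivAt_integral] with x hx hxab
    have h1 := (hx (uIoc_subset_uIcc hxab) c hcu).const_add C
    rw [h1.deriv]
  rw [hWd] at key
  have htoI : ∀ ψ f : ℝ → ℝ, tsupport ψ ⊆ Ioo a b →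
      ∫ x in Ioo (0 : ℝ) 1, f x * ψ x = ∫ x in a..b, f x * ψ x := by
    intro ψ f hψ
    have h1 : tsupport ψ ⊆ Ioo 0 1 := hψ.trans (Ioo_subset_Icc_self.trans hI)
    have h2 : tsupport ψ ⊆ Ioc a b := hψ.trans Ioo_subset_Ioc_self
    rw [setIntegral_eq_integral_of_tsupport_subset h1, intervalIntegral.integral_of_le hlt.le,
      setIntegral_eq_integral_of_tsupport_subset h2]
  rw [htoI _ _ ((tsupport_fderiv_apply_subset ℝ v).trans hsa), htoI _ _ hsa]
  have e1 : ∫ x in a..b, w x * fderiv ℝ φ x v = v * ∫ x in a..b, W x * deriv φ x := by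
    rw [← intervalIntegral.integral_const_mul]
    refine intervalIntegral.integral_congr fun x hx => ?_
    rw [uIcc_of_le hlt.le] at hx
    simp only [hw x (hI hx), fderiv_eq_smul_deriv, smul_eq_mul, hW]
    ring
  have e2 : ∫ x in a..b, inner ℝ (γ x) v * φ x = v * ∫ x in a..b, γ x * φ x := by
    rw [← intervalIntegral.integral_const_mul]
    refine intervalIntegral.integral_congr fun x _ => ?_
    simp only [RCLike.inner_apply, conj_trivial]
    ring
  rw [e1, e2, key, mul_neg]

theorem continuousOn_primitive {γ : ℝ → ℝ} (hγ : LocallyIntegrableOn γ (Ioo 0 1)) {c : ℝ}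
    (hc : c ∈ Ioo (0 : ℝ) 1) : ContinuousOn (fun t => ∫ s in c..t, γ s) (Ioo 0 1) := by
  intro t ht
  obtain ⟨a, b, ha, hb, hab⟩ := exists_Ioo_of_isCompact
    ((isCompact_singleton (x := t)).insert c)
    (insert_subset hc (singleton_subset_iff.2 ht))
  have hca := hab (mem_insert c _)
  have hta := hab (mem_insert_of_mem c (mem_singleton t))
  have hlt : a < b := hca.1.trans hca.2
  have hI : Icc a b ⊆ Ioo 0 1 := fun x hx => ⟨ha.trans_le hx.1, hx.2.trans_lt hb⟩
  have hii : IntegrableOn γ (Icc a b) := hγ.integrableOn_compact_subset hI isCompact_Icc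
  have h1 := intervalIntegral.continuousOn_primitive_interval' (μ := volume) (a := c)
    (b₁ := a) (b₂ := b) ((intervalIntegrable_iff_integrableOn_Icc_of_le hlt.le).2 hii)
    (by rw [uIcc_of_le hlt.le]; exact ⟨hca.1.le, hca.2.le⟩)
  rw [uIcc_of_le hlt.le] at h1
  exact (h1.continuousAt (Icc_mem_nhds hta.1 hta.2)).continuousWithinAt

end Primitive

/-! ### Weak derivatives by duality -/

section Duality

/-- Riesz representation of a linear functional `ℓ` which is bounded with respect to the
seminorm induced by a linear map `L` into a Hilbert space. -/
theorem exists_inner_eq_of_abs_le {T H : Type*} [AddCommGroup T] [Module ℝ T]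
    [NormedAddCommGroup H] [InnerProductSpace ℝ H] [CompleteSpace H] (L : T →ₗ[ℝ] H)
    (ℓ : T →ₗ[ℝ] ℝ) {M : ℝ} (hM : 0 ≤ M) (hℓ : ∀ φ, |ℓ φ| ≤ M * ‖L φ‖) :
    ∃ g : H, ‖g‖ ≤ M ∧ ∀ φ, ℓ φ = inner ℝ g (L φ) := by
  have hker : LinearMap.ker L ≤ LinearMap.ker ℓ := by
    intro φ hφ
    have h1 := hℓ φ
    rw [LinearMap.mem_ker.1 hφ, norm_zero, mul_zero] at h1
    exact LinearMap.mem_ker.2 (abs_nonpos_iff.1 h1)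
  set f : LinearMap.range L →ₗ[ℝ] ℝ :=
    ((LinearMap.ker L).liftQ ℓ hker).comp L.quotKerEquivRange.symm.toLinearMap with hf
  have hfL : ∀ φ (hφ : L φ ∈ LinearMap.range L), f ⟨L φ, hφ⟩ = ℓ φ := by
    intro φ hφ
    have h1 := L.quotKerEquivRange_symm_apply_image φ hφ
    simp only [hf, LinearMap.comp_apply, LinearEquiv.coe_coe]
    rw [h1]
    simp
  set F : StrongDual ℝ (LinearMap.range L) := f.mkContinuous M (by
    rintro ⟨_, φ, rfl⟩
    exact (congrArg abs (hfL φ ⟨φ, rfl⟩)).trans_le (hℓ φ)) with hF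
  have hFn : ‖F‖ ≤ M := LinearMap.mkContinuous_norm_le _ hM _
  obtain ⟨G, hG, hGn⟩ := exists_extension_norm_eq (LinearMap.range L) F
  refine ⟨(InnerProductSpace.toDual ℝ H).symm G, ?_, fun φ => ?_⟩
  · rw [LinearIsometryEquiv.norm_map, hGn]
    exact hFn
  · rw [InnerProductSpace.toDual_symm_apply, ← hfL φ ⟨φ, rfl⟩]
    exact (hG ⟨L φ, ⟨φ, rfl⟩⟩).symm

variable {E : Type*} [NormedAddCommGroup E] [InnerProductSpace ℝ E]

/-- The space `C_c^∞(Ω)` of test functions. -/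
def testFunctions (Ω : Set E) : Submodule ℝ (E → ℝ) where
  carrier := {φ | ContDiff ℝ ∞ φ ∧ HasCompactSupport φ ∧ tsupport φ ⊆ Ω}
  zero_mem' := ⟨contDiff_const, HasCompactSupport.zero, by simp [tsupport]⟩
  add_mem' := fun {φ ψ} hφ hψ => ⟨hφ.1.add hψ.1, hφ.2.1.add hψ.2.1,
    (tsupport_add φ ψ).trans (union_subset hφ.2.2 hψ.2.2)⟩
  smul_mem' := fun c φ hφ => ⟨hφ.1.const_smul c, hφ.2.1.smul_left (f := fun _ : E => c),
    (tsupport_smul_subset_right (fun _ : E => c) φ).trans hφ.2.2⟩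

variable [MeasureSpace E] [BorelSpace E] [IsFiniteMeasureOnCompacts (volume : Measure E)]
  {Ω : Set E}

theorem memLp_testFunction {φ : E → ℝ} (hφ : ContDiff ℝ ∞ φ) (hc : HasCompactSupport φ) :
    MemLp φ 2 (volume.restrict Ω) :=
  (hφ.continuous.memLp_of_hasCompactSupport hc).restrict Ω

/-- The inclusion of the test functions into `L²(Ω)`. -/
def testToLp (Ω : Set E) : testFunctions Ω →ₗ[ℝ] Lp ℝ 2 (volume.restrict Ω) where
  toFun φ := (memLp_testFunction φ.2.1 φ.2.2.1).toLp
  map_add' _ _ := MemLp.toLp_add _ _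
  map_smul' _ _ := MemLp.toLp_const_smul _ _

theorem coeFn_testToLp (φ : testFunctions Ω) :
    testToLp Ω φ =ᵐ[volume.restrict Ω] (φ : E → ℝ) :=
  MemLp.coeFn_toLp (memLp_testFunction φ.2.1 φ.2.2.1)

theorem inner_testToLp (g : Lp ℝ 2 (volume.restrict Ω)) (φ : testFunctions Ω) :
    inner ℝ g (testToLp Ω φ) = ∫ x in Ω, g x * (φ : E → ℝ) x := by
  rw [L2.inner_def]
  refine integral_congr_ae ?_
  filter_upwards [coeFn_testToLp φ] with x hx
  rw [hx]
  simp [mul_comm]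

/-- If `∫ u ∂ₑφ` is controlled by the `L²` norm of `φ`, then `u` has a weak derivative in the
direction `e` in `L²(Ω)`. -/
theorem exists_weak_deriv_of_abs_le (u : Lp ℝ 2 (volume.restrict Ω)) (e : E) {M : ℝ}
    (hM : 0 ≤ M) (hu : ∀ φ : testFunctions Ω,
      |∫ x in Ω, u x * fderiv ℝ (φ : E → ℝ) x e| ≤ M * ‖testToLp Ω φ‖) :
    ∃ g : Lp ℝ 2 (volume.restrict Ω), ‖g‖ ≤ M ∧ ∀ φ : testFunctions Ω,
      ∫ x in Ω, u x * fderiv ℝ (φ : E → ℝ) x e = -∫ x in Ω, g x * (φ : E → ℝ) x := by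
  have hint : ∀ φ : testFunctions Ω,
      Integrable (fun x => u x * fderiv ℝ (φ : E → ℝ) x e) (volume.restrict Ω) := fun φ =>
    integrable_mul_fderiv (Lp.memLp u) φ.2.1 φ.2.2.1 e
  let ℓ : testFunctions Ω →ₗ[ℝ] ℝ :=
    { toFun := fun φ => -∫ x in Ω, u x * fderiv ℝ (φ : E → ℝ) x e
      map_add' := fun φ ψ => by
        rw [← neg_add, ← integral_add (hint φ) (hint ψ)]
        congr 1
        refine integral_congr_ae (Eventually.of_forall fun x => ?_)
        have h1 := fderiv_add (φ.2.1.differentiable (by simp) x)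
          (ψ.2.1.differentiable (by simp) x)
        simp only [Submodule.coe_add, h1, add_apply]
        ring
      map_smul' := fun c φ => by
        rw [RingHom.id_apply, smul_eq_mul, mul_neg, ← integral_const_mul]
        congr 1
        refine integral_congr_ae (Eventually.of_forall fun x => ?_)
        have h1 := fderiv_const_smul (φ.2.1.differentiable (by simp) x) c
        simp only [Submodule.coe_smul, h1, smul_apply, smul_eq_mul]
        ring }
  obtain ⟨g, hg, hgφ⟩ := exists_inner_eq_of_abs_le (testToLp Ω) ℓ hM (fun φ => by
    simp only [ℓ, LinearMap.coe_mk, AddHom.coe_mk, abs_neg]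
    exact hu φ)
  refine ⟨g, hg, fun φ => ?_⟩
  rw [← inner_testToLp, ← hgφ]
  simp [ℓ]

/-- The `L²(Ω)` norm is bounded by duality against test functions, which determine `g`. -/
theorem norm_le_of_abs_integral_le [FiniteDimensional ℝ E] (hΩ : IsOpen Ω)
    (g : Lp ℝ 2 (volume.restrict Ω)) (hi : Integrable g (volume.restrict Ω)) {M : ℝ}
    (hM : 0 ≤ M) (hfin : volume Ω < ⊤)
    (hg : ∀ φ : testFunctions Ω, |∫ x in Ω, g x * (φ : E → ℝ) x| ≤ M * ‖testToLp Ω φ‖) :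
    ‖g‖ ≤ M := by
  let ℓ : testFunctions Ω →ₗ[ℝ] ℝ := (innerₗ _ g).comp (testToLp Ω)
  have hℓ : ∀ φ, ℓ φ = ∫ x in Ω, g x * (φ : E → ℝ) x := fun φ => inner_testToLp g φ
  obtain ⟨g', hg', hgφ⟩ := exists_inner_eq_of_abs_le (testToLp Ω) ℓ hM (fun φ => by
    rw [hℓ]; exact hg φ)
  suffices g = g' by rwa [this]
  have : IsFiniteMeasure (volume.restrict Ω) := ⟨by simpa using hfin⟩
  have hi' : Integrable g' (volume.restrict Ω) := (Lp.memLp g').integrable (by norm_num)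
  refine Lp.ext ?_
  have h1 := hΩ.ae_eq_zero_of_integral_contDiff_smul_eq_zero (μ := volume)
    (f := fun x => g x - g' x) (IntegrableOn.locallyIntegrableOn (hi.sub hi'))
    (fun φ h1 h2 h3 => by
      have h4 : ∫ x, φ x • (g x - g' x) = ∫ x in Ω, φ x • (g x - g' x) := by
        refine (setIntegral_eq_integral_of_forall_compl_eq_zero fun x hx => ?_).symm
        rw [image_eq_zero_of_notMem_tsupport fun h => hx (h3 h), zero_smul]
      have h5 := hgφ ⟨φ, h1, h2, h3⟩
      rw [hℓ, inner_testToLp] at h5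
      have i1 := integrable_mul_test (Lp.memLp g) h1.continuous h2
      have i2 := integrable_mul_test (Lp.memLp g') h1.continuous h2
      rw [h4]
      calc ∫ x in Ω, φ x • (g x - g' x) = ∫ x in Ω, (g x * φ x - g' x * φ x) := by
            refine integral_congr_ae (Eventually.of_forall fun x => ?_)
            simp only [smul_eq_mul]; ring
        _ = 0 := by rw [integral_sub i1 i2]; exact sub_eq_zero.2 h5)
  rw [EventuallyEq, ae_restrict_iff' hΩ.measurableSet]
  filter_upwards [h1] with x hx hxΩ
  exact sub_eq_zero.1 (hx hxΩ)

end Duality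

/-! ### Local bounds on the profile measure -/

section Structure

variable {n : ℕ} {Ω : Set (EuclideanSpace ℝ (Fin (n + 1)))}

/-- Lebesgue measure near a point of `(0, 1)` is bounded by a multiple of the image of Lebesgue
measure on `Ω`, because `Ω` contains a box. -/
theorem exists_restrict_le_smul_map (hΩ : IsOpen Ω)
    (hproj : (fun x : EuclideanSpace ℝ (Fin (n + 1)) => x 0) '' Ω = Ioo 0 1) {t : ℝ}
    (ht : t ∈ Ioo (0 : ℝ) 1) :
    ∃ I ∈ 𝓝 t, ∃ c : ℝ≥0∞, c ≠ ⊤ ∧ volume.restrict I ≤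
      c • (volume.restrict Ω).map (fun x : EuclideanSpace ℝ (Fin (n + 1)) => x 0) := by
  obtain ⟨y, hy⟩ := slice_nonempty hproj ht
  obtain ⟨δ, hδ, hball⟩ := Metric.isOpen_iff.1 (hΩ.preimage continuous_point) (t, y) hy
  have hbox : ∀ s ∈ Metric.ball t δ, Metric.ball y δ ⊆ slice Ω s := fun s hs z hz =>
    hball (show (s, z) ∈ Metric.ball (t, y) δ by
      rw [← ball_prod_same]; exact ⟨hs, hz⟩)
  set b := (volume : Measure (EuclideanSpace ℝ (Fin n))) (Metric.ball y δ) with hb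
  have hb0 : b ≠ 0 := (Metric.measure_ball_pos volume y hδ).ne'
  have hbt : b ≠ ⊤ := measure_ball_lt_top.ne
  have hI : Metric.ball t δ ⊆ Ioo 0 1 := fun s hs =>
    mem_Ioo_of_mem_slice hproj (hbox s hs (Metric.mem_ball_self hδ))
  refine ⟨Metric.ball t δ, Metric.ball_mem_nhds t hδ, b⁻¹, by simpa using hb0, ?_⟩
  rw [map_apply_zero_restrict hΩ hproj]
  refine Measure.le_iff.2 fun s hs => ?_
  rw [Measure.smul_apply, withDensity_apply _ hs, Measure.restrict_apply hs,
    Measure.restrict_restrict hs, smul_eq_mul]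
  calc volume (s ∩ Metric.ball t δ) = b⁻¹ * ∫⁻ _ in s ∩ Metric.ball t δ, b := by
        rw [setLIntegral_const, ← mul_assoc, ENNReal.inv_mul_cancel hb0 hbt, one_mul]
    _ ≤ b⁻¹ * ∫⁻ s in s ∩ Metric.ball t δ,
          (volume : Measure (EuclideanSpace ℝ (Fin n))) (slice Ω s) := by
        refine mul_le_mul' le_rfl ?_
        refine setLIntegral_mono' (hs.inter Metric.isOpen_ball.measurableSet) fun s hs => ?_
        exact measure_mono (hbox s hs.2)
    _ ≤ _ := by
        refine mul_le_mul' le_rfl ?_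
        exact lintegral_mono_set (inter_subset_inter_right s hI)

theorem exists_memLp_of_memLp_comp (hΩ : IsOpen Ω)
    (hproj : (fun x : EuclideanSpace ℝ (Fin (n + 1)) => x 0) '' Ω = Ioo 0 1) {γ : ℝ → ℝ}
    (hγm : Measurable γ) (hγ : MemLp (fun x : EuclideanSpace ℝ (Fin (n + 1)) => γ (x 0)) 2
      (volume.restrict Ω)) {t : ℝ} (ht : t ∈ Ioo (0 : ℝ) 1) :
    ∃ I ∈ 𝓝 t, MemLp γ 2 (volume.restrict I) := by
  obtain ⟨I, hI, c, hc, hle⟩ := exists_restrict_le_smul_map hΩ hproj ht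
  refine ⟨I, hI, MemLp.of_measure_le_smul hc hle ?_⟩
  exact (memLp_map_measure_iff hγm.aestronglyMeasurable
    continuous_apply_zero.measurable.aemeasurable).2 hγ

theorem locallyIntegrableOn_sq_of_memLp_comp (hΩ : IsOpen Ω)
    (hproj : (fun x : EuclideanSpace ℝ (Fin (n + 1)) => x 0) '' Ω = Ioo 0 1) {γ : ℝ → ℝ}
    (hγm : Measurable γ) (hγ : MemLp (fun x : EuclideanSpace ℝ (Fin (n + 1)) => γ (x 0)) 2
      (volume.restrict Ω)) : LocallyIntegrableOn (fun t => γ t ^ 2) (Ioo 0 1) := by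
  intro t ht
  obtain ⟨I, hI, h1⟩ := exists_memLp_of_memLp_comp hΩ hproj hγm hγ ht
  exact ⟨I, mem_nhdsWithin_of_mem_nhds hI, h1.integrable_sq⟩

theorem locallyIntegrableOn_of_memLp_comp (hΩ : IsOpen Ω)
    (hproj : (fun x : EuclideanSpace ℝ (Fin (n + 1)) => x 0) '' Ω = Ioo 0 1) {γ : ℝ → ℝ}
    (hγm : Measurable γ) (hγ : MemLp (fun x : EuclideanSpace ℝ (Fin (n + 1)) => γ (x 0)) 2
      (volume.restrict Ω)) : LocallyIntegrableOn γ (Ioo 0 1) := by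
  intro t ht
  obtain ⟨I, hI, h1⟩ := exists_memLp_of_memLp_comp hΩ hproj hγm hγ ht
  refine ⟨I ∩ Ioo 0 1, inter_mem (mem_nhdsWithin_of_mem_nhds hI) self_mem_nhdsWithin, ?_⟩
  have h2 : MemLp γ 2 (volume.restrict (I ∩ Ioo 0 1)) :=
    h1.mono_measure (Measure.restrict_mono inter_subset_left le_rfl)
  have : IsFiniteMeasure ((volume : Measure ℝ).restrict (I ∩ Ioo 0 1)) :=
    ⟨by
      rw [Measure.restrict_apply_univ]
      exact (measure_mono inter_subset_right).trans_lt measure_Ioo_lt_top⟩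
  exact h2.integrable (by norm_num)

/-- A function `u ∈ L²(Ω)` whose weak gradient, defined by duality, is a multiple of `e₁` is a
primitive of a function of `x₁`. -/
theorem exists_primitive_of_abs_le (hΩ : IsOpen Ω) (hb : Bornology.IsBounded Ω)
    (hconn : IsPreconnected Ω)
    (hproj : (fun x : EuclideanSpace ℝ (Fin (n + 1)) => x 0) '' Ω = Ioo 0 1)
    (hslice : ∀ᵐ t ∂(volume.restrict (Ioo (0 : ℝ) 1)), IsConnected (slice Ω t))
    (u : Lp ℝ 2 (volume.restrict Ω)) {M : ℝ} (hM : 0 ≤ M)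
    (hu : ∀ (v : EuclideanSpace ℝ (Fin (n + 1))) (φ : testFunctions Ω),
      |∫ x in Ω, u x * fderiv ℝ (φ : EuclideanSpace ℝ (Fin (n + 1)) → ℝ) x v| ≤
        M * |v 0| * ‖testToLp Ω φ‖) :
    ∃ (γ : ℝ → ℝ) (C : ℝ), Measurable γ ∧
      MemLp (fun x : EuclideanSpace ℝ (Fin (n + 1)) => γ (x 0)) 2 (volume.restrict Ω) ∧
      (∀ᵐ x ∂volume.restrict Ω, u x = C + ∫ s in (1 / 2 : ℝ)..(x 0), γ s) ∧
      ∀ φ : testFunctions Ω,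
        ∫ x in Ω, u x * fderiv ℝ (φ : EuclideanSpace ℝ (Fin (n + 1)) → ℝ) x (point 1 0) =
          -∫ x in Ω, γ (x 0) * (φ : EuclideanSpace ℝ (Fin (n + 1)) → ℝ) x := by
  have hfin : IsFiniteMeasure (volume.restrict Ω) := ⟨by simpa using hb.measure_lt_top⟩
  obtain ⟨g, -, hgφ⟩ := exists_weak_deriv_of_abs_le u (point 1 0) hM (fun φ => by
    simpa using hu (point 1 0) φ)
  have htrans : ∀ (y : EuclideanSpace ℝ (Fin n)) (φ : testFunctions Ω),
      ∫ x in Ω, u x * fderiv ℝ (φ : EuclideanSpace ℝ (Fin (n + 1)) → ℝ) x (point 0 y) = 0 := by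
    intro y φ
    have := hu (point 0 y) φ
    rw [point_apply_zero, abs_zero, mul_zero, zero_mul] at this
    exact abs_nonpos_iff.1 this
  -- derivatives of test functions are test functions, and partial derivatives commute
  have hg0 : ∀ y : EuclideanSpace ℝ (Fin n), ∀ φ : EuclideanSpace ℝ (Fin (n + 1)) → ℝ,
      ContDiff ℝ ∞ φ → HasCompactSupport φ → tsupport φ ⊆ Ω →
        ∫ x in Ω, g x * fderiv ℝ φ x (point 0 y) = 0 := by
    intro y φ h1 h2 h3
    have hdd : ∀ w : EuclideanSpace ℝ (Fin (n + 1)), ContDiff ℝ ∞ (fun x => fderiv ℝ φ x w) :=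
      fun w => (h1.fderiv_right (m := ∞) (by simp)).clm_apply contDiff_const
    have hmem : ∀ w : EuclideanSpace ℝ (Fin (n + 1)),
        (fun x => fderiv ℝ φ x w) ∈ testFunctions Ω := fun w =>
      ⟨hdd w, h2.fderiv_apply ℝ w, (tsupport_fderiv_apply_subset ℝ w).trans h3⟩
    have h4 : ∫ x in Ω, u x * fderiv ℝ (fun x => fderiv ℝ φ x (point 0 y)) x (point 1 0) =
        -∫ x in Ω, g x * fderiv ℝ φ x (point 0 y) := hgφ ⟨_, hmem (point 0 y)⟩
    have h5 : ∫ x in Ω, u x * fderiv ℝ (fun x => fderiv ℝ φ x (point 1 0)) x (point 0 y) = 0 :=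
      htrans y ⟨_, hmem (point 1 0)⟩
    have hcomm : ∀ (x a b : EuclideanSpace ℝ (Fin (n + 1))),
        fderiv ℝ (fun x => fderiv ℝ φ x a) x b = fderiv ℝ (fun x => fderiv ℝ φ x b) x a := by
      intro x a b
      have hd : DifferentiableAt ℝ (fderiv ℝ φ) x :=
        (h1.fderiv_right (m := ∞) (by simp)).differentiable (by simp) x
      rw [fderiv_clm_apply hd (differentiableAt_const a),
        fderiv_clm_apply hd (differentiableAt_const b)]
      have hsymm := (h1.contDiffAt (x := x)).isSymmSndFDerivAt
        (by simpa using WithTop.coe_le_coe.2 (le_top : (2 : ℕ∞) ≤ ⊤))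
      simpa using hsymm b a
    simp only [hcomm _ (point 0 y) (point 1 0)] at h4
    rw [h5] at h4
    exact neg_eq_zero.1 h4.symm
  have hgl : LocallyIntegrableOn g Ω :=
    IntegrableOn.locallyIntegrableOn ((Lp.memLp g).integrable (by norm_num))
  obtain ⟨γ, hγm, hγ⟩ := exists_ae_eq_comp_apply_zero hΩ hb hproj hslice
    (Lp.stronglyMeasurable g).measurable hgl hg0
  have hγL : MemLp (fun x : EuclideanSpace ℝ (Fin (n + 1)) => γ (x 0)) 2 (volume.restrict Ω) :=
    (memLp_congr_ae hγ).1 (Lp.memLp g)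
  have hγl := locallyIntegrableOn_of_memLp_comp hΩ hproj hγm hγL
  have hhalf : (1 / 2 : ℝ) ∈ Ioo (0 : ℝ) 1 := by constructor <;> norm_num
  set Γ : ℝ → ℝ := fun t => ∫ s in (1 / 2 : ℝ)..t, γ s with hΓ
  have hΓc : ContinuousOn Γ (Ioo 0 1) := continuousOn_primitive hγl hhalf
  have hΓw : IsWeakGradient (Ioo (0 : ℝ) 1) Γ γ :=
    isWeakGradient_primitive (C := 0) hγl hhalf fun t _ => by simp [hΓ]
  have hΓl : LocallyIntegrableOn Γ (Ioo 0 1) := hΓc.locallyIntegrableOn measurableSet_Ioo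
  have hΓΩ := hΓw.comp_apply_zero hproj hΓl hγl
  have hder : ∀ φ : testFunctions Ω,
      ∫ x in Ω, u x * fderiv ℝ (φ : EuclideanSpace ℝ (Fin (n + 1)) → ℝ) x (point 1 0) =
        -∫ x in Ω, γ (x 0) * (φ : EuclideanSpace ℝ (Fin (n + 1)) → ℝ) x := by
    intro φ
    rw [hgφ φ]
    congr 1
    refine integral_congr_ae ?_
    filter_upwards [hγ] with x hx
    rw [hx]
  have hF : IsWeakGradient Ω (fun x => u x - Γ (x 0)) (fun _ => 0) := by
    intro φ h1 h2 h3 v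
    have i1 := integrable_mul_fderiv (Lp.memLp u) h1 h2 v
    have i2 : Integrable (fun x : EuclideanSpace ℝ (Fin (n + 1)) => Γ (x 0) * fderiv ℝ φ x v)
        (volume.restrict Ω) := (integrable_comp_apply_zero_mul hproj hΓl
      ((h1.continuous_fderiv (by simp)).clm_apply continuous_const) (h2.fderiv_apply ℝ v)
      ((tsupport_fderiv_apply_subset ℝ v).trans h3)).restrict
    have hv : v = v 0 • point 1 0 + point 0 (transversal v) := by
      rw [← point_eq_smul_add, point_transversal]
    have e1 : ∫ x in Ω, u x * fderiv ℝ φ x v = -(v 0 * ∫ x in Ω, γ (x 0) * φ x) := by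
      have j1 := integrable_mul_fderiv (Lp.memLp u) h1 h2 (point 1 0)
      have j2 := integrable_mul_fderiv (Lp.memLp u) h1 h2 (point 0 (transversal v))
      have e2 : (fun x => u x * fderiv ℝ φ x v) = fun x =>
          v 0 * (u x * fderiv ℝ φ x (point 1 0)) +
            u x * fderiv ℝ φ x (point 0 (transversal v)) := by
        funext x
        conv_lhs => rw [hv, map_add, map_smul, smul_eq_mul]
        ring
      rw [e2, integral_add (j1.const_mul _) j2, integral_const_mul,
        htrans _ ⟨φ, h1, h2, h3⟩, hder ⟨φ, h1, h2, h3⟩, add_zero, mul_neg]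
    have e3 := hΓΩ φ h1 h2 h3 v
    simp only [inner_point_zero_right] at e3
    have e4 : ∫ x in Ω, γ (x 0) * v 0 * φ x = v 0 * ∫ x in Ω, γ (x 0) * φ x := by
      rw [← integral_const_mul]
      refine integral_congr_ae (Eventually.of_forall fun x => ?_)
      simp only
      ring
    simp only [sub_mul, inner_zero_left, zero_mul, integral_zero, neg_zero]
    rw [integral_sub i1 i2, e1, e3, e4, sub_self]
  have hFl : LocallyIntegrableOn (fun x => u x - Γ (x 0)) Ω := by
    refine LocallyIntegrableOn.sub
      (IntegrableOn.locallyIntegrableOn ((Lp.memLp u).integrable (by norm_num))) ?_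
    refine ContinuousOn.locallyIntegrableOn ?_ hΩ.measurableSet
    exact hΓc.comp continuous_apply_zero.continuousOn fun x hx => hproj ▸ ⟨x, hx, rfl⟩
  obtain ⟨C, hC⟩ := hF.exists_ae_eq_const hΩ hconn hFl
  refine ⟨γ, C, hγm, hγL, ?_, hder⟩
  rw [ae_restrict_iff' hΩ.measurableSet]
  filter_upwards [hC] with x hx hxΩ
  rw [← hx hxΩ]
  simp [hΓ]

end Structure

/-! ### Truncation near the endpoints -/

section Truncation

theorem exists_setIntegral_Ioo_lt {ν : Measure ℝ} {f : ℝ → ℝ} (hf : Integrable f ν) {η τ : ℝ}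
    (hη : 0 < η) (hτ : 0 < τ) : ∃ b ∈ Ioo 0 τ, ∫ t in Ioo 0 b, f t ∂ν < η := by
  have h1 : Tendsto (fun n : ℕ => ∫ t in Ioo (0 : ℝ) (1 / ((n : ℝ) + 1)), f t ∂ν) atTop
      (𝓝 (∫ t in ⋂ n : ℕ, Ioo (0 : ℝ) (1 / ((n : ℝ) + 1)), f t ∂ν)) := by
    refine tendsto_setIntegral_of_antitone (fun _ => measurableSet_Ioo) ?_
      ⟨0, hf.integrableOn⟩
    intro m n hmn
    exact Ioo_subset_Ioo_right (Nat.one_div_le_one_div hmn)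
  have h2 : ⋂ n : ℕ, Ioo (0 : ℝ) (1 / ((n : ℝ) + 1)) = ∅ := by
    refine eq_empty_of_forall_notMem fun t ht => ?_
    rw [mem_iInter] at ht
    obtain ⟨n, hn⟩ := exists_nat_one_div_lt (ht 0).1
    exact (hn.trans (ht n).2).false
  rw [h2, setIntegral_empty] at h1
  have h3 : Tendsto (fun n : ℕ => 1 / ((n : ℝ) + 1)) atTop (𝓝 0) :=
    tendsto_one_div_add_atTop_nhds_zero_nat
  obtain ⟨n, hn1, hn2⟩ := ((h1.eventually_lt_const hη).and (h3.eventually_lt_const hτ)).exists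
  exact ⟨_, ⟨Nat.one_div_pos_of_nat, hn2⟩, hn1⟩

/-- There are cut-off points `a` near `0` at which the value of `S`, extended as a constant to
`(0, a)`, contributes little to the integral: choose `a` where `S` is below its mean over an
interval `[a₀, b)` carrying half of the mass of `(0, b)`. -/
theorem exists_small_left {ν : Measure ℝ} [IsFiniteMeasure ν]
    (hν : ∀ τ : ℝ, 0 < τ → 0 < ν (Ioo 0 τ)) {S : ℝ → ℝ} (hS : Integrable S ν)
    (hS0 : ∀ t, 0 ≤ S t) {η τ : ℝ} (hη : 0 < η) (hτ : 0 < τ) :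
    ∃ a ∈ Ioo 0 τ, ∫ t in Ioo 0 a, (S a + S t) ∂ν ≤ η := by
  obtain ⟨b, hb, hbS⟩ := exists_setIntegral_Ioo_lt hS (η := η / 4) (by positivity) hτ
  set m := ν.real (Ioo 0 b) with hm
  have hm0 : 0 < m := ENNReal.toReal_pos (hν b hb.1).ne' (measure_ne_top _ _)
  obtain ⟨a₀, ha₀, ha₀m⟩ := exists_setIntegral_Ioo_lt (ν := ν) (f := fun _ => (1 : ℝ))
    (integrable_const _) (η := m / 2) (by positivity) hb.1
  rw [setIntegral_const, smul_eq_mul, mul_one] at ha₀m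
  have hunion : Ioo 0 b = Ioo 0 a₀ ∪ Ico a₀ b := (Ioo_union_Ico_eq_Ioo ha₀.1 ha₀.2.le).symm
  have hIco : m / 2 ≤ ν.real (Ico a₀ b) := by
    have h1 : m ≤ ν.real (Ioo 0 a₀) + ν.real (Ico a₀ b) := by
      rw [hm, hunion]
      exact measureReal_union_le _ _
    linarith
  have hIco0 : ν (Ico a₀ b) ≠ 0 := by
    intro h
    rw [measureReal_def, h, ENNReal.toReal_zero] at hIco
    linarith
  obtain ⟨a, ha, haS⟩ := exists_le_setAverage hIco0 (measure_ne_top _ _) hS.integrableOn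
  have haτ : a ∈ Ioo 0 τ := ⟨ha₀.1.trans_le ha.1, ha.2.trans hb.2⟩
  refine ⟨a, haτ, ?_⟩
  have hle : ∀ s : Set ℝ, s ⊆ Ioo 0 b → ∫ t in s, S t ∂ν ≤ η / 4 := fun s hs =>
    (setIntegral_mono_set hS.integrableOn (Eventually.of_forall hS0)
      hs.eventuallyLE).trans hbS.le
  rw [setAverage_eq, smul_eq_mul] at haS
  have h1 : S a * (m / 2) ≤ η / 4 := by
    have hpos : 0 < ν.real (Ico a₀ b) := lt_of_lt_of_le (by positivity) hIco
    calc S a * (m / 2) ≤ S a * ν.real (Ico a₀ b) := mul_le_mul_of_nonneg_left hIco (hS0 a)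
      _ ≤ (ν.real (Ico a₀ b))⁻¹ * (∫ t in Ico a₀ b, S t ∂ν) * ν.real (Ico a₀ b) :=
          mul_le_mul_of_nonneg_right haS hpos.le
      _ = ∫ t in Ico a₀ b, S t ∂ν := by field_simp
      _ ≤ η / 4 := hle _ (hunion ▸ subset_union_right)
  have h2 : ν.real (Ioo 0 a) ≤ m := measureReal_mono (Ioo_subset_Ioo_right ha.2.le)
  rw [integral_add (integrable_const _) hS.integrableOn, setIntegral_const, smul_eq_mul]
  have h3 := hle (Ioo 0 a) (Ioo_subset_Ioo_right ha.2.le)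
  nlinarith [mul_le_mul_of_nonneg_right h2 (hS0 a)]

theorem exists_small_right {ν : Measure ℝ} [IsFiniteMeasure ν]
    (hν : ∀ τ : ℝ, τ < 1 → 0 < ν (Ioo τ 1)) {S : ℝ → ℝ} (hS : Integrable S ν)
    (hS0 : ∀ t, 0 ≤ S t) {η τ : ℝ} (hη : 0 < η) (hτ : τ < 1) :
    ∃ b ∈ Ioo τ 1, ∫ t in Ioo b 1, (S b + S t) ∂ν ≤ η := by
  have hme : MeasurableEmbedding (fun t : ℝ => 1 - t) :=
    (Homeomorph.subLeft (1 : ℝ)).measurableEmbedding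
  have hpre : ∀ a : ℝ, (fun t : ℝ => 1 - t) ⁻¹' Ioo 0 a = Ioo (1 - a) 1 := by
    intro a
    ext t
    simp only [mem_preimage, mem_Ioo]
    constructor <;> rintro ⟨h1, h2⟩ <;> constructor <;> linarith
  have : IsFiniteMeasure (ν.map (fun t : ℝ => 1 - t)) := Measure.isFiniteMeasure_map _ _
  obtain ⟨a, ha, h⟩ := exists_small_left (ν := ν.map (fun t : ℝ => 1 - t))
    (S := fun t => S (1 - t)) (fun τ hτ => by
      rw [hme.map_apply, hpre]
      exact hν _ (by linarith))
    (by
      rw [hme.integrable_map_iff]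
      simpa [Function.comp_def] using hS) (fun t => hS0 _) hη (sub_pos.2 hτ)
  refine ⟨1 - a, ⟨by linarith [ha.2], by linarith [ha.1]⟩, ?_⟩
  rw [hme.setIntegral_map, hpre] at h
  simpa using h

/-- The primitive of the truncation of `γ` to `(a, b]` is the primitive of `γ`, stopped at `a`
and `b`. -/
theorem integral_indicator_Ioc_eq {γ : ℝ → ℝ} {a b c : ℝ} (hca : a ≤ c) (hcb : c ≤ b) (t : ℝ) :
    ∫ s in c..t, (Ioc a b).indicator γ s = ∫ s in c..(max a (min t b)), γ s := by
  rcases le_total c t with h | h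
  · have h1 : c ≤ max a (min t b) := le_max_of_le_right (le_min h hcb)
    rw [intervalIntegral.integral_of_le h, intervalIntegral.integral_of_le h1,
      setIntegral_indicator measurableSet_Ioc, Ioc_inter_Ioc]
    have e1 : c ⊔ a = c := sup_eq_left.2 hca
    have e2 : max a (min t b) = t ⊓ b := max_eq_right (hca.trans (le_min h hcb))
    rw [e1, e2]
  · have h1 : max a (min t b) ≤ c := max_le hca ((min_le_left _ _).trans h)
    rw [intervalIntegral.integral_of_ge h, intervalIntegral.integral_of_ge h1,
      setIntegral_indicator measurableSet_Ioc, Ioc_inter_Ioc]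
    have e1 : c ⊓ b = c := inf_eq_left.2 hcb
    have e2 : max a (min t b) = t ⊔ a := by
      rw [min_eq_left (h.trans hcb)]; exact sup_comm a t
    rw [e1, e2]

end Truncation

/-! ### The weighted measure -/

section Weight

variable {h : ℝ → ℝ}

theorem isFiniteMeasure_weightMeasure (hbdd : MemLp h ⊤ (volume.restrict (Ioo (0 : ℝ) 1))) :
    IsFiniteMeasure (weightMeasure h) := by
  have h1 : Integrable h (volume.restrict (Ioo (0 : ℝ) 1)) := hbdd.integrable (by simp)
  exact isFiniteMeasure_withDensity_ofReal h1.2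

theorem weightMeasure_absolutelyContinuous (h : ℝ → ℝ) :
    weightMeasure h ≪ volume.restrict (Ioo (0 : ℝ) 1) := withDensity_absolutelyContinuous _ _

theorem absolutelyContinuous_weightMeasure
    (hm : AEMeasurable h (volume.restrict (Ioo (0 : ℝ) 1)))
    (hpos : ∀ᵐ t ∂volume.restrict (Ioo (0 : ℝ) 1), 0 < h t) :
    volume.restrict (Ioo (0 : ℝ) 1) ≪ weightMeasure h := by
  refine withDensity_absolutelyContinuous' hm.ennreal_ofReal ?_
  filter_upwards [hpos] with t ht
  simpa using ht

theorem weightMeasure_Ioo_pos (hm : AEMeasurable h (volume.restrict (Ioo (0 : ℝ) 1)))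
    (hpos : ∀ᵐ t ∂volume.restrict (Ioo (0 : ℝ) 1), 0 < h t) {s t : ℝ}
    (hst : (Ioo s t ∩ Ioo 0 1).Nonempty) : 0 < weightMeasure h (Ioo s t) := by
  refine pos_iff_ne_zero.2 fun h0 => ?_
  have h1 := absolutelyContinuous_weightMeasure hm hpos h0
  rw [Measure.restrict_apply measurableSet_Ioo] at h1
  exact ((isOpen_Ioo.inter isOpen_Ioo).measure_pos volume hst).ne' h1

theorem lintegral_mul_ofReal_eq (hm : AEMeasurable h (volume.restrict (Ioo (0 : ℝ) 1)))
    {f : ℝ → ℝ≥0∞} (hf : AEMeasurable f (volume.restrict (Ioo (0 : ℝ) 1))) :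
    ∫⁻ x in Ioo (0 : ℝ) 1, f x * ENNReal.ofReal (h x) = ∫⁻ x, f x ∂weightMeasure h := by
  rw [weightMeasure, lintegral_withDensity_eq_lintegral_mul₀ hm.ennreal_ofReal hf]
  refine lintegral_congr fun x => ?_
  rw [Pi.mul_apply, mul_comm]

theorem integral_mul_eq (hm : AEMeasurable h (volume.restrict (Ioo (0 : ℝ) 1)))
    (hnonneg : ∀ᵐ t ∂volume.restrict (Ioo (0 : ℝ) 1), 0 ≤ h t) (f : ℝ → ℝ) :
    ∫ x in Ioo (0 : ℝ) 1, f x * h x = ∫ x, f x ∂weightMeasure h := by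
  rw [weightMeasure, integral_withDensity_eq_integral_toReal_smul₀ hm.ennreal_ofReal
    (Eventually.of_forall fun _ => ENNReal.ofReal_lt_top)]
  refine integral_congr_ae ?_
  filter_upwards [hnonneg] with x hx
  rw [ENNReal.toReal_ofReal hx, smul_eq_mul, mul_comm]

theorem lintegral_enorm_sq_eq {X : Type*} [MeasurableSpace X] {μ : Measure X} {f : X → ℝ}
    (hf : MemLp f 2 μ) : ∫⁻ x, ‖f x‖ₑ ^ 2 ∂μ = ENNReal.ofReal (∫ x, f x ^ 2 ∂μ) := by
  rw [ofReal_integral_eq_lintegral_ofReal hf.integrable_sq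
    (Eventually.of_forall fun x => sq_nonneg _)]
  refine lintegral_congr fun x => ?_
  rw [Real.enorm_eq_ofReal_abs, ← ENNReal.ofReal_pow (abs_nonneg _), sq_abs]

end Weight

/-! ### The relaxed Sturm-Liouville problem -/

section MinMax

variable {E : Type*} [NormedAddCommGroup E] [InnerProductSpace ℝ E] [MeasureSpace E]
  [BorelSpace E] [IsFiniteMeasureOnCompacts (volume : Measure E)] {Ω : Set E} {w : E → ℝ}

theorem rayleigh_zero : rayleigh Ω w 0 = ⊤ := by
  have h1 : ∫⁻ x in Ω, ‖(0 : H1 Ω).1.1 x‖ₑ ^ 2 * ENNReal.ofReal (w x) = 0 := by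
    refine lintegral_eq_zero_of_ae_eq_zero ?_
    filter_upwards [Lp.coeFn_zero ℝ 2 (volume.restrict Ω)] with x hx
    have h2 : (0 : H1 Ω).1.1 x = 0 := hx
    rw [h2]
    simp
  rw [rayleigh, if_pos h1]

/-- A family of `k` functions whose nontrivial linear combinations have zero mean and finite
Rayleigh quotient at most `R` spans an admissible subspace of dimension `k`. -/
theorem minmax_le_of_family {k : ℕ} {u : Fin k → H1 Ω} {R : ℝ≥0∞} (hR : R ≠ ⊤)
    (hmean : ∀ c : Fin k → ℝ, ∫ x in Ω, (∑ i, c i • u i : H1 Ω).1.1 x * w x = 0)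
    (hray : ∀ c : Fin k → ℝ, c ≠ 0 → rayleigh Ω w (∑ i, c i • u i) ≤ R) :
    minmax Ω w k ≤ R := by
  set T : (Fin k → ℝ) →ₗ[ℝ] H1 Ω := Fintype.linearCombination ℝ u with hT
  have hTc : ∀ c, T c = ∑ i, c i • u i := fun c => Fintype.linearCombination_apply ℝ u c
  have hinj : Function.Injective T := by
    rw [injective_iff_map_eq_zero]
    intro c hc
    by_contra hne
    have h1 := hray c hne
    rw [← hTc, hc, rayleigh_zero, top_le_iff] at h1
    exact hR h1
  refine iInf_le_of_le (LinearMap.range T) (iInf_le_of_le ⟨inferInstance, ?_⟩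
    (iInf_le_of_le ?_ ?_))
  · rw [LinearMap.finrank_range_of_inj hinj, Module.finrank_fin_fun]
  · rintro _ ⟨c, rfl⟩
    rw [hTc]
    exact hmean c
  · refine iSup_le fun v => iSup_le fun hv => iSup_le fun hv0 => ?_
    obtain ⟨c, rfl⟩ := hv
    rw [hTc]
    refine hray c ?_
    rintro rfl
    exact hv0 (map_zero T)

theorem coeFn_sum_smul {F : Type*} [NormedAddCommGroup F] [NormedSpace ℝ F] {X : Type*}
    [MeasurableSpace X] {μ : Measure X} {k : ℕ} (u : Fin k → Lp F 2 μ) (c : Fin k → ℝ) :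
    (∑ i, c i • u i : Lp F 2 μ) =ᵐ[μ] fun x => ∑ i, c i • u i x := by
  refine (Lp.coeFn_finsetSum Finset.univ fun i => c i • u i).trans ?_
  have h1 : ∀ᵐ x ∂μ, ∀ i, (c i • u i : Lp F 2 μ) x = c i • u i x :=
    ae_all_iff.2 fun i => Lp.coeFn_smul (c i) (u i)
  filter_upwards [h1] with x hx
  simp only [Finset.sum_apply, hx]

theorem fst_sum_smul {k : ℕ} (u : Fin k → H1 Ω) (c : Fin k → ℝ) :
    (∑ i, c i • u i : H1 Ω).1.1 = ∑ i, c i • (u i).1.1 := by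
  simp only [Submodule.coe_sum, Submodule.coe_smul, Prod.fst_sum, Prod.smul_fst]

theorem snd_sum_smul {k : ℕ} (u : Fin k → H1 Ω) (c : Fin k → ℝ) :
    (∑ i, c i • u i : H1 Ω).1.2 = ∑ i, c i • (u i).1.2 := by
  simp only [Submodule.coe_sum, Submodule.coe_smul, Prod.snd_sum, Prod.smul_snd]

end MinMax

section Interval

/-- The primitive of `γ` truncated to `(a, b]`, with value `C` at the midpoint of `(0, 1)`. -/
def truncatedPrimitive (γ : ℝ → ℝ) (a b C t : ℝ) : ℝ :=
  C + ∫ s in (1 / 2 : ℝ)..t, (Ioc a b).indicator γ s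

variable {γ : ℝ → ℝ} {a b : ℝ}

theorem truncatedPrimitive_eq (ha : a ≤ 1 / 2) (hb : 1 / 2 ≤ b) (C t : ℝ) :
    truncatedPrimitive γ a b C t = C + ∫ s in (1 / 2 : ℝ)..(max a (min t b)), γ s := by
  rw [truncatedPrimitive, integral_indicator_Ioc_eq ha hb]

theorem integrable_indicator_Ioc (hγ : LocallyIntegrableOn γ (Ioo 0 1)) (ha : 0 < a)
    (hb : b < 1) : Integrable ((Ioc a b).indicator γ) := by
  rw [integrable_indicator_iff measurableSet_Ioc]
  exact (hγ.integrableOn_compact_subset (fun x hx => ⟨ha.trans_le hx.1, hx.2.trans_lt hb⟩)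
    isCompact_Icc).mono_set Ioc_subset_Icc_self

theorem continuous_truncatedPrimitive (hγ : LocallyIntegrableOn γ (Ioo 0 1)) (ha : 0 < a)
    (hb : b < 1) (C : ℝ) : Continuous (truncatedPrimitive γ a b C) :=
  continuous_const.add (intervalIntegral.continuous_primitive
    (fun _ _ => (integrable_indicator_Ioc hγ ha hb).intervalIntegrable) _)

theorem exists_abs_truncatedPrimitive_le (hγ : LocallyIntegrableOn γ (Ioo 0 1)) (ha : 0 < a)
    (hb : b < 1) (C : ℝ) : ∃ B, ∀ t, ‖truncatedPrimitive γ a b C t‖ ≤ B := by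
  have hi := integrable_indicator_Ioc hγ ha hb
  refine ⟨‖C‖ + ∫ s, ‖(Ioc a b).indicator γ s‖, fun t => (norm_add_le _ _).trans ?_⟩
  refine add_le_add le_rfl ((intervalIntegral.norm_integral_le_integral_norm_uIoc).trans ?_)
  exact setIntegral_le_integral hi.norm (Eventually.of_forall fun _ => norm_nonneg _)

theorem memLp_truncatedPrimitive (hγ : LocallyIntegrableOn γ (Ioo 0 1)) (ha : 0 < a)
    (hb : b < 1) (C : ℝ) (ν : Measure ℝ) [IsFiniteMeasure ν] :
    MemLp (truncatedPrimitive γ a b C) 2 ν := by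
  obtain ⟨B, hB⟩ := exists_abs_truncatedPrimitive_le hγ ha hb C
  exact MemLp.of_bound (continuous_truncatedPrimitive hγ ha hb C).aestronglyMeasurable B
    (Eventually.of_forall hB)

theorem memLp_indicator_Ioc (hγm : Measurable γ)
    (hγ : LocallyIntegrableOn (fun t => γ t ^ 2) (Ioo 0 1)) (ha : 0 < a) (hb : b < 1) :
    MemLp ((Ioc a b).indicator γ) 2 (volume.restrict (Ioo (0 : ℝ) 1)) := by
  refine (memLp_two_iff_integrable_sq
    (hγm.indicator measurableSet_Ioc).aestronglyMeasurable).2 ?_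
  have h1 := (integrable_indicator_Ioc hγ ha hb).restrict (s := Ioo (0 : ℝ) 1)
  refine h1.congr (Eventually.of_forall fun t => ?_)
  by_cases ht : t ∈ Ioc a b <;> simp [ht]

/-- Truncated primitives are elements of `H¹(0, 1)`. -/
theorem exists_H1_truncatedPrimitive (hγm : Measurable γ)
    (hγ : LocallyIntegrableOn γ (Ioo 0 1))
    (hγ2 : LocallyIntegrableOn (fun t => γ t ^ 2) (Ioo 0 1)) (ha : 0 < a) (hb : b < 1) (C : ℝ) :
    ∃ u : H1 (Ioo (0 : ℝ) 1),
      u.1.1 =ᵐ[volume.restrict (Ioo (0 : ℝ) 1)] truncatedPrimitive γ a b C ∧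
      u.1.2 =ᵐ[volume.restrict (Ioo (0 : ℝ) 1)] (Ioc a b).indicator γ := by
  have h1 := memLp_truncatedPrimitive hγ ha hb C (volume.restrict (Ioo (0 : ℝ) 1))
  have h2 := memLp_indicator_Ioc hγm hγ2 ha hb
  have h3 : IsWeakGradient (Ioo (0 : ℝ) 1) (truncatedPrimitive γ a b C)
      ((Ioc a b).indicator γ) :=
    isWeakGradient_primitive (c := 1 / 2) (C := C)
      ((integrable_indicator_Ioc hγ ha hb).locallyIntegrable.locallyIntegrableOn _)
      (by constructor <;> norm_num) fun t _ => rfl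
  exact ⟨⟨(h1.toLp, h2.toLp), h3.congr_ae h1.coeFn_toLp.symm h2.coeFn_toLp.symm⟩,
    h1.coeFn_toLp, h2.coeFn_toLp⟩

end Interval

section Approximation

variable {h : ℝ → ℝ} {k : ℕ}

/-- If truncations `W` of functions `w` with `∫ (∑ cᵢ wᵢ)² = |c|²` are close to `w` in `L²`, then
their linear combinations are almost normalized. -/
theorem le_integral_sq_of_close {ν : Measure ℝ} {w W : Fin k → ℝ → ℝ}
    (hw : ∀ i, MemLp (w i) 2 ν) (hW : ∀ i, MemLp (W i) 2 ν)
    (hnorm : ∀ c : Fin k → ℝ, ∫ t, (∑ i, c i * w i t) ^ 2 ∂ν = ∑ i, c i ^ 2) {s η : ℝ}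
    (hs : 0 < s) (hη : (1 + s⁻¹) * (k * η) ≤ s)
    (hclose : ∀ i, ∫ t, (W i t - w i t) ^ 2 ∂ν ≤ η) (c : Fin k → ℝ) :
    (1 - s) * ∑ i, c i ^ 2 ≤ (1 + s) * ∫ t, (∑ i, c i * W i t) ^ 2 ∂ν := by
  have hg : MemLp (fun t => ∑ i, c i * W i t) 2 ν :=
    memLp_finsetSum _ fun i _ => (hW i).const_mul (c i)
  have hd : ∀ i, Integrable (fun t => (W i t - w i t) ^ 2) ν := fun i =>
    ((hW i).sub (hw i)).integrable_sq
  have hpt : ∀ t, (∑ i, c i * w i t) ^ 2 ≤ (1 + s) * (∑ i, c i * W i t) ^ 2 +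
      (1 + s⁻¹) * ((∑ i, c i ^ 2) * ∑ i, (W i t - w i t) ^ 2) := by
    intro t
    have h1 : (∑ i, c i * (W i t - w i t)) ^ 2 ≤
        (∑ i, c i ^ 2) * ∑ i, (W i t - w i t) ^ 2 := Finset.sum_mul_sq_le_sq_mul_sq _ _ _
    have h2 : ∑ i, c i * w i t = ∑ i, c i * W i t - ∑ i, c i * (W i t - w i t) := by
      rw [← Finset.sum_sub_distrib]
      refine Finset.sum_congr rfl fun i _ => by ring
    set x := ∑ i, c i * W i t
    set y := ∑ i, c i * (W i t - w i t)
    have hs' : 0 < s⁻¹ := inv_pos.2 hs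
    have h3 : (x - y) ^ 2 ≤ (1 + s) * x ^ 2 + (1 + s⁻¹) * y ^ 2 := by
      have h4 : 0 ≤ s⁻¹ * (s * x + y) ^ 2 := by positivity
      have h5 : s⁻¹ * (s * x + y) ^ 2 = s * x ^ 2 + 2 * x * y + s⁻¹ * y ^ 2 := by
        field_simp
        ring
      nlinarith
    rw [h2]
    refine h3.trans (add_le_add le_rfl (mul_le_mul_of_nonneg_left h1 (by positivity)))
  have i1 : Integrable (fun t => (1 + s) * (∑ i, c i * W i t) ^ 2) ν :=
    hg.integrable_sq.const_mul _
  have i2 : Integrable (fun t => ∑ i, (W i t - w i t) ^ 2) ν :=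
    integrable_finsetSum _ fun i _ => hd i
  have i3 := (i2.const_mul (∑ i, c i ^ 2)).const_mul (1 + s⁻¹)
  have h4 := integral_mono_of_nonneg (μ := ν) (Eventually.of_forall fun t => sq_nonneg _)
    (i1.add i3) (Eventually.of_forall hpt)
  simp only [Pi.add_apply] at h4
  rw [hnorm, integral_add i1 i3, integral_const_mul, integral_const_mul, integral_const_mul,
    integral_finsetSum _ fun i _ => hd i] at h4
  have h5 : ∑ i, ∫ t, (W i t - w i t) ^ 2 ∂ν ≤ k * η := by
    refine (Finset.sum_le_sum fun i _ => hclose i).trans ?_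
    simp
  have h6 : 0 ≤ ∑ i, c i ^ 2 := Finset.sum_nonneg fun i _ => sq_nonneg _
  have h7 : (1 + s⁻¹) * ((∑ i, c i ^ 2) * ∑ i, ∫ t, (W i t - w i t) ^ 2 ∂ν) ≤
      s * ∑ i, c i ^ 2 := by
    calc (1 + s⁻¹) * ((∑ i, c i ^ 2) * ∑ i, ∫ t, (W i t - w i t) ^ 2 ∂ν)
        ≤ (1 + s⁻¹) * ((∑ i, c i ^ 2) * (k * η)) := by gcongr
      _ = (1 + s⁻¹) * (k * η) * ∑ i, c i ^ 2 := by ring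
      _ ≤ s * ∑ i, c i ^ 2 := mul_le_mul_of_nonneg_right hη h6
  linarith

/-- Subtracting the mean does not increase the `L²` distance to a function of mean zero. -/
theorem integral_sub_mean_sq_le {ν : Measure ℝ} [IsFiniteMeasure ν] (hν : ν.real univ ≠ 0)
    {w W : ℝ → ℝ} (hw : MemLp w 2 ν) (hW : MemLp W 2 ν) (hmean : ∫ t, w t ∂ν = 0) :
    ∫ t, (W t - (∫ t, W t ∂ν) / ν.real univ - w t) ^ 2 ∂ν ≤ ∫ t, (W t - w t) ^ 2 ∂ν := by
  set m := (∫ t, W t ∂ν) / ν.real univ with hm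
  have i1 : Integrable (fun t => (W t - w t) ^ 2) ν := (hW.sub hw).integrable_sq
  have i2 : Integrable (fun t => W t - w t) ν := (hW.sub hw).integrable (by norm_num)
  have h1 : ∀ t, (W t - m - w t) ^ 2 = ((W t - w t) ^ 2 - 2 * m * (W t - w t)) + m ^ 2 :=
    fun t => by ring
  have h2 : ∫ t, (W t - w t) ∂ν = m * ν.real univ := by
    rw [integral_sub (hW.integrable (by norm_num)) (hw.integrable (by norm_num)), hmean, sub_zero,
      hm, div_mul_cancel₀ _ hν]
  have i3 : Integrable (fun t => (W t - w t) ^ 2 - 2 * m * (W t - w t)) ν :=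
    i1.sub (i2.const_mul _)
  simp only [h1]
  rw [integral_add i3 (integrable_const _),
    integral_sub i1 (i2.const_mul _), integral_const_mul, h2, integral_const, smul_eq_mul]
  have h3 : 0 ≤ m ^ 2 * ν.real univ := mul_nonneg (sq_nonneg _) measureReal_nonneg
  linarith

/-- Finitely many primitives in `L²(h)` are approximated in `L²(h)` by their truncations. -/
theorem exists_truncation_close (hbdd : MemLp h ⊤ (volume.restrict (Ioo (0 : ℝ) 1)))
    (hpos : ∀ᵐ t ∂volume.restrict (Ioo (0 : ℝ) 1), 0 < h t) {γ : Fin k → ℝ → ℝ} {C : Fin k → ℝ}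
    (hw : ∀ i, MemLp (fun t => C i + ∫ s in (1 / 2 : ℝ)..t, γ i s) 2 (weightMeasure h))
    {η : ℝ} (hη : 0 < η) :
    ∃ a b : ℝ, 0 < a ∧ a ≤ 1 / 2 ∧ 1 / 2 ≤ b ∧ b < 1 ∧ ∀ i,
      ∫ t, (truncatedPrimitive (γ i) a b (C i) t - (C i + ∫ s in (1 / 2 : ℝ)..t, γ i s)) ^ 2
        ∂weightMeasure h ≤ η := by
  have := isFiniteMeasure_weightMeasure hbdd
  have hm := hbdd.1.aemeasurable
  set ν := weightMeasure h with hν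
  set w : Fin k → ℝ → ℝ := fun i t => C i + ∫ s in (1 / 2 : ℝ)..t, γ i s with hwdef
  -- the cut-off points are chosen for the sum of squares, hence are common to all the functions
  set S : ℝ → ℝ := fun t => ∑ i, w i t ^ 2 with hS
  have hSi : Integrable S ν := integrable_finsetSum _ fun i _ => (hw i).integrable_sq
  have hS0 : ∀ t, 0 ≤ S t := fun t => Finset.sum_nonneg fun i _ => sq_nonneg _
  have hle : ∀ i t, w i t ^ 2 ≤ S t := fun i t =>
    Finset.single_le_sum (f := fun i => w i t ^ 2) (fun i _ => sq_nonneg _) (Finset.mem_univ i)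
  obtain ⟨a, ha, haS⟩ := exists_small_left (ν := ν) (fun τ hτ =>
    weightMeasure_Ioo_pos hm hpos ⟨min τ 1 / 2, by
      have : 0 < min τ 1 := lt_min hτ one_pos
      exact ⟨⟨by linarith, by linarith [min_le_left τ 1]⟩,
        by linarith, by linarith [min_le_right τ 1]⟩⟩) hSi hS0
    (η := η / 4) (τ := 1 / 2) (by positivity) (by norm_num)
  obtain ⟨b, hb, hbS⟩ := exists_small_right (ν := ν) (fun τ hτ =>
    weightMeasure_Ioo_pos hm hpos ⟨(max τ 0 + 1) / 2, by
      have : max τ 0 < 1 := max_lt hτ one_pos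
      exact ⟨⟨by linarith [le_max_left τ 0], by linarith⟩,
        by linarith [le_max_right τ 0], by linarith⟩⟩) hSi hS0
    (η := η / 4) (τ := 1 / 2) (by positivity) (by norm_num)
  refine ⟨a, b, ha.1, ha.2.le, hb.1.le, hb.2, fun i => ?_⟩
  have hI : ∀ᵐ t ∂ν, t ∈ Ioo (0 : ℝ) 1 :=
    (weightMeasure_absolutelyContinuous h).ae_le (ae_restrict_mem measurableSet_Ioo)
  have hval : ∀ t, truncatedPrimitive (γ i) a b (C i) t = w i (max a (min t b)) := fun t =>
    truncatedPrimitive_eq ha.2.le hb.1.le _ _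
  set f : ℝ → ℝ := fun t => 2 * (Ioo 0 a).indicator (fun t => S a + S t) t +
    2 * (Ioo b 1).indicator (fun t => S b + S t) t with hf
  have ia : Integrable (fun t => S a + S t) ν := (integrable_const _).add hSi
  have ib : Integrable (fun t => S b + S t) ν := (integrable_const _).add hSi
  have hpt : ∀ᵐ t ∂ν, (truncatedPrimitive (γ i) a b (C i) t - w i t) ^ 2 ≤ f t := by
    filter_upwards [hI] with t ht
    rw [hval, hf]
    simp only
    have hsq : ∀ x y : ℝ, (x - y) ^ 2 ≤ 2 * (x ^ 2 + y ^ 2) := fun x y => by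
      nlinarith [sq_nonneg (x + y)]
    rcases lt_or_ge t a with hta | hta
    · have e1 : max a (min t b) = a := max_eq_left ((min_le_left _ _).trans hta.le)
      have e2 : t ∉ Ioo b 1 := fun h => by linarith [h.1, ha.2, hb.1]
      rw [e1, indicator_of_mem (show t ∈ Ioo 0 a from ⟨ht.1, hta⟩), indicator_of_notMem e2,
        mul_zero, add_zero]
      exact (hsq _ _).trans (by linarith [hle i a, hle i t])
    · rcases le_or_gt t b with htb | htb
      · have e1 : max a (min t b) = t := by rw [min_eq_left htb, max_eq_right hta]
        rw [e1, sub_self]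
        have e2 : t ∉ Ioo 0 a := fun h => h.2.not_ge hta
        have e3 : t ∉ Ioo b 1 := fun h => h.1.not_ge htb
        rw [indicator_of_notMem e2, indicator_of_notMem e3]
        norm_num
      · have e1 : max a (min t b) = b := by
          rw [min_eq_right htb.le, max_eq_right (by linarith [ha.2, hb.1])]
        have e2 : t ∉ Ioo 0 a := fun h => h.2.not_ge hta
        rw [e1, indicator_of_mem (show t ∈ Ioo b 1 from ⟨htb, ht.2⟩), indicator_of_notMem e2,
          mul_zero, zero_add]
        exact (hsq _ _).trans (by linarith [hle i b, hle i t])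
  have j1 := (ia.indicator (measurableSet_Ioo (a := 0) (b := a))).const_mul 2
  have j2 := (ib.indicator (measurableSet_Ioo (a := b) (b := 1))).const_mul 2
  refine (integral_mono_of_nonneg (Eventually.of_forall fun t => sq_nonneg _) (j1.add j2)
    hpt).trans ?_
  simp only [Pi.add_apply]
  rw [integral_add j1 j2, integral_const_mul, integral_const_mul,
    integral_indicator measurableSet_Ioo, integral_indicator measurableSet_Ioo]
  linarith

/-- Functions which are primitives on `(0, 1)`, possibly not in `H¹(0, 1)`, bound the relaxed
eigenvalue just as test functions in `H¹(0, 1)` do. -/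
theorem sturmLiouvilleEigenvalue_le_of_primitives
    (hbdd : MemLp h ⊤ (volume.restrict (Ioo (0 : ℝ) 1)))
    (hpos : ∀ᵐ t ∂volume.restrict (Ioo (0 : ℝ) 1), 0 < h t) {γ : Fin k → ℝ → ℝ} {C : Fin k → ℝ}
    (hw : ∀ i, MemLp (fun t => C i + ∫ s in (1 / 2 : ℝ)..t, γ i s) 2 (weightMeasure h))
    (hγm : ∀ i, Measurable (γ i))
    (hγ : ∀ i, LocallyIntegrableOn (γ i) (Ioo 0 1))
    (hγ2 : ∀ i, LocallyIntegrableOn (fun t => γ i t ^ 2) (Ioo 0 1))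
    (hγν : ∀ i, MemLp (γ i) 2 (weightMeasure h))
    (hmean : ∀ i, ∫ t, (C i + ∫ s in (1 / 2 : ℝ)..t, γ i s) ∂weightMeasure h = 0)
    (hnorm : ∀ c : Fin k → ℝ, ∫ t, (∑ i, c i * (C i + ∫ s in (1 / 2 : ℝ)..t, γ i s)) ^ 2
      ∂weightMeasure h = ∑ i, c i ^ 2) {lam : ℝ} (hlam : 0 ≤ lam)
    (hgrad : ∀ c : Fin k → ℝ, ∫ t, (∑ i, c i * γ i t) ^ 2 ∂weightMeasure h ≤
      lam * ∑ i, c i ^ 2) :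
    sturmLiouvilleEigenvalue h k ≤ ENNReal.ofReal lam := by
  have := isFiniteMeasure_weightMeasure hbdd
  have hm := hbdd.1.aemeasurable
  have hac := absolutelyContinuous_weightMeasure hm hpos
  have hac' := weightMeasure_absolutelyContinuous h
  have hnn : ∀ᵐ t ∂volume.restrict (Ioo (0 : ℝ) 1), 0 ≤ h t := hpos.mono fun t ht => ht.le
  set ν := weightMeasure h with hν
  have hν0 : ν.real univ ≠ 0 := by
    refine (ENNReal.toReal_pos ?_ (measure_ne_top _ _)).ne'
    refine ((weightMeasure_Ioo_pos hm hpos (s := 0) (t := 1)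
      ⟨1 / 2, by constructor <;> constructor <;> norm_num⟩).trans_le
        (measure_mono (subset_univ _))).ne'
  -- the bound up to a factor which tends to `1` with `s`
  have key : ∀ s ∈ Ioo (0 : ℝ) 1,
      sturmLiouvilleEigenvalue h k ≤ ENNReal.ofReal (lam * ((1 + s) / (1 - s))) := by
    intro s hs
    -- `k + 1` instead of `k` avoids a zero denominator when `k = 0`
    set η : ℝ := s / ((1 + s⁻¹) * (k + 1)) with hηdef
    have hs' : 0 < s⁻¹ := inv_pos.2 hs.1
    have hη : 0 < η := div_pos hs.1 (by positivity)
    have hηk : (1 + s⁻¹) * (k * η) ≤ s := by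
      have h1 : (1 + s⁻¹) * ((k + 1) * η) = s := by
        have h2 : (1 + s⁻¹) * ((k : ℝ) + 1) ≠ 0 := by positivity
        rw [← mul_assoc, hηdef, mul_div_assoc', mul_div_cancel_left₀ _ h2]
      have h2 : (1 + s⁻¹) * (k * η) ≤ (1 + s⁻¹) * ((k + 1) * η) := by
        gcongr
        linarith
      exact h2.trans_eq h1
    obtain ⟨a, b, ha0, ha, hb, hb1, hclose⟩ := exists_truncation_close hbdd hpos hw hη
    set m : Fin k → ℝ := fun i =>
      (∫ t, truncatedPrimitive (γ i) a b (C i) t ∂ν) / ν.real univ with hmdef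
    set W : Fin k → ℝ → ℝ := fun i => truncatedPrimitive (γ i) a b (C i - m i) with hW
    have hWeq : ∀ i t, W i t = truncatedPrimitive (γ i) a b (C i) t - m i := fun i t => by
      simp only [hW, truncatedPrimitive]; ring
    have hWL : ∀ i, MemLp (W i) 2 ν := fun i => memLp_truncatedPrimitive (hγ i) ha0 hb1 _ ν
    have hWc : ∀ i, ∫ t, (W i t - (C i + ∫ s in (1 / 2 : ℝ)..t, γ i s)) ^ 2 ∂ν ≤ η := fun i => by
      simp only [hWeq]
      exact (integral_sub_mean_sq_le hν0 (hw i)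
        (memLp_truncatedPrimitive (hγ i) ha0 hb1 (C i) ν) (hmean i)).trans (hclose i)
    have hWmean : ∀ i, ∫ t, W i t ∂ν = 0 := fun i => by
      simp only [hWeq]
      rw [integral_sub ((memLp_truncatedPrimitive (hγ i) ha0 hb1 (C i) ν).integrable
        (by norm_num)) (integrable_const _), integral_const, smul_eq_mul, hmdef]
      simp only
      rw [mul_div_cancel₀ _ hν0, sub_self]
    have hlow := le_integral_sq_of_close hw hWL hnorm hs.1 hηk hWc
    choose u hu1 hu2 using fun i => exists_H1_truncatedPrimitive (hγm i) (hγ i) (hγ2 i) ha0 hb1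
      (C i - m i)
    have hsum1 : ∀ c : Fin k → ℝ, (∑ i, c i • u i : H1 (Ioo (0 : ℝ) 1)).1.1
        =ᵐ[volume.restrict (Ioo (0 : ℝ) 1)] fun t => ∑ i, c i * W i t := by
      intro c
      rw [fst_sum_smul]
      filter_upwards [coeFn_sum_smul (fun i => (u i).1.1) c, ae_all_iff.2 hu1] with t h1 h2
      rw [h1]
      simp only [h2, smul_eq_mul, hW]
    have hsum2 : ∀ c : Fin k → ℝ, (∑ i, c i • u i : H1 (Ioo (0 : ℝ) 1)).1.2
        =ᵐ[volume.restrict (Ioo (0 : ℝ) 1)] (Ioc a b).indicator fun t => ∑ i, c i * γ i t := by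
      intro c
      rw [snd_sum_smul]
      filter_upwards [coeFn_sum_smul (fun i => (u i).1.2) c, ae_all_iff.2 hu2] with t h1 h2
      rw [h1]
      simp only [h2, smul_eq_mul]
      by_cases ht : t ∈ Ioc a b <;> simp [ht]
    refine minmax_le_of_family (u := u) ENNReal.ofReal_ne_top (fun c => ?_) (fun c hc => ?_)
    · rw [integral_mul_eq hm hnn, integral_congr_ae (hac'.ae_le (hsum1 c)),
        integral_finsetSum _ fun i _ => ((hWL i).integrable (by norm_num)).const_mul _]
      simp only [integral_const_mul, hWmean, mul_zero, Finset.sum_const_zero]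
    · have hc0 : 0 < ∑ i, c i ^ 2 := by
        obtain ⟨i, hi⟩ := Function.ne_iff.1 hc
        exact Finset.sum_pos' (fun i _ => sq_nonneg _)
          ⟨i, Finset.mem_univ i, by have : c i ≠ 0 := hi; positivity⟩
      have hWc2 : MemLp (fun t => ∑ i, c i * W i t) 2 ν :=
        memLp_finsetSum _ fun i _ => (hWL i).const_mul (c i)
      have hγc2 : MemLp (fun t => ∑ i, c i * γ i t) 2 ν :=
        memLp_finsetSum _ fun i _ => (hγν i).const_mul (c i)
      have hden : ∫⁻ x in Ioo (0 : ℝ) 1, ‖(∑ i, c i • u i : H1 (Ioo (0 : ℝ) 1)).1.1 x‖ₑ ^ 2 *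
          ENNReal.ofReal (h x) = ENNReal.ofReal (∫ t, (∑ i, c i * W i t) ^ 2 ∂ν) := by
        rw [lintegral_mul_ofReal_eq hm ((Lp.aestronglyMeasurable _).enorm.pow_const 2),
          ← lintegral_enorm_sq_eq hWc2]
        refine lintegral_congr_ae ?_
        filter_upwards [hac'.ae_le (hsum1 c)] with t ht
        rw [ht]
      have hnum : ∫⁻ x in Ioo (0 : ℝ) 1, ‖(∑ i, c i • u i : H1 (Ioo (0 : ℝ) 1)).1.2 x‖ₑ ^ 2 *
          ENNReal.ofReal (h x) ≤ ENNReal.ofReal (lam * ∑ i, c i ^ 2) := by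
        rw [lintegral_mul_ofReal_eq hm ((Lp.aestronglyMeasurable _).enorm.pow_const 2)]
        refine le_trans ?_ (ENNReal.ofReal_le_ofReal (hgrad c))
        rw [← lintegral_enorm_sq_eq hγc2]
        refine lintegral_mono_ae ?_
        filter_upwards [hac'.ae_le (hsum2 c)] with t ht
        rw [ht]
        gcongr
        exact enorm_indicator_le_enorm_self _ _
      have hQ : 0 < ∫ t, (∑ i, c i * W i t) ^ 2 ∂ν := by
        have h1 := hlow c
        have h2 : 0 < (1 - s) * ∑ i, c i ^ 2 := mul_pos (by linarith [hs.2]) hc0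
        exact pos_of_mul_pos_right (h2.trans_le h1) (by linarith [hs.1])
      rw [rayleigh, if_neg (by rw [hden]; simpa using hQ), hden]
      refine (ENNReal.div_le_div_right hnum _).trans ?_
      rw [← ENNReal.ofReal_div_of_pos hQ]
      refine ENNReal.ofReal_le_ofReal ?_
      rw [div_le_iff₀ hQ, mul_assoc]
      refine mul_le_mul_of_nonneg_left ?_ hlam
      rw [div_mul_eq_mul_div, le_div_iff₀ (by linarith [hs.2]), mul_comm]
      exact hlow c
  have hlim : Tendsto (fun s : ℝ => ENNReal.ofReal (lam * ((1 + s) / (1 - s)))) (𝓝[>] 0)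
      (𝓝 (ENNReal.ofReal lam)) := by
    refine ENNReal.tendsto_ofReal ?_
    have h1 : ContinuousAt (fun s : ℝ => lam * ((1 + s) / (1 - s))) 0 := by
      refine continuousAt_const.mul (ContinuousAt.div ?_ ?_ (by norm_num)) <;> fun_prop
    have h2 := h1.tendsto.mono_left (nhdsWithin_le_nhds (s := Ioi 0))
    simpa using h2
  refine ge_of_tendsto hlim ?_
  filter_upwards [Ioo_mem_nhdsGT one_pos] with s hs
  exact key s hs

end Approximation

/-! ### Compactness for thin domains -/

section RayleighNorm

variable {E : Type*} [NormedAddCommGroup E] [InnerProductSpace ℝ E] [MeasureSpace E]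
  [BorelSpace E] [IsFiniteMeasureOnCompacts (volume : Measure E)] {Ω : Set E}

theorem lintegral_enorm_sq_Lp {X F : Type*} [MeasurableSpace X] {μ : Measure X}
    [NormedAddCommGroup F] (f : Lp F 2 μ) : ∫⁻ x, ‖f x‖ₑ ^ 2 ∂μ = ‖f‖ₑ ^ 2 := by
  have h1 := eLpNorm_nnreal_pow_eq_lintegral (f := f) (μ := μ) (p := 2) (by norm_num)
  rw [Lp.enorm_def]
  simpa using h1.symm

theorem rayleigh_one_eq (u : H1 Ω) : rayleigh Ω (fun _ => 1) u =
    if ‖u.1.1‖ₑ ^ 2 = 0 then ⊤ else ‖u.1.2‖ₑ ^ 2 / ‖u.1.1‖ₑ ^ 2 := by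
  simp only [rayleigh, ENNReal.ofReal_one, mul_one, lintegral_enorm_sq_Lp]

theorem norm_le_of_rayleigh_le {u : H1 Ω} {lam : ℝ} (hlam : 0 ≤ lam)
    (hu : rayleigh Ω (fun _ => 1) u ≤ ENNReal.ofReal lam) :
    u.1.1 ≠ 0 ∧ ‖u.1.2‖ ≤ √lam * ‖u.1.1‖ := by
  rw [rayleigh_one_eq] at hu
  split_ifs at hu with h0
  · exact absurd (top_le_iff.1 hu) ENNReal.ofReal_ne_top
  have h1 : u.1.1 ≠ 0 := by
    rintro h
    rw [h] at h0
    simp at h0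
  refine ⟨h1, ?_⟩
  rw [ENNReal.div_le_iff h0 (by simp)] at hu
  rw [← ofReal_norm, ← ofReal_norm, ← ENNReal.ofReal_pow (norm_nonneg _),
    ← ENNReal.ofReal_pow (norm_nonneg _), ← ENNReal.ofReal_mul hlam,
    ENNReal.ofReal_le_ofReal_iff (by positivity)] at hu
  refine Real.sqrt_le_sqrt hu |>.trans_eq' ?_ |>.trans_eq ?_
  · rw [Real.sqrt_sq (norm_nonneg _)]
  · rw [Real.sqrt_mul hlam, Real.sqrt_sq (norm_nonneg _)]

/-- The directional derivative of a test function. -/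
def testDeriv (v : E) (φ : testFunctions Ω) : testFunctions Ω :=
  ⟨fun x => fderiv ℝ (φ : E → ℝ) x v,
    (φ.2.1.fderiv_right (m := ∞) (by simp)).clm_apply contDiff_const,
    φ.2.2.1.fderiv_apply ℝ v, (tsupport_fderiv_apply_subset ℝ v).trans φ.2.2.2⟩

theorem inner_testDeriv (u : Lp ℝ 2 (volume.restrict Ω)) (v : E) (φ : testFunctions Ω) :
    inner ℝ u (testToLp Ω (testDeriv v φ)) =
      ∫ x in Ω, u x * fderiv ℝ (φ : E → ℝ) x v := inner_testToLp _ _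

end RayleighNorm

section Compactness

variable {E : Type*} [NormedAddCommGroup E] [InnerProductSpace ℝ E] [FiniteDimensional ℝ E]
  [MeasureSpace E] [BorelSpace E] [(volume : Measure E).IsAddHaarMeasure] {Ω Ω' : Set E}

theorem norm_pullbackLp {F : Type*} [NormedAddCommGroup F] [NormedSpace ℝ F] (A : E ≃L[ℝ] E)
    (h : Ω' = A '' Ω) (u : Lp F 2 (volume.restrict Ω')) :
    ‖pullbackLp A F h u‖ = (jacobianFactor A ^ (1 / 2 : ℝ)).toReal * ‖u‖ := by
  change ‖(memLp_comp_of_image_eq A h (Lp.memLp u)).toLp‖ = _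
  rw [Lp.norm_toLp, eLpNorm_comp_of_image_eq A h, ENNReal.toReal_mul, Lp.norm_def]

theorem pullbackH1_snd (A : E ≃L[ℝ] E) (h : Ω' = A '' Ω)
    (hA : ∀ x y, inner ℝ (A x) y = inner ℝ x (A y)) (u : H1 Ω') :
    (pullbackH1 A h hA u).1.2 = (A : E →L[ℝ] E).compLp (pullbackLp A E h u.1.2) := rfl

theorem norm_pullbackH1_snd_le (A : E ≃L[ℝ] E) (h : Ω' = A '' Ω)
    (hA : ∀ x y, inner ℝ (A x) y = inner ℝ x (A y)) (hA1 : ∀ x, ‖A x‖ ≤ ‖x‖) (u : H1 Ω') :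
    ‖(pullbackH1 A h hA u).1.2‖ ≤ ‖pullbackLp A E h u.1.2‖ := by
  rw [pullbackH1_snd]
  refine (ContinuousLinearMap.norm_compLp_le _ _).trans ?_
  refine mul_le_of_le_one_left (norm_nonneg _) ?_
  exact ContinuousLinearMap.opNorm_le_bound _ zero_le_one fun x => by
    rw [one_mul]; exact hA1 x

/-- The pulled back gradient is `A ∘ ∇u ∘ A`, so that its component in the direction `v` is the
component of `∇u ∘ A` in the direction `A v`. -/
theorem abs_inner_testDeriv_pullbackH1_le (A : E ≃L[ℝ] E) (h : Ω' = A '' Ω)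
    (hA : ∀ x y, inner ℝ (A x) y = inner ℝ x (A y)) (u : H1 Ω') (v : E)
    (φ : testFunctions Ω) :
    |inner ℝ (pullbackH1 A h hA u).1.1 (testToLp Ω (testDeriv v φ))| ≤
      ‖pullbackLp A E h u.1.2‖ * ‖A v‖ * ‖testToLp Ω φ‖ := by
  have hw : IsWeakGradient Ω (pullbackH1 A h hA u).1.1 (pullbackH1 A h hA u).1.2 :=
    (pullbackH1 A h hA u).2
  rw [inner_testDeriv, hw φ φ.2.1 φ.2.2.1 φ.2.2.2 v, abs_neg]
  set g : Lp ℝ 2 (volume.restrict Ω) :=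
    (innerSL ℝ (A v)).compLp (pullbackLp A E h u.1.2) with hg
  have h4 : ∫ x in Ω, inner ℝ ((pullbackH1 A h hA u).1.2 x) v * (φ : E → ℝ) x =
      inner ℝ g (testToLp Ω φ) := by
    rw [inner_testToLp]
    refine integral_congr_ae ?_
    filter_upwards [(A : E →L[ℝ] E).coeFn_compLp (pullbackLp A E h u.1.2),
      (innerSL ℝ (A v)).coeFn_compLp (pullbackLp A E h u.1.2)] with x hx hx'
    rw [pullbackH1_snd, hx, hg, hx', innerSL_apply_apply, real_inner_comm]
    congr 1
    exact (hA _ _).symm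
  rw [h4]
  refine (abs_real_inner_le_norm _ _).trans ?_
  refine mul_le_mul_of_nonneg_right ?_ (norm_nonneg _)
  refine (ContinuousLinearMap.norm_compLp_le _ _).trans ?_
  rw [innerSL_apply_norm, mul_comm]

/-- An admissible `k`-dimensional subspace of `H¹(A(Ω))` with Rayleigh quotients at most `lam`
provides an `L²(Ω)`-orthonormal family of functions on `Ω` for which the dual norm of the
derivative in the direction `v` is controlled by `‖A v‖`. -/
theorem exists_orthonormal_family (A : E ≃L[ℝ] E) (h : Ω' = A '' Ω)
    (hA : ∀ x y, inner ℝ (A x) y = inner ℝ x (A y)) (hA1 : ∀ x, ‖A x‖ ≤ ‖x‖) {k : ℕ} {lam : ℝ}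
    (hlam : 0 ≤ lam) (hk : neumannEigenvalue Ω' k < ENNReal.ofReal lam) :
    ∃ u : Fin k → H1 Ω, Orthonormal ℝ (fun i => (u i).1.1) ∧
      (∀ i, ∫ x in Ω, (u i).1.1 x = 0) ∧ (∀ i, ‖(u i).1.2‖ ≤ √lam) ∧
      ∀ (c : Fin k → ℝ) (v : E) (φ : testFunctions Ω),
        |inner ℝ (∑ i, c i • (u i).1.1) (testToLp Ω (testDeriv v φ))| ≤
          √lam * √(∑ i, c i ^ 2) * ‖A v‖ * ‖testToLp Ω φ‖ := by
  simp only [neumannEigenvalue, minmax, iInf_lt_iff] at hk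
  obtain ⟨V, ⟨hVf, hVk⟩, hVmean, hVray⟩ := hk
  have hray : ∀ u ∈ V, u ≠ 0 → u.1.1 ≠ 0 ∧ ‖u.1.2‖ ≤ √lam * ‖u.1.1‖ := fun u hu hu0 =>
    norm_le_of_rayleigh_le hlam
      (iSup_le_iff.1 (iSup_le_iff.1 (iSup_le_iff.1 hVray.le u) hu) hu0)
  set κ : ℝ := (jacobianFactor A ^ (1 / 2 : ℝ)).toReal with hκ
  have hκ0 : 0 < κ := ENNReal.toReal_pos
    (ENNReal.rpow_pos (pos_iff_ne_zero.2 (jacobianFactor_ne_zero A))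
      (jacobianFactor_ne_top A)).ne'
    (ENNReal.rpow_lt_top_of_nonneg (by norm_num) (jacobianFactor_ne_top A)).ne
  -- the `L²` parts of the pulled back subspace
  let T : V →ₗ[ℝ] Lp ℝ 2 (volume.restrict Ω) :=
    (pullbackLp A ℝ h).toLinearMap.comp
      ((LinearMap.fst ℝ _ _).comp ((H1 Ω').subtype.comp V.subtype))
  have hT : ∀ u : V, T u = pullbackLp A ℝ h u.1.1.1 := fun u => rfl
  have hinj : Function.Injective T := by
    rw [injective_iff_map_eq_zero]
    intro u hu
    by_contra hne
    have h1 := hray u u.2 (by simpa using hne)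
    refine h1.1 (norm_eq_zero.1 ?_)
    have h2 := norm_pullbackLp A h u.1.1.1
    rw [← hT, hu, norm_zero] at h2
    exact (mul_eq_zero.1 h2.symm).resolve_left hκ0.ne'
  have hrank : Module.finrank ℝ (LinearMap.range T) = k := by
    rw [LinearMap.finrank_range_of_inj hinj, hVk]
  let b : OrthonormalBasis (Fin k) ℝ (LinearMap.range T) :=
    (stdOrthonormalBasis ℝ (LinearMap.range T)).reindex (finCongr hrank)
  choose û hû using fun i => (b i).2
  have hon : Orthonormal ℝ (fun i => T (û i)) := by
    have h1 := b.orthonormal.comp_linearIsometry (LinearMap.range T).subtypeₗᵢ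
    convert h1 using 1
    funext i
    exact hû i
  have hsum : ∀ c : Fin k → ℝ, ‖T (∑ i, c i • û i)‖ = √(∑ i, c i ^ 2) := by
    intro c
    rw [eq_comm, Real.sqrt_eq_iff_mul_self_eq (Finset.sum_nonneg fun i _ => sq_nonneg _)
      (norm_nonneg _), ← real_inner_self_eq_norm_mul_norm, map_sum]
    simp only [map_smul]
    rw [hon.inner_sum]
    simp [sq]
  -- the pulled back gradient, before multiplication by `A`
  set G : V → Lp E 2 (volume.restrict Ω) := fun u => pullbackLp A E h u.1.1.2 with hG
  have hGle : ∀ u : V, ‖G u‖ ≤ √lam * ‖T u‖ := by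
    intro u
    rcases eq_or_ne u 0 with rfl | hu
    · have h1 : G 0 = 0 := map_zero (pullbackLp A E h)
      rw [h1, norm_zero]
      positivity
    · rw [hG, hT, norm_pullbackLp, norm_pullbackLp, mul_left_comm]
      exact mul_le_mul_of_nonneg_left (hray u u.2 (by simpa using hu)).2 hκ0.le
  refine ⟨fun i => pullbackH1 A h hA (û i).1, hon, fun i => ?_, fun i => ?_, fun c v φ => ?_⟩
  · have h1 := setIntegral_comp_of_image_eq A h (fun z => (û i).1.1.1 z)
    have h2 := hVmean (û i) (û i).2
    simp only [mul_one] at h2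
    rw [h2, mul_zero] at h1
    rw [← h1]
    exact integral_congr_ae (coeFn_pullbackLp A h (û i).1.1.1)
  · have h1 := hGle (û i)
    rw [hon.norm_eq_one i, mul_one] at h1
    exact (norm_pullbackH1_snd_le A h hA hA1 (û i).1).trans h1
  · have h1 : (∑ i, c i • (pullbackH1 A h hA (û i).1).1.1) =
        (pullbackH1 A h hA (∑ i, c i • û i : V).1).1.1 := by
      change ∑ i, c i • T (û i) = T (∑ i, c i • û i)
      rw [map_sum]
      simp only [map_smul]
    rw [h1]
    refine (abs_inner_testDeriv_pullbackH1_le A h hA _ v φ).trans ?_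
    rw [← hsum c]
    gcongr
    exact hGle _

/-- A sequence of orthonormal families as in `exists_orthonormal_family` has a limit point in
`L²(Ω)`, and the bounds pass to the limit. -/
theorem exists_limit_family (hΩ : IsNeumannDomain Ω) {k : ℕ} {lam : ℝ} {u : ℕ → Fin k → H1 Ω}
    {N : ℕ → E → ℝ} {N₀ : E → ℝ} (hN : ∀ v, Tendsto (fun j => N j v) atTop (𝓝 (N₀ v)))
    (hon : ∀ j, Orthonormal ℝ (fun i => (u j i).1.1))
    (hmean : ∀ j i, ∫ x in Ω, (u j i).1.1 x = 0) (hgrad : ∀ j i, ‖(u j i).1.2‖ ≤ √lam)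
    (hweak : ∀ j (c : Fin k → ℝ) (v : E) (φ : testFunctions Ω),
      |inner ℝ (∑ i, c i • (u j i).1.1) (testToLp Ω (testDeriv v φ))| ≤
        √lam * √(∑ i, c i ^ 2) * N j v * ‖testToLp Ω φ‖) :
    ∃ f : Fin k → Lp ℝ 2 (volume.restrict Ω), Orthonormal ℝ f ∧ (∀ i, ∫ x in Ω, f i x = 0) ∧
      ∀ (c : Fin k → ℝ) (v : E) (φ : testFunctions Ω),
        |inner ℝ (∑ i, c i • f i) (testToLp Ω (testDeriv v φ))| ≤
          √lam * √(∑ i, c i ^ 2) * N₀ v * ‖testToLp Ω φ‖ := by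
  have hfin : IsFiniteMeasure (volume.restrict Ω) :=
    ⟨by simpa using hΩ.isBounded.measure_lt_top⟩
  let ι : H1 Ω →ₗ[ℝ] Lp ℝ 2 (volume.restrict Ω) := (LinearMap.fst ℝ _ _).comp (H1 Ω).subtype
  have hι : IsCompactOperator ι := hΩ.compact_embedding
  obtain ⟨K, hK, hKsub⟩ := hι.image_closedBall_subset_compact (max 1 √lam)
  have hmem : ∀ j, (fun i => (u j i).1.1) ∈ Set.pi univ (fun _ : Fin k => K) := by
    intro j i _
    refine hKsub ⟨u j i, ?_, rfl⟩
    rw [mem_closedBall_zero_iff]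
    change max ‖(u j i).1.1‖ ‖(u j i).1.2‖ ≤ _
    exact max_le_max ((hon j).norm_eq_one i).le (hgrad j i)
  obtain ⟨f, -, σ, hσ, hlim⟩ := (isCompact_univ_pi fun _ : Fin k => hK).tendsto_subseq hmem
  have hlimi : ∀ i, Tendsto (fun j => (u (σ j) i).1.1) atTop (𝓝 (f i)) := fun i =>
    (tendsto_pi_nhds.1 hlim) i
  refine ⟨f, ?_, fun i => ?_, fun c v φ => ?_⟩
  · rw [orthonormal_iff_ite]
    intro i i'
    have h1 := (hlimi i).inner (𝕜 := ℝ) (hlimi i')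
    refine tendsto_nhds_unique h1 ?_
    simp only [orthonormal_iff_ite.1 (hon _) i i']
    exact tendsto_const_nhds
  · -- the mean is the inner product with the constant function `1`
    have h1 : ∀ g : Lp ℝ 2 (volume.restrict Ω), ∫ x in Ω, g x =
        inner ℝ (MemLp.toLp (fun _ => (1 : ℝ)) (memLp_const 1) :
          Lp ℝ 2 (volume.restrict Ω)) g := by
      intro g
      rw [L2.inner_def]
      refine integral_congr_ae ?_
      filter_upwards [(memLp_const (1 : ℝ) (p := 2) (μ := volume.restrict Ω)).coeFn_toLp]
        with x hx
      rw [hx]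
      simp
    have h2 := (tendsto_const_nhds (x := (MemLp.toLp (fun _ => (1 : ℝ)) (memLp_const 1) :
      Lp ℝ 2 (volume.restrict Ω)))).inner (𝕜 := ℝ) (hlimi i)
    rw [h1]
    refine tendsto_nhds_unique h2 ?_
    simp only [← h1, hmean]
    exact tendsto_const_nhds
  · have h1 : Tendsto (fun j => ∑ i, c i • (u (σ j) i).1.1) atTop (𝓝 (∑ i, c i • f i)) :=
      tendsto_finsetSum _ fun i _ => (hlimi i).const_smul (c i)
    have h2 := (h1.inner (𝕜 := ℝ) (tendsto_const_nhds (x := testToLp Ω (testDeriv v φ)))).abs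
    refine le_of_tendsto_of_tendsto h2 ?_ (Eventually.of_forall fun j => hweak (σ j) c v φ)
    exact (((hN v).comp hσ.tendsto_atTop).const_mul _).mul_const _

end Compactness

/-! ### The lower bound -/

section LowerBound

variable {n : ℕ} {Ω : Set (EuclideanSpace ℝ (Fin (n + 1)))}

theorem norm_stretch_le {ε : ℝ} (hε : 0 < ε) (hε1 : ε ≤ 1)
    (x : EuclideanSpace ℝ (Fin (n + 1))) : ‖stretch n ε hε.ne' x‖ ≤ ‖x‖ := by
  rw [stretch_apply, EuclideanSpace.norm_eq, EuclideanSpace.norm_eq, Fin.sum_univ_succ,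
    Fin.sum_univ_succ]
  refine Real.sqrt_le_sqrt (add_le_add le_rfl (Finset.sum_le_sum fun i _ => ?_))
  have h1 : point (x 0) (ε • transversal x) i.succ = ε * x i.succ := by
    simp [point, transversal]
  rw [h1, norm_mul, mul_pow, Real.norm_eq_abs ε, abs_of_pos hε]
  exact mul_le_of_le_one_left (sq_nonneg _) (pow_le_one₀ hε.le hε1)

theorem norm_point_zero (t : ℝ) : ‖point t (0 : EuclideanSpace ℝ (Fin n))‖ = |t| := by
  rw [EuclideanSpace.norm_eq, Fin.sum_univ_succ]
  simp [point, Real.sqrt_sq_eq_abs]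

theorem memLp_comp_apply_zero_iff {ν : Measure ℝ}
    (hmap : (volume.restrict Ω).map (fun x : EuclideanSpace ℝ (Fin (n + 1)) => x 0) = ν)
    {f : ℝ → ℝ} (hf : AEStronglyMeasurable f ν) :
    MemLp f 2 ν ↔ MemLp (fun x : EuclideanSpace ℝ (Fin (n + 1)) => f (x 0)) 2
      (volume.restrict Ω) := by
  subst hmap
  exact memLp_map_measure_iff hf continuous_apply_zero.measurable.aemeasurable

theorem integral_comp_apply_zero {ν : Measure ℝ}
    (hmap : (volume.restrict Ω).map (fun x : EuclideanSpace ℝ (Fin (n + 1)) => x 0) = ν)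
    {f : ℝ → ℝ} (hf : AEStronglyMeasurable f ν) :
    ∫ t, f t ∂ν = ∫ x in Ω, f (x 0) := by
  subst hmap
  exact integral_map continuous_apply_zero.measurable.aemeasurable hf

/-- An orthonormal family in `L²(Ω)` of mean zero whose linear combinations have weak gradients
parallel to `e₁` of norm at most `√lam` bounds the eigenvalue of the profile. -/
theorem sturmLiouvilleEigenvalue_le_of_family {h : ℝ → ℝ} {k : ℕ}
    (hbdd : MemLp h ⊤ (volume.restrict (Ioo (0 : ℝ) 1)))
    (hpos : ∀ᵐ t ∂volume.restrict (Ioo (0 : ℝ) 1), 0 < h t) (hΩ : IsNeumannDomain Ω)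
    (hproj : (fun x : EuclideanSpace ℝ (Fin (n + 1)) => x 0) '' Ω = Ioo 0 1)
    (hprofile : profile Ω =ᵐ[volume.restrict (Ioo (0 : ℝ) 1)] h)
    (hslice : ∀ᵐ t ∂(volume.restrict (Ioo (0 : ℝ) 1)), IsConnected (slice Ω t)) {lam : ℝ}
    (hlam : 0 ≤ lam) {f : Fin k → Lp ℝ 2 (volume.restrict Ω)} (hon : Orthonormal ℝ f)
    (hmean : ∀ i, ∫ x in Ω, f i x = 0)
    (hweak : ∀ (c : Fin k → ℝ) (v : EuclideanSpace ℝ (Fin (n + 1))) (φ : testFunctions Ω),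
      |inner ℝ (∑ i, c i • f i) (testToLp Ω (testDeriv v φ))| ≤
        √lam * √(∑ i, c i ^ 2) * |v 0| * ‖testToLp Ω φ‖) :
    sturmLiouvilleEigenvalue h k ≤ ENNReal.ofReal lam := by
  have hfin : IsFiniteMeasure (volume.restrict Ω) :=
    ⟨by simpa using hΩ.isBounded.measure_lt_top⟩
  have hmap := map_apply_zero_eq_weightMeasure hΩ.isOpen hΩ.isBounded hproj hprofile
  have hprim := fun i => exists_primitive_of_abs_le hΩ.isOpen hΩ.isBounded
    hΩ.isConnected.isPreconnected hproj hslice (f i) (Real.sqrt_nonneg lam) (fun v φ => by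
      have h1 := hweak (Pi.single i 1) v φ
      simpa [Pi.single_apply, ite_pow, inner_testDeriv] using h1)
  choose γ C hγm hγL hf hγφ using hprim
  have hγl := fun i => locallyIntegrableOn_of_memLp_comp hΩ.isOpen hproj (hγm i) (hγL i)
  have hγ2 := fun i => locallyIntegrableOn_sq_of_memLp_comp hΩ.isOpen hproj (hγm i) (hγL i)
  have hhalf : (1 / 2 : ℝ) ∈ Ioo (0 : ℝ) 1 := by constructor <;> norm_num
  set w : Fin k → ℝ → ℝ := fun i t => C i + ∫ s in (1 / 2 : ℝ)..t, γ i s with hw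
  have hwm : ∀ i, AEStronglyMeasurable (w i) (weightMeasure h) := fun i => by
    have h1 : ContinuousOn (w i) (Ioo 0 1) :=
      continuousOn_const.add (continuousOn_primitive (hγl i) hhalf)
    exact (h1.aestronglyMeasurable measurableSet_Ioo).mono_ac
      (weightMeasure_absolutelyContinuous h)
  have hwL : ∀ i, MemLp (w i) 2 (weightMeasure h) := fun i =>
    (memLp_comp_apply_zero_iff hmap (hwm i)).2 ((memLp_congr_ae (hf i)).1 (Lp.memLp (f i)))
  have hγν : ∀ i, MemLp (γ i) 2 (weightMeasure h) := fun i =>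
    (memLp_comp_apply_zero_iff hmap (hγm i).aestronglyMeasurable).2 (hγL i)
  refine sturmLiouvilleEigenvalue_le_of_primitives (γ := γ) (C := C) hbdd hpos hwL hγm hγl hγ2 hγν
    (fun i => ?_) (fun c => ?_) hlam (fun c => ?_)
  · rw [integral_comp_apply_zero hmap (hwm i), ← hmean i]
    exact (integral_congr_ae (hf i)).symm
  · have hm : AEStronglyMeasurable (fun t => (∑ i, c i * w i t) ^ 2) (weightMeasure h) :=
      (Finset.aestronglyMeasurable_fun_sum _ fun i _ => (hwm i).const_mul (c i)).pow 2
    rw [integral_comp_apply_zero hmap hm]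
    have h1 : ∫ x in Ω, (∑ i, c i * w i (x 0)) ^ 2 =
        inner ℝ (∑ i, c i • f i) (∑ i, c i • f i) := by
      rw [L2.inner_def]
      refine integral_congr_ae ?_
      filter_upwards [coeFn_sum_smul f c, ae_all_iff.2 hf] with x h1 h2
      rw [h1]
      simp only [h2, smul_eq_mul, hw]
      rw [real_inner_self_eq_norm_sq, Real.norm_eq_abs, sq_abs]
    rw [h1, hon.inner_sum]
    simp [sq]
  · -- `∑ cᵢ γᵢ(x₁)` is the weak derivative of `∑ cᵢ fᵢ`
    have hcL : MemLp (fun x : EuclideanSpace ℝ (Fin (n + 1)) => ∑ i, c i * γ i (x 0)) 2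
        (volume.restrict Ω) := memLp_finsetSum _ fun i _ => (hγL i).const_mul (c i)
    have hM : 0 ≤ √lam * √(∑ i, c i ^ 2) := by positivity
    have h1 : ‖hcL.toLp‖ ≤ √lam * √(∑ i, c i ^ 2) := by
      refine norm_le_of_abs_integral_le hΩ.isOpen _
        ((Lp.memLp hcL.toLp).integrable (by norm_num)) hM hΩ.isBounded.measure_lt_top
        fun φ => ?_
      have h2 := hweak c (point 1 0) φ
      rw [point_apply_zero, abs_one, mul_one] at h2
      refine le_trans (le_of_eq ?_) h2
      rw [← abs_neg, sum_inner]
      congr 1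
      have h3 : ∫ x in Ω, (hcL.toLp :) x * (φ : EuclideanSpace ℝ (Fin (n + 1)) → ℝ) x =
          ∑ i, c i * ∫ x in Ω, γ i (x 0) * (φ : EuclideanSpace ℝ (Fin (n + 1)) → ℝ) x := by
        simp only [← integral_const_mul]
        rw [← integral_finsetSum]
        · refine integral_congr_ae ?_
          filter_upwards [hcL.coeFn_toLp] with x hx
          rw [hx, Finset.sum_mul]
          exact Finset.sum_congr rfl fun i _ => by ring
        · exact fun i _ => (integrable_mul_test (hγL i) φ.2.1.continuous φ.2.2.1).const_mul _
      rw [h3, ← Finset.sum_neg_distrib]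
      refine Finset.sum_congr rfl fun i _ => ?_
      rw [real_inner_smul_left, inner_testDeriv, hγφ i φ, mul_neg]
    have hm : AEStronglyMeasurable (fun t => (∑ i, c i * γ i t) ^ 2) (weightMeasure h) :=
      (Finset.aestronglyMeasurable_fun_sum _ fun i _ =>
        (hγν i).1.const_mul (c i)).pow 2
    rw [integral_comp_apply_zero hmap hm]
    have h2 : ∫ x in Ω, (∑ i, c i * γ i (x 0)) ^ 2 = ‖hcL.toLp‖ ^ 2 := by
      rw [← real_inner_self_eq_norm_sq, L2.inner_def]
      refine integral_congr_ae ?_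
      filter_upwards [hcL.coeFn_toLp] with x hx
      rw [hx, real_inner_self_eq_norm_sq, Real.norm_eq_abs, sq_abs]
    rw [h2]
    calc ‖hcL.toLp‖ ^ 2 ≤ (√lam * √(∑ i, c i ^ 2)) ^ 2 :=
          pow_le_pow_left₀ (norm_nonneg _) h1 2
      _ = lam * ∑ i, c i ^ 2 := by
          rw [mul_pow, Real.sq_sqrt hlam,
            Real.sq_sqrt (Finset.sum_nonneg fun i _ => sq_nonneg _)]

/-- A bound for the Neumann eigenvalue along some sequence of thin domains is a bound for the
eigenvalue of the profile. -/
theorem sturmLiouvilleEigenvalue_le_of_frequently {h : ℝ → ℝ} {k : ℕ}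
    (hbdd : MemLp h ⊤ (volume.restrict (Ioo (0 : ℝ) 1)))
    (hpos : ∀ᵐ t ∂volume.restrict (Ioo (0 : ℝ) 1), 0 < h t) (hΩ : IsNeumannDomain Ω)
    (hproj : (fun x : EuclideanSpace ℝ (Fin (n + 1)) => x 0) '' Ω = Ioo 0 1)
    (hprofile : profile Ω =ᵐ[volume.restrict (Ioo (0 : ℝ) 1)] h)
    (hslice : ∀ᵐ t ∂(volume.restrict (Ioo (0 : ℝ) 1)), IsConnected (slice Ω t)) {lam : ℝ}
    (hlam : 0 ≤ lam)
    (hfreq : ∃ᶠ ε in 𝓝[>] (0 : ℝ), neumannEigenvalue (thin ε Ω) k < ENNReal.ofReal lam) :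
    sturmLiouvilleEigenvalue h k ≤ ENNReal.ofReal lam := by
  obtain ⟨e, he, hek⟩ := exists_seq_forall_of_frequently
    (hfreq.and_eventually (Ioc_mem_nhdsGT (one_pos (α := ℝ))))
  have he0 : Tendsto e atTop (𝓝 0) := he.mono_right nhdsWithin_le_nhds
  choose u hon hmean hgrad hweak using fun j => exists_orthonormal_family
    (stretch n (e j) (hek j).2.1.ne') (thin_eq_image (hek j).2.1.ne' Ω)
    (inner_stretch (hek j).2.1.ne') (norm_stretch_le (hek j).2.1 (hek j).2.2) hlam (hek j).1
  have hN : ∀ v : EuclideanSpace ℝ (Fin (n + 1)),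
      Tendsto (fun j => ‖stretch n (e j) (hek j).2.1.ne' v‖) atTop (𝓝 |v 0|) := by
    intro v
    have h1 : Tendsto (fun j => point (v 0) (e j • transversal v)) atTop
        (𝓝 (point (v 0) ((0 : ℝ) • transversal v))) :=
      ((continuous_point_right (v 0)).tendsto _).comp (he0.smul_const (transversal v))
    rw [zero_smul] at h1
    have h2 := h1.norm
    rwa [norm_point_zero] at h2
  obtain ⟨f, hf1, hf2, hf3⟩ := exists_limit_family hΩ hN hon hmean hgrad hweak
  exact sturmLiouvilleEigenvalue_le_of_family hbdd hpos hΩ hproj hprofile hslice hlam hf1 hf2 hf3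

end LowerBound

/-! ### The upper bound -/

section UpperBound

variable {n : ℕ} {Ω : Set (EuclideanSpace ℝ (Fin (n + 1)))}

theorem weightMeasure_le_smul {h : ℝ → ℝ} {B : ℝ}
    (hB : ∀ᵐ t ∂volume.restrict (Ioo (0 : ℝ) 1), h t ≤ B) :
    weightMeasure h ≤ ENNReal.ofReal B • volume.restrict (Ioo (0 : ℝ) 1) := by
  rw [weightMeasure, ← withDensity_const]
  refine withDensity_mono ?_
  filter_upwards [hB] with t ht
  exact ENNReal.ofReal_le_ofReal ht

theorem weightMeasure_const_mul {h : ℝ → ℝ} {c : ℝ} (hc : 0 ≤ c) :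
    weightMeasure (fun t => c * h t) = ENNReal.ofReal c • weightMeasure h := by
  rw [weightMeasure, weightMeasure, ← withDensity_smul' _ _ ENNReal.ofReal_ne_top]
  congr 1
  funext t
  rw [ENNReal.ofReal_mul hc]
  rfl

theorem exists_ae_le_of_memLp_top {α : Type*} {_ : MeasurableSpace α} {μ : Measure α} {h : α → ℝ}
    (hbdd : MemLp h ⊤ μ) : ∃ B : ℝ, ∀ᵐ t ∂μ, h t ≤ B := by
  have hlt : eLpNormEssSup h μ < ⊤ := by
    have := hbdd.2
    rwa [eLpNorm_exponent_top] at this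
  refine ⟨(eLpNormEssSup h μ).toReal, ?_⟩
  filter_upwards [ae_le_eLpNormEssSup (f := h) (μ := μ)] with t ht
  refine (le_abs_self _).trans ?_
  rw [← Real.norm_eq_abs, ← toReal_enorm]
  exact ENNReal.toReal_mono hlt.ne ht

theorem lintegral_comp_apply_zero {h : ℝ → ℝ}
    (hm : AEMeasurable h (volume.restrict (Ioo (0 : ℝ) 1))) {κ : ℝ≥0∞}
    (hmap : (volume.restrict Ω).map (fun x : EuclideanSpace ℝ (Fin (n + 1)) => x 0) =
      κ • weightMeasure h) {F : ℝ → ℝ≥0∞}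
    (hF : AEMeasurable F (volume.restrict (Ioo (0 : ℝ) 1))) :
    ∫⁻ x in Ω, F (x 0) = κ * ∫⁻ t in Ioo (0 : ℝ) 1, F t * ENNReal.ofReal (h t) := by
  have hac : (volume.restrict Ω).map (fun x : EuclideanSpace ℝ (Fin (n + 1)) => x 0) ≪
      volume.restrict (Ioo (0 : ℝ) 1) := by
    rw [hmap]
    exact Measure.smul_absolutelyContinuous.trans (weightMeasure_absolutelyContinuous h)
  rw [← lintegral_map' (hF.mono_ac hac) continuous_apply_zero.measurable.aemeasurable, hmap,
    lintegral_smul_measure, lintegral_mul_ofReal_eq hm hF, smul_eq_mul]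

theorem rayleigh_eq_of_comp_apply_zero {h : ℝ → ℝ}
    (hm : AEMeasurable h (volume.restrict (Ioo (0 : ℝ) 1))) {κ : ℝ≥0∞} (hκ0 : κ ≠ 0)
    (hκ : κ ≠ ⊤)
    (hmap : (volume.restrict Ω).map (fun x : EuclideanSpace ℝ (Fin (n + 1)) => x 0) =
      κ • weightMeasure h) {U : H1 Ω} {u : H1 (Ioo (0 : ℝ) 1)}
    (hU1 : U.1.1 =ᵐ[volume.restrict Ω] (fun x => u.1.1 (x 0)))
    (hU2 : U.1.2 =ᵐ[volume.restrict Ω] (fun x => point (u.1.2 (x 0)) 0)) :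
    rayleigh Ω (fun _ => 1) U = rayleigh (Ioo (0 : ℝ) 1) h u := by
  have hden : ∫⁻ x in Ω, ‖U.1.1 x‖ₑ ^ 2 * ENNReal.ofReal 1 =
      κ * ∫⁻ t in Ioo (0 : ℝ) 1, ‖u.1.1 t‖ₑ ^ 2 * ENNReal.ofReal (h t) := by
    rw [← lintegral_comp_apply_zero hm hmap ((Lp.aestronglyMeasurable _).enorm.pow_const 2)]
    refine lintegral_congr_ae ?_
    filter_upwards [hU1] with x hx
    rw [hx, ENNReal.ofReal_one, mul_one]
  have hnum : ∫⁻ x in Ω, ‖U.1.2 x‖ₑ ^ 2 * ENNReal.ofReal 1 =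
      κ * ∫⁻ t in Ioo (0 : ℝ) 1, ‖u.1.2 t‖ₑ ^ 2 * ENNReal.ofReal (h t) := by
    rw [← lintegral_comp_apply_zero hm hmap ((Lp.aestronglyMeasurable _).enorm.pow_const 2)]
    refine lintegral_congr_ae ?_
    filter_upwards [hU2] with x hx
    rw [hx, ENNReal.ofReal_one, mul_one, ← ofReal_norm, norm_point_zero,
      ← Real.norm_eq_abs, ofReal_norm]
  simp only [rayleigh]
  rw [hden, hnum, ENNReal.mul_div_mul_left _ _ hκ0 hκ]
  simp only [mul_eq_zero, hκ0, false_or]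

/-- A function in `H¹(0, 1)`, seen as a function of `x₁`, belongs to `H¹(Ω)`. -/
theorem exists_H1_comp_apply_zero
    (hproj : (fun x : EuclideanSpace ℝ (Fin (n + 1)) => x 0) '' Ω = Ioo 0 1) {c : ℝ≥0∞}
    (hc : c ≠ ⊤)
    (hle : (volume.restrict Ω).map (fun x : EuclideanSpace ℝ (Fin (n + 1)) => x 0) ≤
      c • volume.restrict (Ioo (0 : ℝ) 1)) (u : H1 (Ioo (0 : ℝ) 1)) :
    ∃ U : H1 Ω, U.1.1 =ᵐ[volume.restrict Ω] (fun x => u.1.1 (x 0)) ∧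
      U.1.2 =ᵐ[volume.restrict Ω] (fun x => point (u.1.2 (x 0)) 0) := by
  have hm : Measurable (fun x : EuclideanSpace ℝ (Fin (n + 1)) => x 0) :=
    continuous_apply_zero.measurable
  have hL : ∀ g : Lp ℝ 2 (volume.restrict (Ioo (0 : ℝ) 1)),
      MemLp (fun x : EuclideanSpace ℝ (Fin (n + 1)) => g (x 0)) 2 (volume.restrict Ω) := fun g =>
    (memLp_map_measure_iff (Lp.stronglyMeasurable g).aestronglyMeasurable hm.aemeasurable).1
      (MemLp.of_measure_le_smul hc hle (Lp.memLp g))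
  have hloc : ∀ g : Lp ℝ 2 (volume.restrict (Ioo (0 : ℝ) 1)),
      LocallyIntegrableOn g (Ioo 0 1) := fun g =>
    IntegrableOn.locallyIntegrableOn ((Lp.memLp g).integrable (by norm_num))
  have h1 := hL u.1.1
  have h2 : MemLp (fun x : EuclideanSpace ℝ (Fin (n + 1)) =>
      point (u.1.2 (x 0)) (0 : EuclideanSpace ℝ (Fin n))) 2 (volume.restrict Ω) := by
    refine (hL u.1.2).of_le_mul (c := 1) ?_ (Eventually.of_forall fun x => ?_)
    · exact (continuous_point_left 0).comp_aestronglyMeasurable (hL u.1.2).1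
    · rw [norm_point_zero, one_mul, Real.norm_eq_abs]
  have hu : IsWeakGradient (Ioo (0 : ℝ) 1) u.1.1 u.1.2 := u.2
  have h3 := hu.comp_apply_zero hproj (hloc u.1.1) (hloc u.1.2)
  exact ⟨⟨(h1.toLp, h2.toLp), h3.congr_ae h1.coeFn_toLp.symm h2.coeFn_toLp.symm⟩,
    h1.coeFn_toLp, h2.coeFn_toLp⟩

theorem sum_smul_fst_ae_eq_comp {k : ℕ}
    (hqmp : Measure.QuasiMeasurePreserving (fun x : EuclideanSpace ℝ (Fin (n + 1)) => x 0)
      (volume.restrict Ω) (volume.restrict (Ioo (0 : ℝ) 1)))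
    {u : Fin k → H1 (Ioo (0 : ℝ) 1)} {U : Fin k → H1 Ω}
    (hU : ∀ i, (U i).1.1 =ᵐ[volume.restrict Ω] (fun x => (u i).1.1 (x 0))) (c : Fin k → ℝ) :
    (∑ i, c i • U i).1.1 =ᵐ[volume.restrict Ω] fun x => (∑ i, c i • u i).1.1 (x 0) := by
  rw [fst_sum_smul, fst_sum_smul]
  have h1 := hqmp.ae_eq_comp (coeFn_sum_smul (fun i => (u i).1.1) c)
  filter_upwards [coeFn_sum_smul (fun i => (U i).1.1) c, ae_all_iff.2 hU, h1] with x h2 h3 h4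
  simp only [Function.comp_apply] at h4
  rw [h2, h4]
  simp only [h3]

theorem sum_smul_snd_ae_eq_comp {k : ℕ}
    (hqmp : Measure.QuasiMeasurePreserving (fun x : EuclideanSpace ℝ (Fin (n + 1)) => x 0)
      (volume.restrict Ω) (volume.restrict (Ioo (0 : ℝ) 1)))
    {u : Fin k → H1 (Ioo (0 : ℝ) 1)} {U : Fin k → H1 Ω}
    (hU : ∀ i, (U i).1.2 =ᵐ[volume.restrict Ω] (fun x => point ((u i).1.2 (x 0)) 0))
    (c : Fin k → ℝ) :
    (∑ i, c i • U i).1.2 =ᵐ[volume.restrict Ω]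
      fun x => point ((∑ i, c i • u i).1.2 (x 0)) 0 := by
  rw [snd_sum_smul, snd_sum_smul]
  have h1 := hqmp.ae_eq_comp (coeFn_sum_smul (fun i => (u i).1.2) c)
  filter_upwards [coeFn_sum_smul (fun i => (U i).1.2) c, ae_all_iff.2 hU, h1] with x h2 h3 h4
  simp only [Function.comp_apply] at h4
  rw [h2, h4]
  simp only [h3]
  ext j
  refine Fin.cases ?_ (fun j => ?_) j <;> simp [point]

theorem exists_linearIndependent_of_finrank_eq {E : Type*} [AddCommGroup E] [Module ℝ E]
    {V : Submodule ℝ E} {k : ℕ} (hf : Module.Finite ℝ V) (hk : Module.finrank ℝ V = k) :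
    ∃ u : Fin k → E, LinearIndependent ℝ u ∧ ∀ c : Fin k → ℝ, ∑ i, c i • u i ∈ V := by
  let b := Module.finBasisOfFinrankEq ℝ V hk
  exact ⟨fun i => b i, b.linearIndependent.map' V.subtype V.ker_subtype,
    fun c => V.sum_mem fun i _ => V.smul_mem _ (b i).2⟩

/-- Functions of `x₁` alone are admissible for the Neumann problem on a domain whose profile
function is proportional to `h`. -/
theorem neumannEigenvalue_le_sturmLiouvilleEigenvalue
    (hproj : (fun x : EuclideanSpace ℝ (Fin (n + 1)) => x 0) '' Ω = Ioo 0 1) {h : ℝ → ℝ}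
    (hbdd : MemLp h ⊤ (volume.restrict (Ioo (0 : ℝ) 1)))
    (hnonneg : ∀ᵐ t ∂volume.restrict (Ioo (0 : ℝ) 1), 0 ≤ h t) {κ : ℝ≥0∞} (hκ0 : κ ≠ 0)
    (hκ : κ ≠ ⊤)
    (hmap : (volume.restrict Ω).map (fun x : EuclideanSpace ℝ (Fin (n + 1)) => x 0) =
      κ • weightMeasure h) (k : ℕ) :
    neumannEigenvalue Ω k ≤ sturmLiouvilleEigenvalue h k := by
  have hm : AEMeasurable h (volume.restrict (Ioo (0 : ℝ) 1)) := hbdd.1.aemeasurable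
  have hcoord : Measurable (fun x : EuclideanSpace ℝ (Fin (n + 1)) => x 0) :=
    continuous_apply_zero.measurable
  have hac : (volume.restrict Ω).map (fun x : EuclideanSpace ℝ (Fin (n + 1)) => x 0) ≪
      volume.restrict (Ioo (0 : ℝ) 1) := by
    rw [hmap]
    exact Measure.smul_absolutelyContinuous.trans (weightMeasure_absolutelyContinuous h)
  have hqmp : Measure.QuasiMeasurePreserving
      (fun x : EuclideanSpace ℝ (Fin (n + 1)) => x 0) (volume.restrict Ω)
      (volume.restrict (Ioo (0 : ℝ) 1)) := ⟨hcoord, hac⟩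
  obtain ⟨c, hc, hle⟩ : ∃ c : ℝ≥0∞, c ≠ ⊤ ∧
      (volume.restrict Ω).map (fun x : EuclideanSpace ℝ (Fin (n + 1)) => x 0) ≤
        c • volume.restrict (Ioo (0 : ℝ) 1) := by
    obtain ⟨B, hbound⟩ := exists_ae_le_of_memLp_top hbdd
    refine ⟨κ * ENNReal.ofReal B, ENNReal.mul_ne_top hκ ENNReal.ofReal_ne_top, ?_⟩
    rw [hmap, mul_smul]
    exact smul_le_smul_left κ (weightMeasure_le_smul hbound)
  refine le_iInf fun V => le_iInf fun hV => le_iInf fun hVmean => ?_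
  set R : ℝ≥0∞ := ⨆ (u : H1 (Ioo (0 : ℝ) 1)) (_ : u ∈ V) (_ : u ≠ 0),
    rayleigh (Ioo (0 : ℝ) 1) h u with hR
  -- when `R = ∞` the bound is trivial, and `minmax_le_of_family` would not apply
  rcases eq_or_ne R ⊤ with hRt | hRt
  · rw [hRt]; exact le_top
  obtain ⟨hVf, hVk⟩ := hV
  obtain ⟨u, hu, hmem⟩ := exists_linearIndependent_of_finrank_eq hVf hVk
  choose U hU1 hU2 using fun i => exists_H1_comp_apply_zero hproj hc hle (u i)
  have hsum1 := sum_smul_fst_ae_eq_comp hqmp hU1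
  have hsum2 := sum_smul_snd_ae_eq_comp hqmp hU2
  refine minmax_le_of_family (u := U) hRt (fun c => ?_) (fun c hc0 => ?_)
  · simp only [mul_one]
    rw [integral_congr_ae (hsum1 c), ← integral_comp_apply_zero hmap
      (Lp.stronglyMeasurable _).aestronglyMeasurable, integral_smul_measure,
      ← integral_mul_eq hm hnonneg, hVmean _ (hmem c), smul_zero]
  · have hu0 : ∑ i, c i • u i ≠ 0 := fun h0 =>
      hc0 (funext (Fintype.linearIndependent_iff.1 hu c h0))
    rw [rayleigh_eq_of_comp_apply_zero hm hκ0 hκ hmap (hsum1 c) (hsum2 c), hR]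
    exact le_iSup_of_le _ (le_iSup_of_le (hmem c) (le_iSup_of_le hu0 le_rfl))

end UpperBound

end ThinNeumann

end

theorem mainTheorem7 (n k : ℕ) (hk : 1 ≤ k) (h : ℝ → ℝ)
    (hbdd : MemLp h ⊤ (volume.restrict (Ioo (0 : ℝ) 1)))
    (hnonneg : ∀ᵐ t ∂(volume.restrict (Ioo (0 : ℝ) 1)), 0 ≤ h t)
    (hne : ¬ h =ᵐ[volume.restrict (Ioo (0 : ℝ) 1)] 0)
    (Ω : Set (EuclideanSpace ℝ (Fin (n + 1))))
    (hΩ : ThinNeumann.IsNeumannDomain Ω)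
    (hproj : (fun x : EuclideanSpace ℝ (Fin (n + 1)) => x 0) '' Ω = Ioo 0 1)
    (hprofile : ThinNeumann.profile Ω =ᵐ[volume.restrict (Ioo (0 : ℝ) 1)] h)
    (hslice : ∀ᵐ t ∂(volume.restrict (Ioo (0 : ℝ) 1)), IsConnected (ThinNeumann.slice Ω t)) :
    (∀ ε : ℝ, 0 < ε → ThinNeumann.IsNeumannDomain (ThinNeumann.thin ε Ω) ∧
      ThinNeumann.profile (ThinNeumann.thin ε Ω)
        =ᵐ[volume.restrict (Ioo (0 : ℝ) 1)] fun t => ε ^ n * h t) ∧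
    Tendsto (fun ε : ℝ => ENNReal.ofReal (Metric.diam (ThinNeumann.thin ε Ω)) ^ 2 *
        ThinNeumann.neumannEigenvalue (ThinNeumann.thin ε Ω) k)
      (𝓝[>] 0) (𝓝 (ThinNeumann.sturmLiouvilleEigenvalue h k)) := by
  have hprof : ∀ ε : ℝ, 0 < ε → ThinNeumann.profile (ThinNeumann.thin ε Ω)
      =ᵐ[volume.restrict (Ioo (0 : ℝ) 1)] fun t => ε ^ n * h t := fun ε hε => by
    filter_upwards [hprofile] with t ht
    rw [ThinNeumann.profile_thin hε, ht]
  have hdom : ∀ ε : ℝ, 0 < ε → ThinNeumann.IsNeumannDomain (ThinNeumann.thin ε Ω) :=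
    fun ε hε => ThinNeumann.isNeumannDomain_thin hΩ hε.ne'
  refine ⟨fun ε hε => ⟨hdom ε hε, hprof ε hε⟩, ?_⟩
  -- the slices are open and nonempty, so that `h` is positive almost everywhere
  have hpos : ∀ᵐ t ∂volume.restrict (Ioo (0 : ℝ) 1), 0 < h t := by
    filter_upwards [hprofile, ae_restrict_mem measurableSet_Ioo] with t ht htI
    rw [← ht]
    exact ThinNeumann.profile_pos hΩ.isOpen hΩ.isBounded hproj htI
  have hprojε : ∀ ε : ℝ, 0 < ε → (fun x : EuclideanSpace ℝ (Fin (n + 1)) => x 0) ''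
      ThinNeumann.thin ε Ω = Ioo 0 1 := fun ε hε => by
    rw [ThinNeumann.image_apply_zero_thin hε.ne', hproj]
  have hupper : ∀ ε : ℝ, 0 < ε → ThinNeumann.neumannEigenvalue (ThinNeumann.thin ε Ω) k ≤
      ThinNeumann.sturmLiouvilleEigenvalue h k := fun ε hε => by
    refine ThinNeumann.neumannEigenvalue_le_sturmLiouvilleEigenvalue
      (hprojε ε hε) hbdd hnonneg (κ := ENNReal.ofReal (ε ^ n)) ?_ ENNReal.ofReal_ne_top ?_ k
    · simpa using pow_pos hε n
    · rw [ThinNeumann.map_apply_zero_eq_weightMeasure (hdom ε hε).isOpen (hdom ε hε).isBounded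
        (hprojε ε hε) (hprof ε hε), ThinNeumann.weightMeasure_const_mul (pow_pos hε n).le]
  have hdiam : ∀ ε : ℝ, 0 < ε →
      1 ≤ ENNReal.ofReal (Metric.diam (ThinNeumann.thin ε Ω)) ^ 2 := fun ε hε => by
    refine one_le_pow_of_one_le' ?_ 2
    rw [← ENNReal.ofReal_one]
    exact ENNReal.ofReal_le_ofReal
      (ThinNeumann.one_le_diam (hdom ε hε).isBounded (hprojε ε hε))
  have hbound : Tendsto (fun ε : ℝ => ENNReal.ofReal (1 + ε * Metric.diam Ω) ^ 2 *
      ThinNeumann.sturmLiouvilleEigenvalue h k) (𝓝[>] 0)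
      (𝓝 (ThinNeumann.sturmLiouvilleEigenvalue h k)) := by
    have h1 : Tendsto (fun ε : ℝ => 1 + ε * Metric.diam Ω) (𝓝[>] 0) (𝓝 1) := by
      have h2 : Continuous (fun ε : ℝ => 1 + ε * Metric.diam Ω) := by fun_prop
      simpa using (h2.tendsto 0).mono_left (nhdsWithin_le_nhds (s := Ioi 0))
    have h3 : Tendsto (fun ε : ℝ => ENNReal.ofReal (1 + ε * Metric.diam Ω) ^ 2) (𝓝[>] 0)
        (𝓝 1) := by
      simpa using ENNReal.Tendsto.pow (n := 2) (ENNReal.tendsto_ofReal h1)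
    simpa using ENNReal.Tendsto.mul_const h3 (Or.inl one_ne_zero)
  refine tendsto_order.2 ⟨fun a ha => ?_, fun a ha => ?_⟩
  · -- otherwise, for some `r` above `a` and below the eigenvalue of `h`, the Neumann eigenvalue is
    -- less than `r` for arbitrarily small `ε`
    by_contra hcon
    obtain ⟨r, hr1, hr2⟩ := ENNReal.lt_iff_exists_nnreal_btwn.1 ha
    refine hr2.not_ge ?_
    rw [← ENNReal.ofReal_coe_nnreal] at hr1 ⊢
    refine ThinNeumann.sturmLiouvilleEigenvalue_le_of_frequently hbdd hpos hΩ hproj hprofile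
      hslice r.coe_nonneg ?_
    refine ((not_eventually.1 hcon).and_eventually self_mem_nhdsWithin).mono ?_
    rintro ε ⟨h1, hε⟩
    exact (le_mul_of_one_le_left' (hdiam ε hε)).trans_lt ((not_lt.1 h1).trans_lt hr1)
  · filter_upwards [hbound.eventually_lt_const ha, self_mem_nhdsWithin] with ε h1 hε
    refine lt_of_le_of_lt (mul_le_mul' (pow_le_pow_left' (ENNReal.ofReal_le_ofReal ?_) 2)
      (hupper ε hε)) h1
    exact ThinNeumann.diam_thin_le hΩ.isBounded hproj hε
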